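/- **Setting.** Let $\Omega\subset\mathbb R^2$ be a polygon with a conforming triangulation $\mathcal T^H_0$; let $\mathcal E_p$ be its set of edges and $\mathcal E_p^0$ the set of those not on $\partial\Omega$. Joining the centroid of each triangle to its vertices gives the coarse mesh $\mathcal T^H$ (elements $K$, edges $\mathcal E^H\supset\mathcal E_p$). Let $\mathcal T^h$ be a conforming triangulation refining $\mathcal T^H$, with largest triangle diameter $h$. For $E\in\mathcal E^H$ let $\omega_E$ be the union of the $K\in\mathcal T^H$ having the edge $E$. Let $\kappa,\rho$ be measurable, positive, and bounded above and away from zero on $\Omega$; $\|v\|_V^2=\int_\Omega\kappa|v|^2$, $\|q\|_Q^2=\int_\Omega\rho q^2$. Let $T>0$ and $f\in C^1([0,T];L^2(\Omega))$. Dots denote time derivatives, $n$ unit normals, and $[w\cdot n]$ the sum of the two outward normal components. **Fine spaces.** $\widehat V_h$: lowest order Raviart–Thomas fields on $\mathcal T^h$ whose normal components are continuous across all fine edges except those lying on $\mathcal E^0_p$. $Q_h$: piecewise constants on $\mathcal T^h$. $\widetilde Q_{h,0}$: functions supported on the fine triangles with an edge on $\mathcal E_p$, affine with zero mean on each of them,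 constant on each such edge, continuous on the edges on $\mathcal E^0_p$, zero on those on $\partial\Omega$. $\widehat Q_{h,0}=Q_h\oplus\widetilde Q_{h,0}$, and $q=q^{(I)}+q^{(B)}$ is the corresponding decomposition. $V_h(K)$ and $Q_h(K)$ are the Raviart–Thomas and piecewise constant spaces of the fine mesh in $K$; $V_{h,0}(K)\subset V_h(K)$ consists of the fields with zero normal component on $\partial K$. **Schemes.** For $V\subset\widehat V_h$ and $Q\subset\widehat Q_{h,0}$ the scheme on $V\times Q$ is: $v(t)\in V$, $p(t)\in Q$, $v(0)=0$, $p(0)=0$ and, for $0\le t\le T$, $$\int_\Omega\kappa\dot v\cdot w-\int_\Omega p^{(I)}\nabla\cdot w+\sum_{E\in\mathcal E_p^0}\int_E p^{(B)}[w\cdot n]=0\quad\forall w\in V,$$ $$\int_\Omega\rho\dot p\,q+\int_\Omega q^{(I)}\nabla\cdot v-\sum_{E\in\mathcal E_p^0}\int_E q^{(B)}[v\cdot n]=\int_\Omega fq\quad\forall q\in Q.$$ The reference solution $(v_h,p_h)$, assumed $C^2$ in time, solves it on $\widehat V_h\times\widehat Q_{h,0}$ (here $\nabla\cdot$ is taken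 on each fine triangle). **Basis functions.** Fix a unit normal $n_E$ of each $E\in\mathcal E^H$. A *local solution* with data $(g,c)$ at $E$ is a field $\phi$ supported in $\omega_E$ such that, for each $K\subset\omega_E$, $\phi|_K\in V_h(K)$, $\nabla\cdot\phi=c_K$ on $K$, $\phi\cdot n_E=g$ on $E$, $\phi\cdot n=0$ on $\partial K\setminus E$, and for some $p\in Q_h(K)$, $\int_K\kappa\phi\cdot w=\int_Kp\nabla\cdot w$ for all $w\in V_{h,0}(K)$. 1. $\phi_E^{(1)}$ is the local solution with $g=1$ and $c_K=(n_E\cdot n_K)|E|/|K|$, where $n_K$ is the normal of $E$ outward from $K$. 2. Let $N_E+1$ be the number of fine edges in $E$, and let $V^{(2)}_{E,\rm snap}$ consist of the local solutions with $c=0$ and $g$ piecewise constant of zero mean on $E$. Then $\phi^{(2)}_{E,j}$, with eigenvalues $\lambda_{E,1}\le\dots\le\lambda_{E,N_E}$, are the eigenfunctions in $V^{(2)}_{E,\rm snap}$ of $\int_E(\phi\cdot n)(w\cdot n)=\lambda\int_{\omega_E}\kappa\phi\cdot w$ for all $w\in V^{(2)}_{E,\rm snap}$, normalised by $\int_E(\phi_{E,i}^{(2)}\cdot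 n)(\phi_{E,j}^{(2)}\cdot n)=\delta_{ij}$. 3. Let $M_K+1=\dim Q_h(K)$ and let $\overline Q_h(K)\subset Q_h(K)$ be the functions with $\int_Kq=0$. Then $(\phi_{K,j}^{(3)},p_{K,j}^{(3)})\in V_{h,0}(K)\times\overline Q_h(K)$, with $\mu_{K,1}\le\dots\le\mu_{K,M_K}$, are the eigenpairs of $\int_K\kappa\phi\cdot w=\int_Kp\nabla\cdot w$ for all $w\in V_{h,0}(K)$, $\int_Kq\nabla\cdot\phi=\mu\int_K\rho pq$ for all $q\in\overline Q_h(K)$, normalised by $\int_K\rho\,p^{(3)}_{K,i}p^{(3)}_{K,j}=\delta_{ij}$. For $E\in\mathcal E_p^0$ let $p_E^{(1)},p_{E,j}^{(2)}\in\widetilde Q_{h,0}$ be supported on the fine triangles with an edge in $E$ and equal on $E$ to $1$ and $\phi^{(2)}_{E,j}\cdot n_E$. Choose $0\le n_E\le N_E$ and $0\le m_K\le M_K$. $V_H$ is spanned by the $\phi_E^{(1)}$, $\phi_{E,j}^{(2)}$ $(j\le n_E)$ and $\phi_{K,j}^{(3)}$ $(j\le m_K)$, where for $E\in\mathcal E_p^0$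 the functions $\phi_E^{(1)},\phi_{E,j}^{(2)}$ are replaced by their restrictions to each of the two coarse elements in $\omega_E$. $Q_H$ is spanned by the piecewise constants on $\mathcal T^H$, the $p_{K,j}^{(3)}$ $(j\le m_K)$ and, for $E\in\mathcal E_p^0$, the $p_E^{(1)}$ and $p_{E,j}^{(2)}$ $(j\le n_E)$. Let $(v_H,p_H)$ solve the scheme on $V_H\times Q_H$ (the mixed GMsFEM). **Interpolants.** $$\pi(p_h^{(I)})=\sum_K\Big(a_{K,0}1_K+\sum_{j\le m_K}a_{K,j}p_{K,j}^{(3)}\Big),\qquad \pi(p_h^{(B)})=\sum_{E\in\mathcal E^0_p}\Big(b_{E,0}p_E^{(1)}+\sum_{j\le n_E}b_{E,j}p_{E,j}^{(2)}\Big),$$ $$\pi(v_h)|_K=\sum_{E\subset\partial K}\Big(c_{E,0}\phi_E^{(1)}+\sum_{j\le n_E}c_{E,j}\phi_{E,j}^{(2)}\Big)+\sum_{j\le m_K}d_{K,j}\phi_{K,j}^{(3)},$$ where $a_{K,0}$ is the average of $p_h^{(I)}$ on $K$, $a_{K,j}=\int_K\rho(p_h^{(I)}-a_{K,0})p^{(3)}_{K,j}$,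 $b_{E,0}$ is the average of $p_h^{(B)}$ on $E$, $b_{E,j}=\int_Ep_h^{(B)}\phi^{(2)}_{E,j}\cdot n_E$, $c_{E,0}$ is the average of $v_h\cdot n_E$ on $E$, $c_{E,j}=\int_E(v_h\cdot n)(\phi_{E,j}^{(2)}\cdot n)$ (both with the trace of $v_h$ from $K$), and $d_{K,j}=\mu_{K,j}^{-1}\int_Kp_{K,j}^{(3)}\nabla\cdot v_h$. **Theorem.** There is a constant $C$, depending only on $T$ and an upper bound of $\rho$ (in particular independent of the meshes), such that $$\begin{aligned}\max_{0\le t\le T}&\Big(\|\pi(v_h)-v_H\|_V^2+\|\pi(p_h^{(I)})+\pi(p_h^{(B)})-p_H\|_Q^2\Big)\\ \le C\Big[&\Big(\max_{E\in\mathcal E^H}\lambda_{E,n_E+1}^{-1}\Big)\sum_{E\in\mathcal E^H}\int_0^T\!\!\int_E(\dot v_h\cdot n)^2+h\Big(\max_{E\in\mathcal E^H}\lambda_{E,n_E+1}^{-1}\Big)\int_0^T\|\ddot v_h\|_V^2\\&+\Big(\max_{K\in\mathcal T^H}\mu_{K,m_K+1}^{-1}\Big)\int_0^T\Big(\|\rho^{-1}\dot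 f-\ddot p_h\|_Q^2+\|\ddot v_h\|_V^2\Big)\Big].\end{aligned}$$ Here $\lambda_{E,N_E+1}^{-1}=\mu_{K,M_K+1}^{-1}=0$, and where $\dot v_h\cdot n$ is two-valued on $E$, $(\dot v_h\cdot n)^2$ is the average of the squares of the two values. -/

import Mathlib

open MeasureTheory Set
open scoped RealInnerProductSpace

namespace MixedGMsFEM

noncomputable section

open Classical

/-! ## Triangles, edges and triangulations of plane polygons -/

abbrev Plane := EuclideanSpace ℝ (Fin 2)

/-- The closed convex polygon (triangle or edge) spanned by a finite set of vertices. -/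
abbrev hull (s : Finset Plane) : Set Plane := convexHull ℝ (s : Set Plane)

/-- Mean of the vertices: the centroid of a triangle, the midpoint of an edge. -/
def center (s : Finset Plane) : Plane := (s.card : ℝ)⁻¹ • ∑ x ∈ s, x

/-- Area of the triangle with vertex set `τ`. -/
def area (τ : Finset Plane) : ℝ := (volume (hull τ)).toReal

/-- Length of the edge with vertex set `e`. -/
def len (e : Finset Plane) : ℝ := Metric.diam (e : Set Plane)

/-- The edges of a finite family of triangles. -/
def edges (T : Finset (Finset Plane)) : Finset (Finset Plane) :=
  T.biUnion fun τ => τ.powersetCard 2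

/-- The unit normal vector of the edge `e` of the triangle `τ` that points out of `τ`: the
component orthogonal to `e` of the vector from the centroid of `τ` to the midpoint of `e`,
normalised. -/
def outwardNormal (τ e : Finset Plane) : Plane :=
  let d : Plane := (vectorSpan ℝ (e : Set Plane))ᗮ.starProjection (center e - center τ)
  ‖d‖⁻¹ • d

/-- A conforming triangulation (of the union of its triangles), each triangle being given by its
three vertices. -/
structure Triangulation where
  triangles : Finset (Finset Plane)
  card_eq : ∀ τ ∈ triangles, τ.card = 3
  indep : ∀ τ ∈ triangles, AffineIndependent ℝ (fun x : τ => (x : Plane))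
  conforming : ∀ σ ∈ triangles, ∀ τ ∈ triangles, hull σ ∩ hull τ = hull (σ ∩ τ)

/-- The edges of a triangulation that do not lie on the boundary: those shared by two
triangles. -/
def Triangulation.interiorEdges (T : Triangulation) : Finset (Finset Plane) :=
  (edges T.triangles).filter fun e => (T.triangles.filter fun τ => e ⊆ τ).card = 2

/-- The coarse mesh: every triangle of `T` is divided into three by joining its centroid to its
vertices. -/
def subdivide (T : Triangulation) : Finset (Finset Plane) :=
  T.triangles.biUnion fun τ => (τ.powersetCard 2).image fun e => insert (center τ) e

/-- The initial coarse triangulation `init`, and a conforming fine mesh `fine` that refines the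
subdivided mesh `subdivide init`: every fine triangle lies in a coarse element, and every coarse
element is the union of the fine triangles that it contains. -/
structure StaggeredMesh where
  init : Triangulation
  fine : Triangulation
  fine_le : ∀ τ ∈ fine.triangles, ∃ K ∈ subdivide init, hull τ ⊆ hull K
  fine_cover : ∀ K ∈ subdivide init, ∀ x ∈ hull K,
    ∃ τ ∈ fine.triangles, hull τ ⊆ hull K ∧ x ∈ hull τ

namespace StaggeredMesh

variable (M : StaggeredMesh)

/-- The computational domain (as a closed polygon). -/
def domain : Set Plane := ⋃ τ ∈ M.init.triangles, hull τ

/-- Coarse elements `K`. -/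
abbrev Elt := {K : Finset Plane // K ∈ subdivide M.init}

/-- Coarse edges `E`, old (from the initial triangulation) and new. -/
abbrev Edge := {E : Finset Plane // E ∈ edges (subdivide M.init)}

/-- Fine triangles. -/
abbrev Tri := {τ : Finset Plane // τ ∈ M.fine.triangles}

/-- All fine edges. -/
def fineEdges : Finset (Finset Plane) := edges M.fine.triangles

/-- The size of the fine mesh: the largest diameter of a fine triangle. -/
def h : ℝ := ⨆ τ : M.Tri, Metric.diam (hull τ.1)

/-- The fine triangles contained in the coarse element `K`. -/
def trisIn (K : M.Elt) : Finset M.Tri := Finset.univ.filter fun τ => hull τ.1 ⊆ hull K.1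

/-- The coarse elements having the edge `E`; their union is `ω_E`. -/
def eltsAt (E : M.Edge) : Finset M.Elt := Finset.univ.filter fun K => E.1 ⊆ K.1

/-- The fine triangles contained in `ω_E`. -/
def patch (E : M.Edge) : Finset M.Tri := (M.eltsAt E).biUnion M.trisIn

/-- The partition of the coarse edge `E` by fine edges. -/
def edgesIn (E : M.Edge) : Finset (Finset Plane) := M.fineEdges.filter fun e => hull e ⊆ hull E.1

/-- The fine triangles having the edge `e`. -/
def trisAt (e : Finset Plane) : Finset M.Tri := Finset.univ.filter fun τ => e ⊆ τ.1

/-- `N_E`, the dimension of the space of mean-zero piecewise constants on `E`. -/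
def dimEdge (E : M.Edge) : ℕ := (M.edgesIn E).card - 1

/-- `M_K`, the dimension of the space of mean-zero piecewise constants on `K`. -/
def dimElt (K : M.Elt) : ℕ := (M.trisIn K).card - 1

/-- Coarse edges that are interior edges of the initial triangulation. -/
def IsDecoupled (E : M.Edge) : Prop := E.1 ∈ M.init.interiorEdges

/-- Fine edges lying on edges of the initial triangulation. -/
def OnInit (e : Finset Plane) : Prop := ∃ E ∈ edges M.init.triangles, hull e ⊆ hull E

/-- Fine edges lying on interior edges of the initial triangulation. -/
def OnInitInterior (e : Finset Plane) : Prop := ∃ E ∈ M.init.interiorEdges, hull e ⊆ hull E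

/-! ## Fine velocity spaces -/

/-- Broken lowest order Raviart-Thomas fields on the fine mesh: on the triangle `τ` the field
`v` is `x ↦ a + b x` with `v τ = (a, b)`. -/
abbrev Vel := M.Tri → Plane × ℝ

variable {M}

/-- The value at `x` of the affine field `v|_τ`. -/
def velAt (v : M.Vel) (τ : M.Tri) (x : Plane) : Plane := (v τ).1 + (v τ).2 • x

/-- The divergence of `x ↦ a + b x` is the constant `2 b`. -/
def dvg (v : M.Vel) (τ : M.Tri) : ℝ := 2 * (v τ).2

/-- The component `v|_τ · ν` on the fine edge `e` of `τ`, for a vector `ν` normal to `e`; it is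
constant along `e`, hence equal to its value at the midpoint. -/
def comp (v : M.Vel) (τ : M.Tri) (e : Finset Plane) (ν : Plane) : ℝ :=
  ⟪velAt v τ (center e), ν⟫

/-- The outward normal component of `v|_τ` on the edge `e` of `τ`. -/
def flux (v : M.Vel) (τ : M.Tri) (e : Finset Plane) : ℝ := comp v τ e (outwardNormal τ.1 e)

lemma comp_add (v w : M.Vel) (τ : M.Tri) (e : Finset Plane) (ν : Plane) :
    comp (v + w) τ e ν = comp v τ e ν + comp w τ e ν := by
  simp only [comp, velAt, Pi.add_apply, Prod.fst_add, Prod.snd_add, add_smul, ← inner_add_left]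
  congr 1
  abel

lemma comp_smul (c : ℝ) (v : M.Vel) (τ : M.Tri) (e : Finset Plane) (ν : Plane) :
    comp (c • v) τ e ν = c * comp v τ e ν := by
  simp only [comp, velAt, Pi.smul_apply, Prod.smul_fst, Prod.smul_snd, smul_assoc, ← smul_add,
    real_inner_smul_left]

lemma comp_zero (τ : M.Tri) (e : Finset Plane) (ν : Plane) : comp (0 : M.Vel) τ e ν = 0 := by
  simp [comp, velAt]

lemma flux_add (v w : M.Vel) (τ : M.Tri) (e : Finset Plane) :
    flux (v + w) τ e = flux v τ e + flux w τ e := comp_add ..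

lemma flux_smul (c : ℝ) (v : M.Vel) (τ : M.Tri) (e : Finset Plane) :
    flux (c • v) τ e = c * flux v τ e := comp_smul ..

lemma flux_zero (τ : M.Tri) (e : Finset Plane) : flux (0 : M.Vel) τ e = 0 := comp_zero ..

/-- Continuity of the normal component of `v` across the fine edge `e` between `τ` and `τ'` -/
def FluxContinuous (v : M.Vel) (τ τ' : M.Tri) (e : Finset Plane) : Prop :=
  flux v τ e + flux v τ' e = 0

/-- `v|_K` belongs to the Raviart-Thomas space `V_h(K)` of the fine mesh in `K`. -/
def ConformingIn (K : M.Elt) (v : M.Vel) : Prop :=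
  ∀ e ∈ M.fineEdges, ∀ τ ∈ M.trisIn K, ∀ τ' ∈ M.trisIn K, τ ≠ τ' → e ⊆ τ.1 → e ⊆ τ'.1 →
    FluxContinuous v τ τ' e

variable (M) in
/-- The decoupled velocity space: normal components are continuous except on the fine edges that
lie on interior edges of the initial triangulation. -/
def fineV : Submodule ℝ M.Vel where
  carrier := {v | ∀ e ∈ M.fineEdges, ¬ M.OnInitInterior e → ∀ τ τ' : M.Tri, τ ≠ τ' →
    e ⊆ τ.1 → e ⊆ τ'.1 → FluxContinuous v τ τ' e}
  add_mem' := by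
    intro v w hv hw e he he' τ τ' hne h h'
    have h1 := hv e he he' τ τ' hne h h'
    have h2 := hw e he he' τ τ' hne h h'
    simp only [FluxContinuous, flux_add] at *
    linarith
  zero_mem' := by
    intro e _ _ τ τ' _ _ _
    simp [FluxContinuous, flux_zero]
  smul_mem' := by
    intro c v hv e he he' τ τ' hne h h'
    have h1 := hv e he he' τ τ' hne h h'
    simp only [FluxContinuous, flux_smul] at *
    rw [← mul_add, h1, mul_zero]

/-- `V_{h,0}(K)`: fields in `V_h(K)` whose normal component vanishes on `∂K`, extended by zero
outside `K`. -/
def LocalV (K : M.Elt) (w : M.Vel) : Prop :=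
  (∀ τ, τ ∉ M.trisIn K → w τ = 0) ∧ ConformingIn K w ∧
  ∀ E : M.Edge, E.1 ⊆ K.1 → ∀ e ∈ M.edgesIn E, ∀ τ ∈ M.trisIn K, e ⊆ τ.1 → flux w τ e = 0

/-- The restriction of `v` to `K`, extended by zero. -/
def restr (K : M.Elt) (v : M.Vel) : M.Vel := fun τ => if τ ∈ M.trisIn K then v τ else 0

/-! ## Fine pressure spaces -/

variable (M) in
/-- Broken affine functions on the fine mesh: on `τ` the function `q` is `x ↦ c + g · x` with
`q τ = (c, g)`. -/
abbrev Pres := M.Tri → ℝ × Plane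

/-- The value at `x` of the affine function `q|_τ`. -/
def presAt (q : M.Pres) (τ : M.Tri) (x : Plane) : ℝ := (q τ).1 + ⟪(q τ).2, x⟫

lemma presAt_add (p q : M.Pres) (τ : M.Tri) (x : Plane) :
    presAt (p + q) τ x = presAt p τ x + presAt q τ x := by
  simp only [presAt, Pi.add_apply, Prod.fst_add, Prod.snd_add, inner_add_left]
  ring

lemma presAt_smul (c : ℝ) (q : M.Pres) (τ : M.Tri) (x : Plane) :
    presAt (c • q) τ x = c * presAt q τ x := by
  simp only [presAt, Pi.smul_apply, Prod.smul_fst, Prod.smul_snd, real_inner_smul_left,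
    smul_eq_mul]
  ring

lemma presAt_zero (τ : M.Tri) (x : Plane) : presAt (0 : M.Pres) τ x = 0 := by
  simp [presAt]

/-- The piecewise constant function with value `c τ` on `τ`. -/
def const (c : M.Tri → ℝ) : M.Pres := fun τ => (c τ, 0)

variable (M) in
/-- `Q_h`: piecewise constants on the fine mesh. -/
def fineQ : Submodule ℝ M.Pres where
  carrier := {q | ∀ τ, (q τ).2 = 0}
  add_mem' := by
    intro p q hp hq τ
    simp [hp τ, hq τ]
  zero_mem' := by
    intro τ
    simp
  smul_mem' := by
    intro c q hq τ
    simp [hq τ]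

variable (M) in
/-- The additional pressure space with homogeneous boundary condition: `q` lives on the fine
triangles with an edge on the initial triangulation, has zero mean on each of them (for an affine
function, the mean over a triangle is the value at the centroid), is constant on each such edge,
continuous on the interior ones and zero on the ones that lie on the boundary. -/
def bubbleQ : Submodule ℝ M.Pres where
  carrier := {q |
    (∀ τ : M.Tri, (∀ e ∈ M.fineEdges, e ⊆ τ.1 → ¬ M.OnInit e) → q τ = 0) ∧
    (∀ τ : M.Tri, presAt q τ (center τ.1) = 0) ∧
    (∀ e ∈ M.fineEdges, M.OnInit e → ∀ τ ∈ M.trisAt e, ∀ x ∈ e,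
      presAt q τ x = presAt q τ (center e)) ∧
    (∀ e ∈ M.fineEdges, M.OnInitInterior e → ∀ τ ∈ M.trisAt e, ∀ τ' ∈ M.trisAt e,
      presAt q τ (center e) = presAt q τ' (center e)) ∧
    (∀ e ∈ M.fineEdges, M.OnInit e → ¬ M.OnInitInterior e → ∀ τ ∈ M.trisAt e,
      presAt q τ (center e) = 0)}
  add_mem' := by
    rintro p q ⟨p1, p2, p3, p4, p5⟩ ⟨q1, q2, q3, q4, q5⟩
    refine ⟨fun τ h => ?_, fun τ => ?_, fun e he h τ hτ x hx => ?_,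
      fun e he h τ hτ τ' hτ' => ?_, fun e he h h' τ hτ => ?_⟩
    · rw [Pi.add_apply, p1 τ h, q1 τ h, add_zero]
    · rw [presAt_add, p2, q2, add_zero]
    · rw [presAt_add, presAt_add, p3 e he h τ hτ x hx, q3 e he h τ hτ x hx]
    · rw [presAt_add, presAt_add, p4 e he h τ hτ τ' hτ', q4 e he h τ hτ τ' hτ']
    · rw [presAt_add, p5 e he h h' τ hτ, q5 e he h h' τ hτ, add_zero]
  zero_mem' := by
    refine ⟨fun τ h => rfl, fun τ => ?_, fun e he h τ hτ x hx => ?_,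
      fun e he h τ hτ τ' hτ' => ?_, fun e he h h' τ hτ => ?_⟩ <;> simp only [presAt_zero]
  smul_mem' := by
    rintro c q ⟨q1, q2, q3, q4, q5⟩
    refine ⟨fun τ h => ?_, fun τ => ?_, fun e he h τ hτ x hx => ?_,
      fun e he h τ hτ τ' hτ' => ?_, fun e he h h' τ hτ => ?_⟩
    · rw [Pi.smul_apply, q1 τ h, smul_zero]
    · rw [presAt_smul, q2, mul_zero]
    · rw [presAt_smul, presAt_smul, q3 e he h τ hτ x hx]
    · rw [presAt_smul, presAt_smul, q4 e he h τ hτ τ' hτ']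
    · rw [presAt_smul, q5 e he h h' τ hτ, mul_zero]

variable (M) in
/-- The enriched fine pressure space with homogeneous Dirichlet condition. -/
def fineQhat : Submodule ℝ M.Pres := fineQ M ⊔ bubbleQ M

/-- `q^{(I)}`: since the functions of `bubbleQ` have zero mean on every fine triangle, the
component of `q` in the piecewise constants consists of its means. -/
def partI (q : M.Pres) : M.Tri → ℝ := fun τ => presAt q τ (center τ.1)

/-- `q^{(B)}`, the component of `q` in `bubbleQ`. -/
def partB (q : M.Pres) : M.Pres := q - const (partI q)

/-! ## Bilinear forms and norms

Sums over fine triangles `τ` of integrals over `τ` are integrals over the union of these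
triangles, which overlap in null sets only. -/

/-- `∫ κ v · w` over the union of the triangles in `S` -/
def massV (κ : Plane → ℝ) (S : Finset M.Tri) (v w : M.Vel) : ℝ :=
  ∑ τ ∈ S, ∫ x in hull τ.1, κ x * ⟪velAt v τ x, velAt w τ x⟫

/-- `∫ q ∇·w` over the union of the triangles in `S`, for piecewise constant `q` -/
def divForm (S : Finset M.Tri) (q : M.Tri → ℝ) (w : M.Vel) : ℝ :=
  ∑ τ ∈ S, area τ.1 * (q τ * dvg w τ)

/-- `∫_Ω ρ p q` -/
def massQ (ρ : Plane → ℝ) (p q : M.Pres) : ℝ :=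
  ∑ τ : M.Tri, ∫ x in hull τ.1, ρ x * (presAt p τ x * presAt q τ x)

/-- `‖v‖_V²` -/
def normV2 (κ : Plane → ℝ) (v : M.Vel) : ℝ := massV κ Finset.univ v v

/-- `‖q‖_Q²` -/
def normQ2 (ρ : Plane → ℝ) (q : M.Pres) : ℝ := massQ ρ q q

/-- `∫_Ω g q` -/
def source (g : Plane → ℝ) (q : M.Pres) : ℝ := ∑ τ : M.Tri, ∫ x in hull τ.1, g x * presAt q τ x

/-- `‖ρ⁻¹ g - q‖_Q²` -/
def residual2 (ρ g : Plane → ℝ) (q : M.Pres) : ℝ :=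
  ∑ τ : M.Tri, ∫ x in hull τ.1, ρ x * ((ρ x)⁻¹ * g x - presAt q τ x) ^ 2

/-- The value on the fine edge `e` of a pressure that is constant on `e`. (All one-sided values
agree for the functions to which this is applied, so their average is the common value.) -/
def presOn (q : M.Pres) (e : Finset Plane) : ℝ :=
  ((M.trisAt e).card : ℝ)⁻¹ * ∑ τ ∈ M.trisAt e, presAt q τ (center e)

/-- The value on `e` of `φ · ν`, for a unit normal `ν` of `e` and a field with continuous normal
component at `e`. (All one-sided values agree then.) -/
def compOn (φ : M.Vel) (ν : Plane) (e : Finset Plane) : ℝ :=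
  ((M.trisAt e).card : ℝ)⁻¹ * ∑ τ ∈ M.trisAt e, comp φ τ e ν

/-- `[w · n]` on the fine edge `e`: the sum of the outward normal components. -/
def jump (w : M.Vel) (e : Finset Plane) : ℝ := ∑ τ ∈ M.trisAt e, flux w τ e

/-- The sum over the interior edges `E` of the initial triangulation (or over their fine
edges) of `∫_E q^{(B)} [w · n]`. -/
def jumpForm (q : M.Pres) (w : M.Vel) : ℝ :=
  ∑ e ∈ M.fineEdges.filter M.OnInitInterior, len e * (presOn (partB q) e * jump w e)

/-- `∫_E (v|_K · n)(w|_K · n)`, for the traces from the side of the coarse element `K`. -/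
def sideInner (K : M.Elt) (E : M.Edge) (v w : M.Vel) : ℝ :=
  ∑ e ∈ M.edgesIn E, len e * ∑ τ ∈ (M.trisIn K).filter (fun τ => e ⊆ τ.1), flux v τ e * flux w τ e

/-- `∫_E (v · n)(w · n)`; where the normal components are two-valued, the product is averaged over
the two sides of `E`. -/
def edgeInner (E : M.Edge) (v w : M.Vel) : ℝ :=
  ((M.eltsAt E).card : ℝ)⁻¹ * ∑ K ∈ M.eltsAt E, sideInner K E v w

/-! ## The semi-discrete schemes -/

/-- `(v, p)` solves on `[0, T]`, with zero initial values, the semi-discrete mixed scheme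
with velocity space `V`, pressure space `Q` and source `f`. -/
structure IsSolution (κ ρ : Plane → ℝ) (T : ℝ) (f : ℝ → Lp ℝ 2 (volume.restrict M.domain))
    (V : Submodule ℝ M.Vel) (Q : Submodule ℝ M.Pres) (v : ℝ → M.Vel) (p : ℝ → M.Pres) : Prop where
  v_mem : ∀ t ∈ Icc 0 T, v t ∈ V
  p_mem : ∀ t ∈ Icc 0 T, p t ∈ Q
  v_diff : DifferentiableOn ℝ v (Icc 0 T)
  p_diff : DifferentiableOn ℝ p (Icc 0 T)
  v_zero : v 0 = 0
  p_zero : p 0 = 0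
  eq_v : ∀ t ∈ Icc 0 T, ∀ w ∈ V,
    massV κ Finset.univ (derivWithin v (Icc 0 T) t) w - divForm Finset.univ (partI (p t)) w
      + jumpForm (p t) w = 0
  eq_p : ∀ t ∈ Icc 0 T, ∀ q ∈ Q,
    massQ ρ (derivWithin p (Icc 0 T) t) q + divForm Finset.univ (partI q) (v t)
      - jumpForm q (v t) = source (f t) q

/-! ## Multiscale basis functions -/

/-- `φ`, supported in `ω_E`, solves on each coarse element `K` with edge `E` the local problem:
find `(φ, p)` in `V_h(K) × Q_h(K)` with `∫_K κ φ·w - ∫_K p ∇·w = 0` for all `w` in `V_{h,0}(K)`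
and `∫_K q ∇·φ = ∫_K c q` for all `q` in `Q_h(K)`, where `φ·ν = g` on `E` and `φ·n = 0` on
`∂K \ E`. Here `ν` is a unit normal of `E`, and `c = c K` is a constant. -/
structure IsLocalSolution (κ : Plane → ℝ) (E : M.Edge) (ν : Plane) (g : Finset Plane → ℝ)
    (c : M.Elt → ℝ) (φ : M.Vel) : Prop where
  supp : ∀ τ, τ ∉ M.patch E → φ τ = 0
  conforming : ∀ K ∈ M.eltsAt E, ConformingIn K φ
  eqs : ∀ K ∈ M.eltsAt E, ∃ p : M.Tri → ℝ,
    (∀ w, LocalV K w → massV κ (M.trisIn K) φ w - divForm (M.trisIn K) p w = 0) ∧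
    (∀ q : M.Tri → ℝ, divForm (M.trisIn K) q φ = ∑ τ ∈ M.trisIn K, area τ.1 * (c K * q τ))
  trace : ∀ K ∈ M.eltsAt E, ∀ τ ∈ M.trisIn K, ∀ e ∈ M.edgesIn E, e ⊆ τ.1 → comp φ τ e ν = g e
  trace_zero : ∀ K ∈ M.eltsAt E, ∀ E' : M.Edge, E' ≠ E → E'.1 ⊆ K.1 → ∀ τ ∈ M.trisIn K,
    ∀ e ∈ M.edgesIn E', e ⊆ τ.1 → flux φ τ e = 0

/-- The snapshot space of `E`: local solutions with zero divergence whose normal component on `E`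
is a piecewise constant function `δ` of zero mean. -/
def Snapshot (κ : Plane → ℝ) (E : M.Edge) (ν : Plane) : Set M.Vel :=
  {ψ | ∃ δ : Finset Plane → ℝ, ∑ e ∈ M.edgesIn E, len e * δ e = 0 ∧
    IsLocalSolution κ E ν δ (fun _ => 0) ψ}

/-- `(φ, p, μ)` solves the spectral problem of the coarse element `K`, posed on
`V_{h,0}(K)` and the mean-zero functions in `Q_h(K)` (extended by zero). -/
structure IsEltEigen (κ ρ : Plane → ℝ) (K : M.Elt) (φ : M.Vel) (p : M.Tri → ℝ) (μ : ℝ) :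
    Prop where
  vel_mem : LocalV K φ
  pres_supp : ∀ τ, τ ∉ M.trisIn K → p τ = 0
  pres_mean : ∑ τ ∈ M.trisIn K, area τ.1 * p τ = 0
  eq_v : ∀ w, LocalV K w → massV κ (M.trisIn K) φ w - divForm (M.trisIn K) p w = 0
  eq_p : ∀ q : M.Tri → ℝ, (∀ τ, τ ∉ M.trisIn K → q τ = 0) →
    ∑ τ ∈ M.trisIn K, area τ.1 * q τ = 0 →
    divForm (M.trisIn K) q φ = μ * massQ ρ (const p) (const q)

/-- The three families of multiscale basis functions, before selection. -/
structure Basis (M : StaggeredMesh) (κ ρ : Plane → ℝ) where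
  /-- a fixed unit normal of each coarse edge -/
  normal : M.Edge → Plane
  normal_spec : ∀ E, ∃ K ∈ M.eltsAt E, normal E = outwardNormal K.1 E.1
  /-- first basis set -/
  first : M.Edge → M.Vel
  /-- normal component one on `E`, and divergence `|E| / |K|` up to the sign of the normal -/
  first_spec : ∀ E, IsLocalSolution κ E (normal E) (fun _ => 1)
    (fun K => ⟪normal E, outwardNormal K.1 E.1⟫ * (len E.1 / area K.1)) (first E)
  /-- second basis set -/
  second : (E : M.Edge) → Fin (M.dimEdge E) → M.Vel
  eigE : (E : M.Edge) → Fin (M.dimEdge E) → ℝ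
  eigE_mono : ∀ E, Monotone (eigE E)
  second_mem : ∀ E j, second E j ∈ Snapshot κ E (normal E)
  second_eq : ∀ E j, ∀ w ∈ Snapshot κ E (normal E),
    edgeInner E (second E j) w = eigE E j * massV κ (M.patch E) (second E j) w
  second_orthonormal : ∀ E i j, edgeInner E (second E i) (second E j) = if i = j then 1 else 0
  /-- third basis set -/
  thirdV : (K : M.Elt) → Fin (M.dimElt K) → M.Vel
  thirdQ : (K : M.Elt) → Fin (M.dimElt K) → M.Tri → ℝ
  eigK : (K : M.Elt) → Fin (M.dimElt K) → ℝ
  eigK_mono : ∀ K, Monotone (eigK K)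
  third_eq : ∀ K j, IsEltEigen κ ρ K (thirdV K j) (thirdQ K j) (eigK K j)
  third_orthonormal : ∀ K i j,
    massQ ρ (const (thirdQ K i)) (const (thirdQ K j)) = if i = j then 1 else 0

/-- The function of `bubbleQ`, living on the fine triangles with an edge on `E`, whose value on
each fine edge `e` in `E` is `g e`: on a triangle `τ` with such an edge it is the affine function
that is `g e` on `e` and zero at the centroid of `τ`. -/
def edgePressure (E : M.Edge) (g : Finset Plane → ℝ) : M.Pres := fun τ =>
  ∑ e ∈ (M.edgesIn E).filter (fun e => e ⊆ τ.1),
    let m := outwardNormal τ.1 e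
    let s := g e / ⟪m, center e - center τ.1⟫
    (-(s * ⟪m, center τ.1⟫), s • m)

namespace Basis

variable {κ ρ : Plane → ℝ} (B : Basis M κ ρ)

/-- `p_E^{(1)}`, with value one on `E` -/
def edgeQ1 (_B : Basis M κ ρ) (E : M.Edge) : M.Pres := edgePressure E fun _ => 1

/-- `p_{E,j}^{(2)}`, with value `φ_{E,j}^{(2)} · n` on `E` -/
def edgeQ2 (E : M.Edge) (j : Fin (M.dimEdge E)) : M.Pres :=
  edgePressure E (compOn (B.second E j) (B.normal E))

/-- The multiscale velocity space, when `nE E` and `mK K` eigenfunctions are selected. The basis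
functions of the interior edges of the initial triangulation are decoupled, that is,
replaced by their restrictions to the two adjacent coarse elements. -/
def coarseV (nE : M.Edge → ℕ) (mK : M.Elt → ℕ) : Submodule ℝ M.Vel :=
  Submodule.span ℝ
    ({w | ∃ E, ¬ M.IsDecoupled E ∧ w = B.first E} ∪
     {w | ∃ E, M.IsDecoupled E ∧ ∃ K ∈ M.eltsAt E, w = restr K (B.first E)} ∪
     {w | ∃ E, ¬ M.IsDecoupled E ∧ ∃ j : Fin (M.dimEdge E), j.1 < nE E ∧ w = B.second E j} ∪
     {w | ∃ E, M.IsDecoupled E ∧ ∃ K ∈ M.eltsAt E, ∃ j : Fin (M.dimEdge E), j.1 < nE E ∧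
        w = restr K (B.second E j)} ∪
     {w | ∃ K, ∃ j : Fin (M.dimElt K), j.1 < mK K ∧ w = B.thirdV K j})

/-- The multiscale pressure space with homogeneous Dirichlet condition. -/
def coarseQ (nE : M.Edge → ℕ) (mK : M.Elt → ℕ) : Submodule ℝ M.Pres :=
  Submodule.span ℝ
    ({q | ∃ K : M.Elt, q = const fun τ => if τ ∈ M.trisIn K then 1 else 0} ∪
     {q | ∃ K, ∃ j : Fin (M.dimElt K), j.1 < mK K ∧ q = const (B.thirdQ K j)} ∪
     {q | ∃ E, M.IsDecoupled E ∧ q = B.edgeQ1 E} ∪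
     {q | ∃ E, M.IsDecoupled E ∧ ∃ j : Fin (M.dimEdge E), j.1 < nE E ∧ q = B.edgeQ2 E j})

/-- `a_{K,0}`, the average on `K` of the piecewise constant function `p` -/
def coefA0 (_B : Basis M κ ρ) (p : M.Tri → ℝ) (K : M.Elt) : ℝ :=
  (∑ τ ∈ M.trisIn K, area τ.1)⁻¹ * ∑ τ ∈ M.trisIn K, area τ.1 * p τ

/-- `a_{K,j}`, the coefficient of `p - a_{K,0}` on `K` along `p_{K,j}^{(3)}` -/
def coefA (p : M.Tri → ℝ) (K : M.Elt) (j : Fin (M.dimElt K)) : ℝ :=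
  massQ ρ (const fun τ => p τ - B.coefA0 p K) (const (B.thirdQ K j))

/-- The interpolant of `p^{(I)}` -/
def interpI (mK : M.Elt → ℕ) (p : M.Pres) : M.Pres :=
  ∑ K : M.Elt, (const (fun τ => if τ ∈ M.trisIn K then B.coefA0 (partI p) K else 0) +
    ∑ j : Fin (M.dimElt K), if j.1 < mK K then
      B.coefA (partI p) K j • const (B.thirdQ K j) else 0)

/-- `b_{E,0}`, the average of `p^{(B)}` on `E` -/
def coefB0 (_B : Basis M κ ρ) (p : M.Pres) (E : M.Edge) : ℝ :=
  (len E.1)⁻¹ * ∑ e ∈ M.edgesIn E, len e * presOn (partB p) e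

/-- `b_{E,j} = ∫_E p^{(B)} φ_{E,j}^{(2)} · n` -/
def coefB (p : M.Pres) (E : M.Edge) (j : Fin (M.dimEdge E)) : ℝ :=
  ∑ e ∈ M.edgesIn E, len e * (presOn (partB p) e * compOn (B.second E j) (B.normal E) e)

/-- The interpolant of `p^{(B)}` -/
def interpB (nE : M.Edge → ℕ) (p : M.Pres) : M.Pres :=
  ∑ E : M.Edge, if M.IsDecoupled E then
    B.coefB0 p E • B.edgeQ1 E +
      ∑ j : Fin (M.dimEdge E), if j.1 < nE E then B.coefB p E j • B.edgeQ2 E j else 0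
  else 0

/-- `c_{E,0}`, the average of `v · n` on `E`, taken from the side of `K` (the side matters
only for decoupled edges); recall that the normal component of `first E` is one on `E`. -/
def coefC0 (v : M.Vel) (K : M.Elt) (E : M.Edge) : ℝ :=
  (len E.1)⁻¹ * sideInner K E v (B.first E)

/-- `c_{E,j} = ∫_E (v · n) (φ_{E,j}^{(2)} · n)`, taken from the side of `K` -/
def coefC (v : M.Vel) (K : M.Elt) (E : M.Edge) (j : Fin (M.dimEdge E)) : ℝ :=
  sideInner K E v (B.second E j)

/-- `d_{K,j}`, determined by `d_{K,j} μ_{K,j} = ∫_K p_{K,j}^{(3)} ∇·v` -/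
def coefD (v : M.Vel) (K : M.Elt) (j : Fin (M.dimElt K)) : ℝ :=
  (B.eigK K j)⁻¹ * divForm (M.trisIn K) (B.thirdQ K j) v

/-- The interpolant of `v`, assembled from its restrictions to the coarse elements -/
def interpV (nE : M.Edge → ℕ) (mK : M.Elt → ℕ) (v : M.Vel) : M.Vel :=
  ∑ K : M.Elt, (
    (∑ E : M.Edge, if E.1 ⊆ K.1 then
      B.coefC0 v K E • restr K (B.first E) +
        ∑ j : Fin (M.dimEdge E), if j.1 < nE E then
          B.coefC v K E j • restr K (B.second E j) else 0
      else 0) +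
    ∑ j : Fin (M.dimElt K), if j.1 < mK K then B.coefD v K j • B.thirdV K j else 0)

/-- `max_E λ_{E, n_E + 1}⁻¹`, where edges all of whose eigenfunctions are selected contribute
zero -/
def maxInvEigE (nE : M.Edge → ℕ) : ℝ :=
  ⨆ E : M.Edge, if hE : nE E < M.dimEdge E then (B.eigE E ⟨nE E, hE⟩)⁻¹ else 0

/-- `max_K μ_{K, m_K + 1}⁻¹`, where elements all of whose eigenfunctions are selected contribute
zero -/
def maxInvEigK (mK : M.Elt → ℕ) : ℝ :=
  ⨆ K : M.Elt, if hK : mK K < M.dimElt K then (B.eigK K ⟨mK K, hK⟩)⁻¹ else 0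

end Basis

end StaggeredMesh

end

end MixedGMsFEM

/-!
The interpolants `πv` of the fine velocity and `πp` of the fine pressure lie in the multiscale
spaces, so the differences to the multiscale solution, `πv - v_H` and `πp - p_H`, may be used as
test functions in both schemes. The spaces are matched in such a way that the interpolation errors
are invisible to the coupling of velocity and pressure (`coupling_pres_error`,
`coupling_vel_error`): what the interpolation discards on an edge or in an element is orthogonal to
the eigenfunctions that are kept, local solutions have constant divergence on the elements, and
mean values are preserved. Therefore all coupling terms cancel in the energy identity, and the energy
of the differences grows at most at the rate of the interpolation errors of the time derivatives
`v'` and `p'` (`energy_deriv_le`). As it vanishes at the initial time, Grönwall's inequality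
(`gronwall_le`) leaves the estimate of these interpolation errors at a fixed time (`interp_error`).

For the velocity, the part discarded on the edges is a combination of snapshot eigenfunctions, whose
`κ`-norm is controlled by the trace on the edge and the reciprocal eigenvalues (`massV_tail_le`).
What remains on an element `K` has no normal component on the boundary and, by the velocity
equation, a potential. The norm of such a field is `∑ D_j² / μ_j` with the components `D_j`
of its divergence along the pressure eigenfunctions (`massV_local`). The components that are kept
vanish, and the others are components of the residual `ρ⁻¹ f' - p''` by the differentiated pressure
equation, so that Bessel's inequality applies (`vel_error_elt`).

For the pressure, the differentiated velocity equation, which relates `v''` to `p'`, is tested with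
the eigenfunctions themselves: those of an element yield the components of the element part
(`presI_error_elt`), and those of a decoupled edge, restricted to one side, the components of the
edge part (`presB_error_edge`). The functions on the fine triangles along an edge are affine and
determined by their values on it, and the triangles have height at most `h`; this is the
additional factor `h` (`bubble_norm_le`).

The eigenfunctions are complete because their number is the dimension of the space of mean-zero
functions (`orthonormal_expansion`). The eigenvalues `μ_j` are positive because a pressure that is
orthogonal to all divergences of fields in `V_{h,0}(K)` takes the same value on adjacent fine
triangles, hence is constant on `K` (`eq_of_adjacent_eq`, `eigK_pos`). The Raviart-Thomas fields enter
through their shape functions in this argument, and otherwise only through the divergence theorem on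
a triangle (`IsTri.gauss`) and on a coarse element (`gauss_elt`).
-/

namespace MixedGMsFEM

noncomputable section

open Classical

/-! ### Triangles in the plane -/

lemma inner_plane (x y : Plane) : ⟪x, y⟫ = x 0 * y 0 + x 1 * y 1 := by
  simp [PiLp.inner_apply, Fin.sum_univ_two]
  ring

/-- The cross product (signed area) of two plane vectors. -/
def cross (u v : Plane) : ℝ := u 0 * v 1 - u 1 * v 0

/-- Rotation of a plane vector by a right angle. -/
def rot (u : Plane) : Plane := !₂[u 1, -u 0]

lemma rot_zero_apply (u : Plane) : rot u 0 = u 1 := rfl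

lemma rot_one_apply (u : Plane) : rot u 1 = -u 0 := rfl

lemma inner_rot (u v : Plane) : ⟪rot u, v⟫ = -cross u v := by
  rw [inner_plane, rot_zero_apply, rot_one_apply, cross]
  ring

lemma plane_ext {x y : Plane} (h0 : x 0 = y 0) (h1 : x 1 = y 1) : x = y := by
  ext i
  fin_cases i <;> assumption

lemma norm_sq_plane (u : Plane) : ‖u‖ ^ 2 = u 0 ^ 2 + u 1 ^ 2 := by
  rw [← real_inner_self_eq_norm_sq, inner_plane]
  ring

lemma norm_rot (u : Plane) : ‖rot u‖ = ‖u‖ := by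
  have h : ‖rot u‖ ^ 2 = ‖u‖ ^ 2 := by
    rw [norm_sq_plane, norm_sq_plane, rot_zero_apply, rot_one_apply]
    ring
  exact (sq_eq_sq₀ (norm_nonneg _) (norm_nonneg _)).1 h

/-- A vector orthogonal to `u ≠ 0` is a multiple of `rot u`. -/
lemma eq_smul_rot {u d : Plane} (hu : u ≠ 0) (h : ⟪d, u⟫ = 0) :
    d = (⟪rot u, d⟫ / ‖u‖ ^ 2) • rot u := by
  have hn : u 0 ^ 2 + u 1 ^ 2 ≠ 0 := by
    rw [← norm_sq_plane]
    exact pow_ne_zero 2 (norm_ne_zero_iff.2 hu)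
  rw [inner_plane] at h
  rw [inner_rot, norm_sq_plane, cross]
  apply plane_ext
  · simp only [PiLp.smul_apply, rot_zero_apply, smul_eq_mul]
    field_simp
    linear_combination u 0 * h
  · simp only [PiLp.smul_apply, rot_one_apply, smul_eq_mul]
    field_simp
    linear_combination u 1 * h

lemma affineIndependent_iff_cross {a b c : Plane} :
    AffineIndependent ℝ ![a, b, c] ↔ cross (b - a) (c - a) ≠ 0 := by
  rw [affineIndependent_iff_linearIndependent_vsub ℝ _ (0 : Fin 3)]
  have e : (fun i : { x : Fin 3 // x ≠ 0 } => (![a, b, c] i -ᵥ ![a, b, c] 0 : Plane)) ∘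
      (finSuccAboveEquiv (0 : Fin 3)) = ![b - a, c - a] := by
    funext i
    fin_cases i <;> rfl
  rw [← linearIndependent_equiv (finSuccAboveEquiv (0 : Fin 3)), e,
    LinearIndependent.pair_iff]
  constructor
  · intro h h0
    -- For parallel `b - a` and `c - a`, each coordinate gives a vanishing linear combination, so
    -- all coordinates of `b - a` would vanish.
    have key := h ((c - a) 1) (-(b - a) 1) ?_
    · have key2 := h ((c - a) 0) (-(b - a) 0) ?_
      · have hb : b - a = 0 := plane_ext (by simpa using neg_eq_zero.1 key2.2)
          (by simpa using neg_eq_zero.1 key.2)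
        have := h 1 0 (by simp [hb])
        simp at this
      · apply plane_ext <;>
          simp only [PiLp.add_apply, PiLp.smul_apply, smul_eq_mul, PiLp.zero_apply] <;>
          unfold cross at h0 <;> linarith
    · apply plane_ext <;>
        simp only [PiLp.add_apply, PiLp.smul_apply, smul_eq_mul, PiLp.zero_apply] <;>
        unfold cross at h0 <;> linarith
  · intro h s t hst
    have h0 : s * (b - a) 0 + t * (c - a) 0 = 0 := by
      have := congrArg (fun x : Plane => x 0) hst
      simpa using this
    have h1 : s * (b - a) 1 + t * (c - a) 1 = 0 := by
      have := congrArg (fun x : Plane => x 1) hst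
      simpa using this
    constructor
    · have : s * cross (b - a) (c - a) = 0 := by
        unfold cross
        linear_combination (c - a) 1 * h0 - (c - a) 0 * h1
      exact (mul_eq_zero.1 this).resolve_right h
    · have : t * cross (b - a) (c - a) = 0 := by
        unfold cross
        linear_combination (b - a) 0 * h1 - (b - a) 1 * h0
      exact (mul_eq_zero.1 this).resolve_right h

/-- A finite set of points is a nondegenerate triangle. -/
def IsTri (τ : Finset Plane) : Prop :=
  τ.card = 3 ∧ AffineIndependent ℝ (fun x : τ => (x : Plane))

lemma isTri_iff {a b c : Plane} : IsTri {a, b, c} ↔ cross (b - a) (c - a) ≠ 0 := by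
  have key : ∀ (hab : a ≠ b) (hac : a ≠ c) (hbc : b ≠ c),
      (AffineIndependent ℝ (fun x : ({a, b, c} : Finset Plane) => (x : Plane)) ↔
        AffineIndependent ℝ ![a, b, c]) := by
    intro hab hac hbc
    have hinj : Function.Injective ![a, b, c] := by
      intro i j hij
      fin_cases i <;> fin_cases j <;> simp_all
    have hr : Set.range ![a, b, c] = (({a, b, c} : Finset Plane) : Set Plane) := by
      ext x
      simp
      tauto
    constructor
    · intro h
      have : AffineIndependent ℝ (fun x : Set.range ![a, b, c] => (x : Plane)) := by
        rw [hr]; exact h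
      exact AffineIndependent.of_set_of_injective this hinj
    · intro h
      have := h.range
      rw [hr] at this
      exact this
  constructor
  · rintro ⟨hc, hi⟩
    rw [Finset.card_eq_three] at hc
    have hab : a ≠ b := by
      rintro rfl
      obtain ⟨x, y, z, hxy, hxz, hyz, h⟩ := hc
      have h1 : ({a, a, c} : Finset Plane).card = 3 :=
        h ▸ Finset.card_eq_three.2 ⟨x, y, z, hxy, hxz, hyz, rfl⟩
      have h2 : ({a, a, c} : Finset Plane).card ≤ 2 := by simpa using Finset.card_le_two
      omega
    have hac : a ≠ c := by
      rintro rfl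
      obtain ⟨x, y, z, hxy, hxz, hyz, h⟩ := hc
      have h1 : ({a, b, a} : Finset Plane).card = 3 :=
        h ▸ Finset.card_eq_three.2 ⟨x, y, z, hxy, hxz, hyz, rfl⟩
      have h2 : ({a, b, a} : Finset Plane).card ≤ 2 := by
        have : ({a, b, a} : Finset Plane) = {a, b} := by ext; simp; tauto
        rw [this]; exact Finset.card_le_two
      omega
    have hbc : b ≠ c := by
      rintro rfl
      obtain ⟨x, y, z, hxy, hxz, hyz, h⟩ := hc
      have h1 : ({a, b, b} : Finset Plane).card = 3 :=
        h ▸ Finset.card_eq_three.2 ⟨x, y, z, hxy, hxz, hyz, rfl⟩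
      have h2 : ({a, b, b} : Finset Plane).card ≤ 2 := by
        have : ({a, b, b} : Finset Plane) = {a, b} := by ext; simp
        rw [this]; exact Finset.card_le_two
      omega
    exact affineIndependent_iff_cross.1 ((key hab hac hbc).1 hi)
  · intro h
    have hab : a ≠ b := by
      rintro rfl
      simp [cross] at h
    have hac : a ≠ c := by
      rintro rfl
      simp [cross] at h
    have hbc : b ≠ c := by
      rintro rfl
      apply h; unfold cross; ring
    exact ⟨Finset.card_eq_three.2 ⟨a, b, c, hab, hac, hbc, rfl⟩,
      (key hab hac hbc).2 (affineIndependent_iff_cross.2 h)⟩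

/-- An edge of a triangle is given by two vertices; the third vertex completes the triangle. -/
lemma IsTri.exists_edge {τ e : Finset Plane} (h : IsTri τ) (he : e ⊆ τ) (hc : e.card = 2) :
    ∃ a b z, a ≠ b ∧ e = {a, b} ∧ τ = {a, b, z} ∧ z ∉ e ∧ cross (b - a) (z - a) ≠ 0 := by
  obtain ⟨a, b, hab, rfl⟩ := Finset.card_eq_two.1 hc
  have h1 : (τ \ {a, b}).card = 1 := by
    rw [Finset.card_sdiff_of_subset he, h.1, hc]
  obtain ⟨z, hz⟩ := Finset.card_eq_one.1 h1
  have hτ : τ = {a, b, z} := by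
    rw [← Finset.sdiff_union_of_subset he, hz]
    ext x; simp; tauto
  have hze : z ∉ ({a, b} : Finset Plane) := by
    have : z ∈ τ \ {a, b} := by rw [hz]; simp
    exact (Finset.mem_sdiff.1 this).2
  exact ⟨a, b, z, hab, rfl, hτ, hze, isTri_iff.1 (hτ ▸ h)⟩

lemma mem_hull_pair {a b x : Plane} :
    x ∈ hull {a, b} ↔ ∃ s t : ℝ, 0 ≤ s ∧ 0 ≤ t ∧ s + t = 1 ∧ s • a + t • b = x := by
  simp only [hull, Finset.coe_insert, Finset.coe_singleton, convexHull_pair, segment, mem_ofPred_eq]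

lemma mem_hull_triple {a b c x : Plane} :
    x ∈ hull {a, b, c} ↔ ∃ r s t : ℝ, 0 ≤ r ∧ 0 ≤ s ∧ 0 ≤ t ∧ r + s + t = 1 ∧
      r • a + s • b + t • c = x := by
  constructor
  · intro h
    have h' : x ∈ convexHull ℝ (insert c ({a, b} : Set Plane)) := by
      have e : (insert c ({a, b} : Set Plane)) = ((({a, b, c} : Finset Plane)) : Set Plane) := by
        ext; simp; tauto
      rw [e]; exact h
    rw [convexHull_insert (by simp)] at h'
    simp only [mem_convexJoin, mem_singleton_iff, exists_eq_left] at h'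
    obtain ⟨y, hy, p, q, hp, hq, hpq, rfl⟩ := h'
    have hy' : y ∈ hull {a, b} := by simpa [hull] using hy
    obtain ⟨s, t, hs, ht, hst, rfl⟩ := mem_hull_pair.1 hy'
    refine ⟨q * s, q * t, p, by positivity, by positivity, hp, ?_, ?_⟩
    · rw [← mul_add, hst]; linarith
    · module
  · rintro ⟨r, s, t, hr, hs, ht, hsum, rfl⟩
    have hc : Convex ℝ (hull {a, b, c}) := convex_convexHull _ _
    have ha : a ∈ hull {a, b, c} := subset_convexHull _ _ (by simp)
    have hb : b ∈ hull {a, b, c} := subset_convexHull _ _ (by simp)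
    have hcc : c ∈ hull {a, b, c} := subset_convexHull _ _ (by simp)
    have := hc.sum_mem (t := Finset.univ) (w := ![r, s, t]) (z := ![a, b, c])
      (by intro i _; fin_cases i <;> simpa) (by simp [Fin.sum_univ_three, hsum])
      (by intro i _; fin_cases i <;> simpa)
    simpa [Fin.sum_univ_three] using this

lemma center_pair {a b : Plane} (hab : a ≠ b) :
    center {a, b} = (1 / 2 : ℝ) • a + (1 / 2 : ℝ) • b := by
  rw [center, Finset.card_pair hab, Finset.sum_pair hab]
  norm_num

lemma center_triple {a b z : Plane} (h : IsTri {a, b, z}) :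
    center {a, b, z} = (1 / 3 : ℝ) • a + (1 / 3 : ℝ) • b + (1 / 3 : ℝ) • z := by
  have hD := isTri_iff.1 h
  have hab : a ≠ b := by
    rintro rfl
    simp [cross] at hD
  have hac : a ≠ z := by
    rintro rfl
    simp [cross] at hD
  have hbc : b ≠ z := by
    rintro rfl
    apply hD; unfold cross; ring
  rw [center, h.1, Finset.sum_insert (by simp [hab, hac]), Finset.sum_pair hbc]
  norm_num
  module

/-- The outward normal of an edge in coordinates. -/
lemma outwardNormal_eq {a b z : Plane} (h : cross (b - a) (z - a) ≠ 0) :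
    outwardNormal {a, b, z} {a, b} =
      (cross (b - a) (z - a) / |cross (b - a) (z - a)| / ‖b - a‖) • rot (b - a) := by
  have hab : a ≠ b := by
    rintro rfl
    simp [cross] at h
  have hu : b - a ≠ 0 := sub_ne_zero.2 hab.symm
  set S := vectorSpan ℝ ((({a, b} : Finset Plane)) : Set Plane) with hS
  set u : Plane := center {a, b} - center {a, b, z} with hu'
  have hS' : S = Submodule.span ℝ {b - a} := by
    rw [hS, Finset.coe_pair, vectorSpan_pair_rev]
    rfl
  set d : Plane := Sᗮ.starProjection u with hd
  have hdm : d ∈ Sᗮ := Submodule.starProjection_apply_mem _ _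
  have h1 : ⟪d, b - a⟫ = 0 := by
    rw [real_inner_comm]
    exact (Submodule.mem_orthogonal _ _).1 hdm _ (by rw [hS']; exact Submodule.mem_span_singleton_self _)
  -- The projection changes `u` only along the edge, so both have the same product with `rot (b -
  -- a)`.
  have h2 : u - d ∈ S := by
    have := Submodule.sub_starProjection_mem_orthogonal (K := Sᗮ) u
    rwa [Submodule.orthogonal_orthogonal] at this
  have h3 : ⟪rot (b - a), d⟫ = ⟪rot (b - a), u⟫ := by
    rw [hS'] at h2
    obtain ⟨c, hc⟩ := Submodule.mem_span_singleton.1 h2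
    have : ⟪rot (b - a), u - d⟫ = 0 := by
      rw [← hc, inner_smul_right, inner_rot]
      unfold cross; ring
    rw [inner_sub_right] at this
    linarith
  have h4 : ⟪rot (b - a), u⟫ = cross (b - a) (z - a) / 3 := by
    rw [hu', center_pair hab, center_triple (isTri_iff.2 h), inner_rot]
    simp only [cross, PiLp.sub_apply, PiLp.add_apply, PiLp.smul_apply, smul_eq_mul]
    ring
  have h5 := eq_smul_rot hu h1
  rw [h3, h4] at h5
  have hn : 0 < ‖b - a‖ := norm_pos_iff.2 hu
  have hD : 0 < |cross (b - a) (z - a)| := abs_pos.2 h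
  change ‖d‖⁻¹ • d = _
  have hnd : ‖d‖ = |cross (b - a) (z - a)| / 3 / ‖b - a‖ := by
    rw [h5, norm_smul, norm_rot, Real.norm_eq_abs, abs_div, abs_div, abs_of_pos (pow_pos hn 2),
      abs_of_pos (by norm_num : (0 : ℝ) < 3)]
    field_simp
  rw [hnd, h5, smul_smul]
  congr 1
  field_simp

/-- The outward normal is a unit vector orthogonal to the edge, and the opposite vertex lies
behind it. -/
lemma outwardNormal_spec {a b z : Plane} (h : cross (b - a) (z - a) ≠ 0) :
    ‖outwardNormal {a, b, z} {a, b}‖ = 1 ∧ ⟪outwardNormal {a, b, z} {a, b}, b - a⟫ = 0 ∧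
      ⟪outwardNormal {a, b, z} {a, b}, z - a⟫ = -(|cross (b - a) (z - a)| / ‖b - a‖) := by
  have hab : a ≠ b := by
    rintro rfl
    simp [cross] at h
  have hn : 0 < ‖b - a‖ := norm_pos_iff.2 (sub_ne_zero.2 hab.symm)
  have hD : 0 < |cross (b - a) (z - a)| := abs_pos.2 h
  rw [outwardNormal_eq h]
  refine ⟨?_, ?_, ?_⟩
  · rw [norm_smul, norm_rot, Real.norm_eq_abs, abs_div, abs_div, abs_abs, abs_of_pos hn]
    field_simp
  · rw [real_inner_smul_left, inner_rot]
    unfold cross; ring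
  · rw [real_inner_smul_left, inner_rot]
    field_simp
    rw [sq_abs]

/-- Two unit vectors orthogonal to the same nonzero vector agree up to the sign. -/
lemma unit_normal_eq_or {n m u : Plane} (hu : u ≠ 0) (hn : ‖n‖ = 1) (hm : ‖m‖ = 1)
    (h : ⟪n, u⟫ = 0) (h' : ⟪m, u⟫ = 0) : n = m ∨ n = -m := by
  have e1 := eq_smul_rot hu h
  have e2 := eq_smul_rot hu h'
  have hr : ‖rot u‖ ≠ 0 := by
    rw [norm_rot]; exact norm_ne_zero_iff.2 hu
  set s := ⟪rot u, n⟫ / ‖u‖ ^ 2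
  set t := ⟪rot u, m⟫ / ‖u‖ ^ 2
  have h1 : |s| * ‖rot u‖ = |t| * ‖rot u‖ := by
    rw [← Real.norm_eq_abs, ← Real.norm_eq_abs, ← norm_smul, ← norm_smul, ← e1, ← e2, hn, hm]
  have h2 := mul_right_cancel₀ hr h1
  rcases abs_eq_abs.1 h2 with h3 | h3
  · left; rw [e1, e2, h3]
  · right; rw [e1, e2, h3, neg_smul]

lemma volume_hull_pair (a b : Plane) : volume (hull {a, b}) = 0 := by
  have h : hull {a, b} ⊆ (affineSpan ℝ ({a, b} : Set Plane) : Set Plane) := by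
    have := convexHull_subset_affineSpan (𝕜 := ℝ) ({a, b} : Set Plane)
    simpa [hull] using this
  refine measure_mono_null h (Measure.addHaar_affineSubspace _ _ ?_)
  intro htop
  have h1 : Module.finrank ℝ (affineSpan ℝ ({a, b} : Set Plane)).direction ≤ 1 := by
    rw [direction_affineSpan, vectorSpan_pair]
    exact (finrank_span_le_card _).trans (by simp)
  rw [htop, AffineSubspace.direction_top, finrank_top, finrank_euclideanSpace_fin] at h1
  omega

/-- The area of a triangle is half that of the parallelogram, which consists of the triangle and its
mirror image at the midpoint of an edge. -/
lemma area_triple {a b c : Plane} (hD : cross (b - a) (c - a) ≠ 0) :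
    area {a, b, c} = |cross (b - a) (c - a)| / 2 := by
  set H := hull {a, b, c} with hH
  set H' : Set Plane := (fun x => (b + c) - x) ⁻¹' H with hH'
  have hclosed : IsClosed H := (({a, b, c} : Finset Plane).finite_toSet.isCompact_convexHull ℝ).isClosed
  have hcomp : IsCompact H := ({a, b, c} : Finset Plane).finite_toSet.isCompact_convexHull ℝ
  have hvol' : volume H' = volume H :=
    (Measure.measurePreserving_sub_left volume (b + c)).measure_preimage hclosed.nullMeasurableSet
  -- The parallelogram is cut by the diagonal from `b` to `c` into `H` and its mirror image `H'`.
  have hpar : (fun x => a + x) '' parallelepiped ![b - a, c - a] = H ∪ H' := by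
    ext x
    simp only [mem_image, mem_parallelepiped_iff, mem_union, hH', mem_preimage, hH,
      mem_hull_triple, Fin.sum_univ_two]
    constructor
    · rintro ⟨_, ⟨t, ht, rfl⟩, rfl⟩
      have h0 := ht.1 0
      have h1 := ht.1 1
      have h2 := ht.2 0
      have h3 := ht.2 1
      simp only [Pi.zero_apply, Pi.one_apply] at h0 h1 h2 h3
      simp only [Matrix.cons_val_zero, Matrix.cons_val_one]
      by_cases hle : t 0 + t 1 ≤ 1
      · left
        refine ⟨1 - t 0 - t 1, t 0, t 1, by linarith, h0, h1, by ring, by module⟩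
      · right
        refine ⟨t 0 + t 1 - 1, 1 - t 0, 1 - t 1, by linarith, by linarith, by linarith,
          by ring, by module⟩
    · rintro (⟨r, s, t, hr, hs, ht, hsum, rfl⟩ | ⟨r, s, t, hr, hs, ht, hsum, hx⟩)
      · refine ⟨s • (b - a) + t • (c - a), ⟨![s, t], ⟨?_, ?_⟩, by simp⟩, ?_⟩
        · intro i; fin_cases i <;> simpa
        · intro i; fin_cases i <;> simp <;> linarith
        · have : r = 1 - s - t := by linarith
          subst this; module
      · refine ⟨(1 - s) • (b - a) + (1 - t) • (c - a), ⟨![1 - s, 1 - t], ⟨?_, ?_⟩, by simp⟩, ?_⟩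
        · intro i; fin_cases i <;> simp <;> linarith
        · intro i; fin_cases i <;> simpa
        · have : x = b + c - (r • a + s • b + t • c) := by rw [hx]; abel
          rw [this]
          have : r = 1 - s - t := by linarith
          subst this; module
  -- The two halves overlap only in the diagonal, which is a null set.
  have hinter : volume (H ∩ H') = 0 := by
    refine measure_mono_null ?_ (volume_hull_pair b c)
    rintro x ⟨h1, h2⟩
    obtain ⟨r, s, t, hr, hs, ht, hsum, rfl⟩ := mem_hull_triple.1 h1
    obtain ⟨r', s', t', hr', hs', ht', hsum', hx⟩ := mem_hull_triple.1 h2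
    have e1 : (s + s' - 1) • (b - a) + (t + t' - 1) • (c - a) = 0 := by
      have h3 : r = 1 - s - t := by linarith
      have h4 : r' = 1 - s' - t' := by linarith
      subst h3 h4
      have h5 : (1 - s' - t') • a + s' • b + t' • c -
        (b + c - ((1 - s - t) • a + s • b + t • c)) = 0 := sub_eq_zero.2 hx
      rw [← h5]; module
    have e2 : (s + s' - 1) * cross (b - a) (c - a) = 0 := by
      have h0 := congrArg (fun x : Plane => x 0) e1
      have h1 := congrArg (fun x : Plane => x 1) e1
      simp only [PiLp.add_apply, PiLp.smul_apply, smul_eq_mul, PiLp.zero_apply] at h0 h1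
      unfold cross
      linear_combination (c - a) 1 * h0 - (c - a) 0 * h1
    have e3 : (t + t' - 1) * cross (b - a) (c - a) = 0 := by
      have h0 := congrArg (fun x : Plane => x 0) e1
      have h1 := congrArg (fun x : Plane => x 1) e1
      simp only [PiLp.add_apply, PiLp.smul_apply, smul_eq_mul, PiLp.zero_apply] at h0 h1
      unfold cross
      linear_combination (b - a) 0 * h1 - (b - a) 1 * h0
    have e4 := (mul_eq_zero.1 e2).resolve_right hD
    have e5 := (mul_eq_zero.1 e3).resolve_right hD
    have hr0 : r = 0 := by linarith
    exact mem_hull_pair.2 ⟨s, t, hs, ht, by linarith, by rw [hr0]; module⟩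
  have hsum : volume (H ∪ H') = 2 * volume H := by
    rw [measure_union₀ _ hinter, hvol', two_mul]
    exact (hclosed.preimage (by fun_prop)).nullMeasurableSet
  have hvp : volume (parallelepiped ![b - a, c - a]) = ENNReal.ofReal |cross (b - a) (c - a)| := by
    have h1 := Measure.addHaar_parallelepiped (EuclideanSpace.basisFun (Fin 2) ℝ).toBasis
      ![b - a, c - a]
    rw [OrthonormalBasis.addHaar_eq_volume] at h1
    rw [h1, Module.Basis.det_apply, Matrix.det_fin_two]
    congr 2
    simp [Module.Basis.toMatrix_apply, cross]
    ring
  have himg : volume ((fun x => a + x) '' parallelepiped ![b - a, c - a]) =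
      volume (parallelepiped ![b - a, c - a]) := by
    rw [image_add_left, measure_preimage_add]
  rw [hpar, hsum, hvp] at himg
  have := congrArg ENNReal.toReal himg
  rw [ENNReal.toReal_mul, ENNReal.toReal_ofReal (abs_nonneg _)] at this
  simp only [ENNReal.toReal_ofNat] at this
  unfold area
  rw [← hH]
  linarith

lemma len_pair (a b : Plane) : len {a, b} = ‖b - a‖ := by
  rw [len, Finset.coe_pair, Metric.diam_pair, dist_comm, dist_eq_norm]

lemma IsTri.area_pos {τ : Finset Plane} (h : IsTri τ) : 0 < area τ := by
  obtain ⟨a, b, c, _, _, _, rfl⟩ := Finset.card_eq_three.1 h.1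
  rw [area_triple (isTri_iff.1 h)]
  have := abs_pos.2 (isTri_iff.1 h)
  positivity

/-- Length times outward normal is the rotated edge vector, up to the orientation. -/
lemma len_smul_outwardNormal {a b z : Plane} (h : cross (b - a) (z - a) ≠ 0) :
    len {a, b} • outwardNormal {a, b, z} {a, b} =
      (cross (b - a) (z - a) / |cross (b - a) (z - a)|) • rot (b - a) := by
  have hab : a ≠ b := by
    rintro rfl
    simp [cross] at h
  have hn : ‖b - a‖ ≠ 0 := norm_ne_zero_iff.2 (sub_ne_zero.2 hab.symm)
  rw [outwardNormal_eq h, len_pair, smul_smul]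
  congr 1
  field_simp

/-- The divergence theorem on a triangle for the field `x ↦ p + r x`. -/
lemma IsTri.gauss {τ : Finset Plane} (h : IsTri τ) (p : Plane) (r : ℝ) :
    ∑ e ∈ τ.powersetCard 2, len e * ⟪p + r • center e, outwardNormal τ e⟫ = area τ * (2 * r) := by
  obtain ⟨a, b, c, hab, hac, hbc, rfl⟩ := Finset.card_eq_three.1 h.1
  have hD := isTri_iff.1 h
  have hps : ({a, b, c} : Finset Plane).powersetCard 2 = {{a, b}, {b, c}, {c, a}} := by
    ext e
    simp only [Finset.mem_powersetCard, Finset.mem_insert, Finset.mem_singleton]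
    constructor
    · rintro ⟨hs, hc⟩
      obtain ⟨x, y, hxy, rfl⟩ := Finset.card_eq_two.1 hc
      have hx : x ∈ ({a, b, c} : Finset Plane) := hs (by simp)
      have hy : y ∈ ({a, b, c} : Finset Plane) := hs (by simp)
      simp only [Finset.mem_insert, Finset.mem_singleton] at hx hy
      rcases hx with rfl | rfl | rfl <;> rcases hy with rfl | rfl | rfl <;>
        first
        | exact absurd rfl hxy
        | (left; rfl)
        | (left; exact Finset.pair_comm _ _)
        | (right; left; rfl)
        | (right; left; exact Finset.pair_comm _ _)
        | (right; right; rfl)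
        | (right; right; exact Finset.pair_comm _ _)
    · rintro (rfl | rfl | rfl)
      · exact ⟨by intro x; simp; tauto, Finset.card_pair hab⟩
      · exact ⟨by intro x; simp; tauto, Finset.card_pair hbc⟩
      · exact ⟨by intro x; simp; tauto, Finset.card_pair hac.symm⟩
  have n1 : ({a, b} : Finset Plane) ∉ ({{b, c}, {c, a}} : Finset (Finset Plane)) := by
    simp only [Finset.mem_insert, Finset.mem_singleton, not_or]
    constructor
    · intro h
      have : a ∈ ({b, c} : Finset Plane) := h ▸ (by simp)
      simp [hab, hac] at this
    · intro h
      have : b ∈ ({c, a} : Finset Plane) := h ▸ (by simp)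
      simp [hab.symm, hbc] at this
  have n2 : ({b, c} : Finset Plane) ∉ ({{c, a}} : Finset (Finset Plane)) := by
    simp only [Finset.mem_singleton]
    intro h
    have : b ∈ ({c, a} : Finset Plane) := h ▸ (by simp)
    simp [hab.symm, hbc] at this
  have e2 : ({a, b, c} : Finset Plane) = {b, c, a} := by ext; simp; tauto
  have e3 : ({a, b, c} : Finset Plane) = {c, a, b} := by ext; simp; tauto
  have c2 : cross (c - b) (a - b) = cross (b - a) (c - a) := by
    simp only [cross, PiLp.sub_apply]; ring
  have c3 : cross (a - c) (b - c) = cross (b - a) (c - a) := by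
    simp only [cross, PiLp.sub_apply]; ring
  have l1 := len_smul_outwardNormal hD
  have l2 := len_smul_outwardNormal (a := b) (b := c) (z := a) (by rw [c2]; exact hD)
  have l3 := len_smul_outwardNormal (a := c) (b := a) (z := b) (by rw [c3]; exact hD)
  rw [c2, ← e2] at l2
  rw [c3, ← e3] at l3
  rw [hps, Finset.sum_insert n1, Finset.sum_insert n2, Finset.sum_singleton, area_triple hD,
    ← real_inner_smul_right, ← real_inner_smul_right, ← real_inner_smul_right, l1, l2, l3,
    center_pair hab, center_pair hbc, center_pair hac.symm]
  set D := cross (b - a) (c - a) with hDdef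
  -- The orientation sign turns the signed area into the area.
  have hs : D / |D| * D = |D| := by
    have : |D| ≠ 0 := abs_ne_zero.2 hD
    field_simp
    rw [sq_abs]
  set s := D / |D|
  have : |D| / 2 * (2 * r) = r * (s * D) := by rw [hs]; ring
  rw [this, hDdef]
  -- The rotated edge vectors add up to zero, so `p` drops out.
  simp only [real_inner_smul_right, inner_plane, rot_zero_apply, rot_one_apply, cross,
    PiLp.add_apply, PiLp.smul_apply, PiLp.sub_apply, smul_eq_mul]
  ring

/-! ### Faces of triangles -/

lemma hull_mono {s t : Finset Plane} (h : s ⊆ t) : hull s ⊆ hull t :=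
  convexHull_mono (Finset.coe_subset.2 h)

lemma mem_hull_self {s : Finset Plane} {x : Plane} (h : x ∈ s) : x ∈ hull s :=
  subset_convexHull _ _ (Finset.mem_coe.2 h)

lemma hull_subset_hull {s t : Finset Plane} (h : ∀ x ∈ s, x ∈ hull t) : hull s ⊆ hull t :=
  convexHull_min (fun x hx => h x (Finset.mem_coe.1 hx)) (convex_convexHull _ _)

lemma isCompact_hull (s : Finset Plane) : IsCompact (hull s) :=
  s.finite_toSet.isCompact_convexHull ℝ

lemma isClosed_hull (s : Finset Plane) : IsClosed (hull s) := (isCompact_hull s).isClosed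

lemma measurableSet_hull (s : Finset Plane) : MeasurableSet (hull s) :=
  (isClosed_hull s).measurableSet

lemma mem_hull_insert {A : Finset Plane} {c x : Plane} (hc : c ∉ A) :
    x ∈ hull (insert c A) ↔ ∃ (g : ℝ) (w : Plane → ℝ), 0 ≤ g ∧ (∀ y ∈ A, 0 ≤ w y) ∧
      g + ∑ y ∈ A, w y = 1 ∧ g • c + ∑ y ∈ A, w y • y = x := by
  rw [hull, Finset.mem_convexHull']
  constructor
  · rintro ⟨w, h0, h1, h2⟩
    rw [Finset.sum_insert hc] at h1 h2
    exact ⟨w c, w, h0 c (by simp), fun y hy => h0 y (by simp [hy]), h1, h2⟩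
  · rintro ⟨g, w, hg, h0, h1, h2⟩
    have hne : ∀ y ∈ A, y ≠ c := fun y hy h => hc (h ▸ hy)
    refine ⟨fun y => if y = c then g else w y, ?_, ?_, ?_⟩
    · intro y hy
      rcases Finset.mem_insert.1 hy with rfl | hy
      · simpa using hg
      · simpa [hne y hy] using h0 y hy
    · rw [Finset.sum_insert hc, if_pos rfl, ← h1]
      congr 1
      exact Finset.sum_congr rfl fun y hy => by rw [if_neg (hne y hy)]
    · rw [Finset.sum_insert hc]
      beta_reduce
      rw [if_pos rfl, ← h2]
      congr 1
      exact Finset.sum_congr rfl fun y hy => by rw [if_neg (hne y hy)]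

lemma center_eq_sum (e : Finset Plane) : center e = ∑ x ∈ e, (e.card : ℝ)⁻¹ • x := by
  rw [center, Finset.smul_sum]

lemma sum_inv_card {e : Finset Plane} (he : e.Nonempty) : ∑ _x ∈ e, (e.card : ℝ)⁻¹ = 1 := by
  rw [Finset.sum_const, nsmul_eq_mul, mul_inv_cancel₀]
  exact_mod_cast he.card_ne_zero

lemma center_mem_hull {e : Finset Plane} (he : e.Nonempty) : center e ∈ hull e := by
  rw [center_eq_sum, hull, Finset.mem_convexHull']
  exact ⟨fun _ => (e.card : ℝ)⁻¹, fun _ _ => by positivity, sum_inv_card he, rfl⟩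

lemma IsTri.nonempty {τ : Finset Plane} (h : IsTri τ) : τ.Nonempty :=
  Finset.card_pos.1 (by rw [h.1]; norm_num)

lemma nonempty_of_card_two {e : Finset Plane} (h : e.card = 2) : e.Nonempty :=
  Finset.card_pos.1 (by rw [h]; norm_num)

/-- Barycentric coordinates with respect to a triangle are unique. -/
lemma IsTri.weights_eq {τ : Finset Plane} (h : IsTri τ) {w w' : Plane → ℝ}
    (h1 : ∑ y ∈ τ, w y = ∑ y ∈ τ, w' y) (h2 : ∑ y ∈ τ, w y • y = ∑ y ∈ τ, w' y • y) :
    ∀ y ∈ τ, w y = w' y := by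
  intro y hy
  have := affineIndependent_iff.1 h.2 Finset.univ (fun x : τ => w x - w' x)
    (by rw [Finset.univ_eq_attach, Finset.sum_attach τ (fun x => w x - w' x),
          Finset.sum_sub_distrib, h1, sub_self])
    (by
      rw [Finset.univ_eq_attach, Finset.sum_attach τ (fun x => (w x - w' x) • x)]
      simp only [sub_smul, Finset.sum_sub_distrib, h2, sub_self])
    ⟨y, hy⟩ (Finset.mem_univ _)
  exact sub_eq_zero.1 this

lemma IsTri.hull_inter {τ A B : Finset Plane} (h : IsTri τ) (hA : A ⊆ τ) (hB : B ⊆ τ) :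
    hull A ∩ hull B = hull (A ∩ B) := by
  have := h.2.convexHull_inter hA hB
  rw [hull, hull, hull, Finset.coe_inter, this]

/-- The barycentric coordinates of a point on a face vanish at the other vertices. -/
lemma IsTri.weight_eq_zero {τ A : Finset Plane} (h : IsTri τ) (hA : A ⊆ τ) {w : Plane → ℝ}
    (h1 : ∑ y ∈ τ, w y = 1) (h2 : ∑ y ∈ τ, w y • y ∈ hull A) : ∀ y ∈ τ, y ∉ A → w y = 0 := by
  rw [hull, Finset.mem_convexHull'] at h2
  obtain ⟨w', _, h4, h5⟩ := h2
  have hs : ∀ (f : Plane → ℝ), ∑ y ∈ τ, (if y ∈ A then f y else 0) = ∑ y ∈ A, f y := by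
    intro f
    rw [← Finset.sum_filter, Finset.filter_mem_eq_inter, Finset.inter_eq_right.2 hA]
  have hs' : ∑ y ∈ τ, (if y ∈ A then w' y else 0) • y = ∑ y ∈ A, w' y • y := by
    simp only [ite_smul, zero_smul]
    rw [← Finset.sum_filter, Finset.filter_mem_eq_inter, Finset.inter_eq_right.2 hA]
  intro y hy hyA
  have := h.weights_eq (w := w) (w' := fun y => if y ∈ A then w' y else 0)
    (by rw [h1, hs, h4]) (by rw [hs', h5]) y hy
  simpa [hyA] using this

/-- The center of a face lies on another face only if the first face is contained in the second. -/
lemma IsTri.subset_of_center_mem {τ e A : Finset Plane} (h : IsTri τ) (he : e ⊆ τ)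
    (hne : e.Nonempty) (hA : A ⊆ τ) (hc : center e ∈ hull A) : e ⊆ A := by
  have hs : ∑ y ∈ τ, (if y ∈ e then (e.card : ℝ)⁻¹ else 0) = 1 := by
    rw [← Finset.sum_filter, Finset.filter_mem_eq_inter, Finset.inter_eq_right.2 he,
      sum_inv_card hne]
  have hs' : ∑ y ∈ τ, (if y ∈ e then (e.card : ℝ)⁻¹ else 0) • y = center e := by
    simp only [ite_smul, zero_smul]
    rw [← Finset.sum_filter, Finset.filter_mem_eq_inter, Finset.inter_eq_right.2 he, center_eq_sum]
  intro y hy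
  by_contra hyA
  have := h.weight_eq_zero hA hs (by rw [hs']; exact hc) y (he hy) hyA
  rw [if_pos hy, inv_eq_zero] at this
  exact hne.card_ne_zero (by exact_mod_cast this)

/-- Faces are extremal: if the center of some points of a triangle lies on a face, so do the
points. -/
lemma IsTri.hull_subset_of_center_mem {K e E : Finset Plane} (h : IsTri K) (hE : E ⊆ K)
    (he : hull e ⊆ hull K) (hne : e.Nonempty) (hc : center e ∈ hull E) : hull e ⊆ hull E := by
  have hW : ∀ x : Plane, ∃ w : Plane → ℝ, x ∈ e →
      (∀ y ∈ K, 0 ≤ w y) ∧ ∑ y ∈ K, w y = 1 ∧ ∑ y ∈ K, w y • y = x := by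
    intro x
    by_cases hx : x ∈ e
    · have := he (mem_hull_self hx)
      rw [hull, Finset.mem_convexHull'] at this
      obtain ⟨w, hw⟩ := this
      exact ⟨w, fun _ => hw⟩
    · exact ⟨0, fun h => absurd h hx⟩
  choose W hW using hW
  have h1 : ∑ y ∈ K, ∑ x ∈ e, (e.card : ℝ)⁻¹ * W x y = 1 := by
    rw [Finset.sum_comm, ← sum_inv_card hne]
    refine Finset.sum_congr rfl fun x hx => ?_
    rw [← Finset.mul_sum, (hW x hx).2.1, mul_one]
  have h2 : ∑ y ∈ K, (∑ x ∈ e, (e.card : ℝ)⁻¹ * W x y) • y = center e := by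
    simp only [Finset.sum_smul]
    rw [Finset.sum_comm, center_eq_sum]
    refine Finset.sum_congr rfl fun x hx => ?_
    conv_rhs => rw [← (hW x hx).2.2]
    rw [Finset.smul_sum]
    exact Finset.sum_congr rfl fun y _ => mul_smul _ _ _
  have h3 := h.weight_eq_zero hE h1 (by rw [h2]; exact hc)
  have hpos : (0 : ℝ) < (e.card : ℝ)⁻¹ := by
    have := hne.card_pos
    positivity
  refine hull_subset_hull fun x hx => ?_
  have h4 : ∀ y ∈ K, y ∉ E → W x y = 0 := by
    intro y hy hyE
    have h5 := h3 y hy hyE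
    rw [Finset.sum_eq_zero_iff_of_nonneg
      (fun x hx => mul_nonneg hpos.le ((hW x hx).1 y hy))] at h5
    exact (mul_eq_zero.1 (h5 x hx)).resolve_left hpos.ne'
  rw [hull, Finset.mem_convexHull']
  refine ⟨W x, fun y hy => (hW x hx).1 y (hE hy), ?_, ?_⟩
  · rw [← (hW x hx).2.1]
    exact Finset.sum_subset hE fun y hy hyE => h4 y hy hyE
  · conv_rhs => rw [← (hW x hx).2.2]
    exact Finset.sum_subset hE fun y hy hyE => by rw [h4 y hy hyE, zero_smul]

lemma exists_subset_pair {E : Finset Plane} (h : E.card ≤ 2) : ∃ a b, E ⊆ {a, b} := by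
  have h' : E.card = 0 ∨ E.card = 1 ∨ E.card = 2 := by omega
  rcases h' with h | h | h
  · rw [Finset.card_eq_zero] at h
    exact ⟨0, 0, by simp [h]⟩
  · obtain ⟨a, rfl⟩ := Finset.card_eq_one.1 h
    exact ⟨a, a, by simp⟩
  · obtain ⟨a, b, _, rfl⟩ := Finset.card_eq_two.1 h
    exact ⟨a, b, subset_rfl⟩

lemma IsTri.not_subset_hull {τ E : Finset Plane} (h : IsTri τ) (hE : E.card ≤ 2) :
    ¬ hull τ ⊆ hull E := by
  intro hsub
  obtain ⟨a, b, hab⟩ := exists_subset_pair hE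
  obtain ⟨x, y, z, _, _, _, rfl⟩ := Finset.card_eq_three.1 h.1
  have hx := hull_mono hab (hsub (mem_hull_self (x := x) (by simp)))
  have hy := hull_mono hab (hsub (mem_hull_self (x := y) (by simp)))
  have hz := hull_mono hab (hsub (mem_hull_self (x := z) (by simp)))
  obtain ⟨s, t, _, _, h1, rfl⟩ := mem_hull_pair.1 hx
  obtain ⟨s', t', _, _, h2, rfl⟩ := mem_hull_pair.1 hy
  obtain ⟨s'', t'', _, _, h3, rfl⟩ := mem_hull_pair.1 hz
  apply isTri_iff.1 h
  have e1 : s = 1 - t := by linarith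
  have e2 : s' = 1 - t' := by linarith
  have e3 : s'' = 1 - t'' := by linarith
  subst e1 e2 e3
  simp only [cross, PiLp.add_apply, PiLp.smul_apply, PiLp.sub_apply, smul_eq_mul]
  ring

lemma two_le_card_of_hull_subset {e F : Finset Plane} (he : e.card = 2) (h : hull e ⊆ hull F) :
    2 ≤ F.card := by
  by_contra hF
  obtain ⟨a, b, hab, rfl⟩ := Finset.card_eq_two.1 he
  have ha := h (mem_hull_self (x := a) (by simp))
  have hb := h (mem_hull_self (x := b) (by simp))
  have hF' : F.card ≤ 1 := by omega
  obtain ⟨c, hc⟩ : ∃ c, F ⊆ {c} := by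
    rcases Finset.card_le_one_iff_subset_singleton.1 hF' with ⟨c, hc⟩
    exact ⟨c, hc⟩
  have ha' := hull_mono hc ha
  have hb' := hull_mono hc hb
  simp only [hull, Finset.coe_singleton, convexHull_singleton, mem_singleton_iff] at ha' hb'
  exact hab (ha'.trans hb'.symm)

lemma cross_eq_zero_of_mem_hull_pair {a b x : Plane} (h : x ∈ hull {a, b}) :
    cross (b - a) (x - a) = 0 := by
  obtain ⟨s, t, _, _, h1, rfl⟩ := mem_hull_pair.1 h
  have e1 : s = 1 - t := by linarith
  subst e1
  simp only [cross, PiLp.add_apply, PiLp.smul_apply, PiLp.sub_apply, smul_eq_mul]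
  ring

/-- If `z` and `y` lie on the same side of the line through `a` and `b`, then points close to the
midpoint of `a` and `b` on the way to `y` belong to the triangle with vertices `a`, `b`, `z`. -/
lemma exists_mem_hull_of_same_side {a b z y : Plane}
    (h : 0 < cross (b - a) (z - a) * cross (b - a) (y - a)) :
    ∃ t : ℝ, 0 < t ∧ t ≤ 1 ∧
      ((1 - t) / 2) • a + ((1 - t) / 2) • b + t • y ∈ hull {a, b, z} := by
  set D := cross (b - a) (z - a) with hD
  have hD0 : D ≠ 0 := by
    intro h0; rw [h0, zero_mul] at h; exact lt_irrefl _ h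
  set β := cross (b - a) (y - a) / D with hβ
  have hβ0 : 0 < β := by
    rw [hβ, div_eq_mul_inv]
    have : cross (b - a) (y - a) * D⁻¹ = D * cross (b - a) (y - a) * (D⁻¹) ^ 2 := by
      field_simp
    rw [this]
    positivity
  set α := cross (y - a) (z - a) / D with hα
  have hy : y = a + α • (b - a) + β • (z - a) := by
    apply plane_ext
    · simp only [PiLp.add_apply, PiLp.smul_apply, smul_eq_mul, hα, hβ]
      field_simp
      simp only [hD, cross, PiLp.sub_apply]
      ring
    · simp only [PiLp.add_apply, PiLp.smul_apply, smul_eq_mul, hα, hβ]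
      field_simp
      simp only [hD, cross, PiLp.sub_apply]
      ring
  -- In the basis `b - a`, `z - a` the point has the barycentric coordinates `(1 - t) / 2 + t (1 - α
  -- - β)`, `(1 - t) / 2 + t α` and `t β`; this `t` is small enough to keep the first two
  -- nonnegative.
  refine ⟨1 / (1 + 2 * (|α| + β + 1)), by positivity, ?_, ?_⟩
  · rw [div_le_one (by positivity)]
    have := abs_nonneg α
    linarith
  · set t := 1 / (1 + 2 * (|α| + β + 1)) with ht
    have ht0 : 0 < t := by positivity
    have ht1 : t * (1 + 2 * (|α| + β + 1)) = 1 := by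
      rw [ht]; field_simp
    have h1 := le_abs_self α
    have h2 := neg_abs_le α
    have e1 := mul_le_mul_of_nonneg_left h1 ht0.le
    have e2 := mul_le_mul_of_nonneg_left h2 ht0.le
    refine mem_hull_triple.2 ⟨(1 - t) / 2 + t * (1 - α - β), (1 - t) / 2 + t * α, t * β,
      ?_, ?_, by positivity, by ring, ?_⟩
    · linarith
    · have := mul_nonneg ht0.le hβ0.le
      linarith
    · conv_rhs => rw [hy]
      module

/-! ### Conforming triangulations -/

lemma mem_edges {T : Finset (Finset Plane)} {e : Finset Plane} :
    e ∈ edges T ↔ ∃ τ ∈ T, e ⊆ τ ∧ e.card = 2 := by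
  simp [edges, Finset.mem_powersetCard]

namespace Triangulation

variable (T : Triangulation)

lemma isTri {τ : Finset Plane} (h : τ ∈ T.triangles) : IsTri τ := ⟨T.card_eq τ h, T.indep τ h⟩

variable {T}

lemma eq_of_subset {σ τ : Finset Plane} (hσ : σ ∈ T.triangles) (hτ : τ ∈ T.triangles)
    (h : σ ⊆ τ) : σ = τ :=
  Finset.eq_of_subset_of_card_le h (by rw [T.card_eq _ hσ, T.card_eq _ hτ])

lemma subset_of_center_mem {σ τ e : Finset Plane} (hσ : σ ∈ T.triangles) (hτ : τ ∈ T.triangles)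
    (he : e ⊆ τ) (hne : e.Nonempty) (hc : center e ∈ hull σ) : e ⊆ σ := by
  have h1 : center e ∈ hull (σ ∩ τ) := by
    rw [← T.conforming σ hσ τ hτ]
    exact ⟨hc, hull_mono he (center_mem_hull hne)⟩
  exact ((T.isTri hτ).subset_of_center_mem he hne Finset.inter_subset_right h1).trans
    Finset.inter_subset_left

lemma eq_of_center_mem {σ τ : Finset Plane} (hσ : σ ∈ T.triangles) (hτ : τ ∈ T.triangles)
    (hc : center τ ∈ hull σ) : τ = σ :=
  eq_of_subset hτ hσ (subset_of_center_mem hσ hτ subset_rfl (T.isTri hτ).nonempty hc)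

lemma card_inter_le {σ τ : Finset Plane} (hσ : σ ∈ T.triangles) (hτ : τ ∈ T.triangles)
    (hne : σ ≠ τ) : (σ ∩ τ).card ≤ 2 := by
  by_contra h
  have h3 := T.card_eq _ hσ
  have : σ ∩ τ = σ := Finset.eq_of_subset_of_card_le Finset.inter_subset_left (by omega)
  exact hne (eq_of_subset hσ hτ (Finset.inter_eq_left.1 this))

lemma card_inter_eq_two {σ τ e : Finset Plane} (hσ : σ ∈ T.triangles) (hτ : τ ∈ T.triangles)
    (hne : σ ≠ τ) (he : e.card = 2) (h1 : hull e ⊆ hull σ) (h2 : hull e ⊆ hull τ) :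
    (σ ∩ τ).card = 2 ∧ hull e ⊆ hull (σ ∩ τ) := by
  have h : hull e ⊆ hull (σ ∩ τ) := by
    rw [← T.conforming σ hσ τ hτ]
    exact subset_inter h1 h2
  exact ⟨le_antisymm (card_inter_le hσ hτ hne) (two_le_card_of_hull_subset he h), h⟩

/-- Edges of a conforming triangulation that share a segment are equal. -/
lemma edge_unique {E E' e : Finset Plane} (hE : E ∈ edges T.triangles)
    (hE' : E' ∈ edges T.triangles) (he : e.card = 2) (h : hull e ⊆ hull E)
    (h' : hull e ⊆ hull E') : E = E' := by
  obtain ⟨σ, hσ, hEσ, hEc⟩ := mem_edges.1 hE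
  obtain ⟨σ', hσ', hEσ', hEc'⟩ := mem_edges.1 hE'
  have h1 : hull e ⊆ hull (σ ∩ σ') := by
    rw [← T.conforming σ hσ σ' hσ']
    exact subset_inter (h.trans (hull_mono hEσ)) (h'.trans (hull_mono hEσ'))
  have h2 : hull e ⊆ hull (E ∩ (σ ∩ σ')) := by
    rw [← (T.isTri hσ).hull_inter hEσ Finset.inter_subset_left]
    exact subset_inter h h1
  have h3 : E ∩ (σ ∩ σ') = E :=
    Finset.eq_of_subset_of_card_le Finset.inter_subset_left
      (by rw [hEc]; exact two_le_card_of_hull_subset he h2)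
  have h4 : E ⊆ σ' := (Finset.inter_eq_left.1 h3).trans Finset.inter_subset_right
  have h5 : hull e ⊆ hull (E ∩ E') := by
    rw [← (T.isTri hσ').hull_inter h4 hEσ']
    exact subset_inter h h'
  have h6 := two_le_card_of_hull_subset he h5
  have h7 : E ∩ E' = E :=
    Finset.eq_of_subset_of_card_le Finset.inter_subset_left (by rw [hEc]; exact h6)
  have h8 : E ∩ E' = E' :=
    Finset.eq_of_subset_of_card_le Finset.inter_subset_right (by rw [hEc']; exact h6)
  rw [← h7, h8]

/-- Two triangles sharing an edge lie on different sides of it. -/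
lemma outwardNormal_neg {σ τ e : Finset Plane} (hσ : σ ∈ T.triangles) (hτ : τ ∈ T.triangles)
    (hne : σ ≠ τ) (heσ : e ⊆ σ) (heτ : e ⊆ τ) (he : e.card = 2) :
    outwardNormal σ e = -outwardNormal τ e := by
  have hinter : σ ∩ τ = e := by
    refine (Finset.eq_of_subset_of_card_le (Finset.subset_inter heσ heτ) ?_).symm
    rw [he]; exact card_inter_le hσ hτ hne
  obtain ⟨a, b, z, hab, rfl, rfl, hz, hD⟩ := (T.isTri hσ).exists_edge heσ he
  obtain ⟨y, hy, hD'⟩ : ∃ y, τ = {a, b, y} ∧ cross (b - a) (y - a) ≠ 0 := by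
    obtain ⟨a', b', y, hab', hE, rfl, hy, hD'⟩ := (T.isTri hτ).exists_edge heτ he
    have hτ' : ({a', b', y} : Finset Plane) = {a, b, y} := by
      have e1 : ({a', b', y} : Finset Plane) = insert y {a', b'} := by ext; simp; tauto
      have e2 : ({a, b, y} : Finset Plane) = insert y {a, b} := by ext; simp; tauto
      rw [e1, e2, hE]
    exact ⟨y, hτ', isTri_iff.1 (hτ' ▸ T.isTri hτ)⟩
  subst hy
  obtain ⟨n1, n2, n3⟩ := outwardNormal_spec hD
  obtain ⟨m1, m2, m3⟩ := outwardNormal_spec hD'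
  have hu : b - a ≠ 0 := sub_ne_zero.2 hab.symm
  rcases unit_normal_eq_or hu n1 m1 n2 m2 with h | h
  · exfalso
    rw [outwardNormal_eq hD, outwardNormal_eq hD'] at h
    have hn : 0 < ‖b - a‖ := norm_pos_iff.2 hu
    have hr : rot (b - a) ≠ 0 := by
      rw [← norm_ne_zero_iff, norm_rot]; exact hn.ne'
    have h1 := smul_left_injective ℝ hr h
    have h2 := (div_left_inj' hn.ne').1 h1
    set D := cross (b - a) (z - a)
    set D' := cross (b - a) (y - a)
    have hpos : 0 < D * D' := by
      have a1 : 0 < |D| := abs_pos.2 hD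
      have a2 : 0 < |D'| := abs_pos.2 hD'
      have : D = D' / |D'| * |D| := by rw [← h2]; field_simp
      rw [this]
      have : D' / |D'| * |D| * D' = D' ^ 2 * |D| / |D'| := by ring
      rw [this]
      positivity
    -- With equal normals the triangles lie on the same side of the edge and share a point off the
    -- line through it, although they may only meet in the edge.
    obtain ⟨t, ht0, ht1, hmem⟩ := exists_mem_hull_of_same_side hpos
    have hmem' : ((1 - t) / 2) • a + ((1 - t) / 2) • b + t • y ∈ hull {a, b, y} :=
      mem_hull_triple.2 ⟨_, _, t, by linarith, by linarith, ht0.le, by ring, rfl⟩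
    have hmem'' : ((1 - t) / 2) • a + ((1 - t) / 2) • b + t • y ∈ hull {a, b} := by
      rw [← hinter, ← T.conforming _ hσ _ hτ]
      exact ⟨hmem, hmem'⟩
    have h0 := cross_eq_zero_of_mem_hull_pair hmem''
    have h3 : t * D' = 0 := by
      rw [← h0]
      simp only [D', cross, PiLp.add_apply, PiLp.smul_apply, PiLp.sub_apply, smul_eq_mul]
      ring
    rcases mul_eq_zero.1 h3 with h4 | h4
    · exact ht0.ne' h4
    · exact hD' h4
  · exact h

lemma norm_outwardNormal {τ e : Finset Plane} (hτ : τ ∈ T.triangles) (he : e ⊆ τ)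
    (hc : e.card = 2) : ‖outwardNormal τ e‖ = 1 := by
  obtain ⟨a, b, z, hab, rfl, rfl, hz, hD⟩ := (T.isTri hτ).exists_edge he hc
  exact (outwardNormal_spec hD).1

/-- An edge belongs to at most two triangles. -/
lemma not_three {σ τ υ e : Finset Plane} (hσ : σ ∈ T.triangles) (hτ : τ ∈ T.triangles)
    (hυ : υ ∈ T.triangles) (heσ : e ⊆ σ) (heτ : e ⊆ τ) (heυ : e ⊆ υ) (he : e.card = 2)
    (h1 : σ ≠ τ) (h2 : σ ≠ υ) : τ = υ := by
  -- Three pairwise opposite normals would be zero.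
  by_contra h3
  have e1 := outwardNormal_neg hσ hτ h1 heσ heτ he
  have e2 := outwardNormal_neg hσ hυ h2 heσ heυ he
  have e3 := outwardNormal_neg hτ hυ h3 heτ heυ he
  have hn := norm_outwardNormal hυ heυ he
  have : outwardNormal υ e = 0 := by
    have h4 : -outwardNormal τ e = -outwardNormal υ e := e1.symm.trans e2
    rw [e3, neg_neg] at h4
    have h5 : (2 : ℝ) • outwardNormal υ e = 0 := by
      rw [two_smul]; nth_rewrite 1 [h4]; simp
    simpa using h5
  rw [this, norm_zero] at hn
  exact zero_ne_one hn

/-- The centroid of a triangle is not a vertex of the triangulation. -/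
lemma center_notMem {σ τ : Finset Plane} (hσ : σ ∈ T.triangles) (hτ : τ ∈ T.triangles) :
    center τ ∉ σ := by
  intro h
  have h1 := eq_of_center_mem hσ hτ (mem_hull_self h)
  subst h1
  have h2 := (T.isTri hσ).subset_of_center_mem subset_rfl (T.isTri hσ).nonempty
    (Finset.singleton_subset_iff.2 h) (mem_hull_self (Finset.mem_singleton_self _))
  have h3 := Finset.card_le_card h2
  rw [T.card_eq _ hσ, Finset.card_singleton] at h3
  omega

/-! ### Subdivision at the centroids -/

lemma mem_subdivide {K : Finset Plane} :
    K ∈ subdivide T ↔ ∃ σ ∈ T.triangles, ∃ e ⊆ σ, e.card = 2 ∧ K = insert (center σ) e := by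
  simp only [subdivide, Finset.mem_biUnion, Finset.mem_image, Finset.mem_powersetCard]
  constructor
  · rintro ⟨σ, hσ, e, ⟨he, hc⟩, rfl⟩
    exact ⟨σ, hσ, e, he, hc, rfl⟩
  · rintro ⟨σ, hσ, e, he, hc, rfl⟩
    exact ⟨σ, hσ, e, ⟨he, hc⟩, rfl⟩

lemma isTri_insert_center {σ e : Finset Plane} (hσ : IsTri σ) (he : e ⊆ σ) (hc : e.card = 2) :
    IsTri (insert (center σ) e) := by
  obtain ⟨a, b, z, hab, rfl, rfl, hz, hD⟩ := hσ.exists_edge he hc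
  have e1 : insert (center {a, b, z}) ({a, b} : Finset Plane) = {a, b, center {a, b, z}} := by
    ext; simp; tauto
  rw [e1, isTri_iff, center_triple hσ]
  have : cross (b - a) ((1 / 3 : ℝ) • a + (1 / 3 : ℝ) • b + (1 / 3 : ℝ) • z - a) =
      cross (b - a) (z - a) / 3 := by
    simp only [cross, PiLp.add_apply, PiLp.smul_apply, PiLp.sub_apply, smul_eq_mul]
    ring
  rw [this]
  exact div_ne_zero hD (by norm_num)

lemma hull_insert_center_subset {σ e : Finset Plane} (hσ : IsTri σ) (he : e ⊆ σ) :
    hull (insert (center σ) e) ⊆ hull σ := by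
  refine hull_subset_hull fun x hx => ?_
  rcases Finset.mem_insert.1 hx with rfl | hx
  · exact center_mem_hull hσ.nonempty
  · exact mem_hull_self (he hx)

/-- Points of a subdivided element in terms of the barycentric coordinates of the parent
triangle: a multiple of the centroid plus a combination of the vertices on the edge. -/
lemma exists_weights {σ e : Finset Plane} (hσ : σ ∈ T.triangles) (he : e ⊆ σ) {x : Plane}
    (hx : x ∈ hull (insert (center σ) e)) :
    ∃ (g : ℝ) (w : Plane → ℝ), 0 ≤ g ∧ (∀ y, 0 ≤ w y) ∧ (∀ y, y ∉ e → w y = 0) ∧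
      g + ∑ y ∈ σ, w y = 1 ∧ g • center σ + ∑ y ∈ σ, w y • y = x ∧
      ∑ y ∈ σ, (g * 3⁻¹ + w y) = 1 ∧ ∑ y ∈ σ, (g * 3⁻¹ + w y) • y = x := by
  have hc : center σ ∉ e := fun h => center_notMem hσ hσ (he h)
  obtain ⟨g, w, hg, hw, h1, h2⟩ := (mem_hull_insert hc).1 hx
  have hs : ∑ y ∈ σ, (if y ∈ e then w y else 0) = ∑ y ∈ e, w y := by
    rw [← Finset.sum_filter, Finset.filter_mem_eq_inter, Finset.inter_eq_right.2 he]
  have hs' : ∑ y ∈ σ, (if y ∈ e then w y else 0) • y = ∑ y ∈ e, w y • y := by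
    simp only [ite_smul, zero_smul]
    rw [← Finset.sum_filter, Finset.filter_mem_eq_inter, Finset.inter_eq_right.2 he]
  have h3 : (σ.card : ℝ) = 3 := by rw [T.card_eq σ hσ]; norm_num
  refine ⟨g, fun y => if y ∈ e then w y else 0, hg, ?_, ?_, by rw [hs, h1], by rw [hs', h2], ?_, ?_⟩
  · intro y
    by_cases hy : y ∈ e
    · simpa [hy] using hw y hy
    · simp [hy]
  · intro y hy
    simp [hy]
  · rw [Finset.sum_add_distrib, hs, Finset.sum_const, nsmul_eq_mul, h3, ← h1]
    ring
  · simp only [add_smul, Finset.sum_add_distrib]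
    rw [hs', ← h2, center, h3, smul_smul, Finset.smul_sum]

/-- A subdivided element meets the proper faces of its parent only in faces of the edge that it
shares with the parent. -/
lemma hull_insert_center_inter {σ e F : Finset Plane} (hσ : σ ∈ T.triangles) (he : e ⊆ σ)
    (hF : F ⊆ σ) (hFσ : F ≠ σ) {x : Plane} (hx : x ∈ hull (insert (center σ) e))
    (hxF : x ∈ hull F) : x ∈ hull (e ∩ F) := by
  have hc : center σ ∉ e := fun h => center_notMem hσ hσ (he h)
  obtain ⟨g, w, hg, hw, hw0, h1, h2, h3, h4⟩ := exists_weights hσ he hx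
  obtain ⟨y, hy, hyF⟩ : ∃ y ∈ σ, y ∉ F := by
    by_contra! h
    exact hFσ (Finset.Subset.antisymm hF h)
  have h5 := (T.isTri hσ).weight_eq_zero hF h3 (by rw [h4]; exact hxF) y hy hyF
  have hg0 : g = 0 := by
    have := hw y
    linarith
  have hxe : x ∈ hull e := by
    rw [hull, Finset.mem_convexHull']
    refine ⟨w, fun y _ => hw y, ?_, ?_⟩
    · rw [hg0, zero_add] at h1
      rw [← h1]
      exact Finset.sum_subset he fun y _ hy => hw0 y hy
    · rw [hg0, zero_smul, zero_add] at h2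
      rw [← h2]
      exact Finset.sum_subset he fun y _ hy => by rw [hw0 y hy, zero_smul]
  rw [← (T.isTri hσ).hull_inter he hF]
  exact ⟨hxe, hxF⟩

/-- Two elements of the subdivision meet only in the convex hull of their common vertices. -/
lemma subdivide_conforming_aux {σ σ' e e' : Finset Plane} (hσ : σ ∈ T.triangles)
    (hσ' : σ' ∈ T.triangles) (he : e ⊆ σ) (he' : e' ⊆ σ')
    (hec : e.card = 2) (hec' : e'.card = 2) {x : Plane}
    (hx : x ∈ hull (insert (center σ) e)) (hx' : x ∈ hull (insert (center σ') e')) :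
    x ∈ hull (insert (center σ) e ∩ insert (center σ') e') := by
  by_cases hσσ : σ = σ'
  · subst hσσ
    -- In the same parent triangle: barycentric coordinates of the parent are unique, and the weight
    -- `g / 3` that comes from the centroid is the smallest of the three coordinates.
    obtain ⟨g, w, hg, hw, hw0, h1, h2, h3, h4⟩ := exists_weights hσ he hx
    obtain ⟨g', w', hg', hw', hw0', h1', h2', h3', h4'⟩ := exists_weights hσ he' hx'
    have hW := (T.isTri hσ).weights_eq (w := fun y => g * 3⁻¹ + w y)
      (w' := fun y => g' * 3⁻¹ + w' y) (by rw [h3, h3']) (by rw [h4, h4'])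
    have hex : ∀ A ⊆ σ, A.card = 2 → ∃ y ∈ σ, y ∉ A := by
      intro A hA hAc
      by_contra! h
      have := Finset.card_le_card h
      rw [T.card_eq σ hσ] at this
      omega
    obtain ⟨y, hy, hye⟩ := hex e he hec
    obtain ⟨y', hy', hye'⟩ := hex e' he' hec'
    have hgg : g = g' := by
      have e1 := hW y hy
      have e2 := hW y' hy'
      have e3 := hw0 y hye
      have e4 := hw0' y' hye'
      have e5 := hw' y
      have e6 := hw y'
      apply le_antisymm <;> linarith
    have hww : ∀ y ∈ σ, y ∉ e ∩ e' → w y = 0 := by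
      intro y hy hyn
      by_cases h : y ∈ e
      · have h' : y ∉ e' := fun h' => hyn (Finset.mem_inter.2 ⟨h, h'⟩)
        have e1 := hW y hy
        simp only [hgg, hw0' y h'] at e1
        linarith
      · exact hw0 y h
    have hsub : e ∩ e' ⊆ σ := Finset.inter_subset_left.trans he
    have hc : center σ ∉ e ∩ e' := fun h => center_notMem hσ hσ (hsub h)
    have hmem : x ∈ hull (insert (center σ) (e ∩ e')) := by
      refine (mem_hull_insert hc).2 ⟨g, w, hg, fun y _ => hw y, ?_, ?_⟩
      · rw [← h1]
        congr 1
        exact Finset.sum_subset hsub fun y hy hyn => hww y hy hyn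
      · rw [← h2]
        congr 1
        exact Finset.sum_subset hsub fun y hy hyn => by rw [hww y hy hyn, zero_smul]
    refine hull_mono ?_ hmem
    rw [Finset.insert_inter_distrib]
  -- In different parent triangles: the point lies on their common face, where the weight of the
  -- centroid vanishes on both sides.
  · have hF : x ∈ hull (σ ∩ σ') := by
      rw [← T.conforming σ hσ σ' hσ']
      exact ⟨hull_insert_center_subset (T.isTri hσ) he hx,
        hull_insert_center_subset (T.isTri hσ') he' hx'⟩
    have hne : σ ∩ σ' ≠ σ := fun h => hσσ (eq_of_subset hσ hσ' (Finset.inter_eq_left.1 h))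
    have hne' : σ ∩ σ' ≠ σ' := fun h => hσσ (eq_of_subset hσ' hσ (Finset.inter_eq_right.1 h)).symm
    have h1 := hull_insert_center_inter hσ he Finset.inter_subset_left hne hx hF
    have h2 := hull_insert_center_inter hσ' he' Finset.inter_subset_right hne' hx' hF
    have h3 : x ∈ hull (e ∩ (σ ∩ σ') ∩ (e' ∩ (σ ∩ σ'))) := by
      rw [← (T.isTri hσ).hull_inter (Finset.inter_subset_left.trans he)
        (Finset.inter_subset_right.trans Finset.inter_subset_left)]
      exact ⟨h1, h2⟩
    refine hull_mono ?_ h3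
    intro y hy
    simp only [Finset.mem_inter, Finset.mem_insert] at hy ⊢
    tauto

variable (T) in
/-- The triangulation obtained by joining the centroid of every triangle to its vertices. -/
def subdivided : Triangulation where
  triangles := subdivide T
  card_eq := by
    intro K hK
    obtain ⟨σ, hσ, e, he, hc, rfl⟩ := mem_subdivide.1 hK
    exact (isTri_insert_center (T.isTri hσ) he hc).1
  indep := by
    intro K hK
    obtain ⟨σ, hσ, e, he, hc, rfl⟩ := mem_subdivide.1 hK
    exact (isTri_insert_center (T.isTri hσ) he hc).2
  conforming := by
    intro K hK K' hK'
    obtain ⟨σ, hσ, e, he, hc, rfl⟩ := mem_subdivide.1 hK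
    obtain ⟨σ', hσ', e', he', hc', rfl⟩ := mem_subdivide.1 hK'
    refine Subset.antisymm (fun x hx => subdivide_conforming_aux hσ hσ' he he' hc hc' hx.1 hx.2) ?_
    exact subset_inter (hull_mono Finset.inter_subset_left) (hull_mono Finset.inter_subset_right)

lemma edges_subset_edges_subdivide {E : Finset Plane} (h : E ∈ edges T.triangles) :
    E ∈ edges (subdivide T) := by
  obtain ⟨σ, hσ, he, hc⟩ := mem_edges.1 h
  exact mem_edges.2 ⟨_, mem_subdivide.2 ⟨σ, hσ, E, he, hc, rfl⟩, Finset.subset_insert _ _, hc⟩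

/-- An element of the subdivision has at most one edge of the initial triangulation. -/
lemma init_edge_unique {K E E' : Finset Plane} (hK : K ∈ subdivide T)
    (hE : E ∈ edges T.triangles) (hE' : E' ∈ edges T.triangles) (h : E ⊆ K) (h' : E' ⊆ K) :
    E = E' := by
  obtain ⟨σ, hσ, e, he, hc, rfl⟩ := mem_subdivide.1 hK
  have key : ∀ F ∈ edges T.triangles, F ⊆ insert (center σ) e → F = e := by
    intro F hF hFK
    obtain ⟨υ, hυ, hFυ, hFc⟩ := mem_edges.1 hF
    have : center σ ∉ F := fun h => center_notMem hυ hσ (hFυ h)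
    refine Finset.eq_of_subset_of_card_le ?_ (by rw [hc, hFc])
    intro y hy
    rcases Finset.mem_insert.1 (hFK hy) with rfl | h
    · exact absurd hy this
    · exact h
  rw [key E hE h, key E' hE' h']

end Triangulation

namespace StaggeredMesh

/-! ### Incidence relations of the staggered mesh -/

variable {M : StaggeredMesh}

variable (M) in
/-- The coarse mesh as a triangulation. -/
def coarse : Triangulation := M.init.subdivided

lemma Tri.isTri (τ : M.Tri) : IsTri τ.1 := M.fine.isTri τ.2

lemma Elt.isTri (K : M.Elt) : IsTri K.1 := M.coarse.isTri K.2

lemma Edge.card (E : M.Edge) : E.1.card = 2 := by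
  obtain ⟨_, _, _, h⟩ := mem_edges.1 E.2
  exact h

lemma mem_fineEdges {e : Finset Plane} :
    e ∈ M.fineEdges ↔ ∃ τ : M.Tri, e ⊆ τ.1 ∧ e.card = 2 := by
  rw [fineEdges, mem_edges]
  exact ⟨fun ⟨τ, h, h'⟩ => ⟨⟨τ, h⟩, h'⟩, fun ⟨τ, h⟩ => ⟨τ.1, τ.2, h⟩⟩

lemma card_of_mem_fineEdges {e : Finset Plane} (h : e ∈ M.fineEdges) : e.card = 2 := by
  obtain ⟨_, _, h⟩ := mem_fineEdges.1 h
  exact h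

lemma mem_trisIn {K : M.Elt} {τ : M.Tri} : τ ∈ M.trisIn K ↔ hull τ.1 ⊆ hull K.1 := by
  simp [trisIn]

lemma mem_eltsAt {E : M.Edge} {K : M.Elt} : K ∈ M.eltsAt E ↔ E.1 ⊆ K.1 := by
  simp [eltsAt]

lemma mem_trisAt {e : Finset Plane} {τ : M.Tri} : τ ∈ M.trisAt e ↔ e ⊆ τ.1 := by
  simp [trisAt]

lemma mem_edgesIn {E : M.Edge} {e : Finset Plane} :
    e ∈ M.edgesIn E ↔ e ∈ M.fineEdges ∧ hull e ⊆ hull E.1 := by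
  simp [edgesIn]

lemma mem_patch {E : M.Edge} {τ : M.Tri} :
    τ ∈ M.patch E ↔ ∃ K ∈ M.eltsAt E, τ ∈ M.trisIn K := by
  simp [patch]

lemma card_of_mem_edgesIn {E : M.Edge} {e : Finset Plane} (h : e ∈ M.edgesIn E) : e.card = 2 :=
  card_of_mem_fineEdges (mem_edgesIn.1 h).1

lemma exists_elt (τ : M.Tri) : ∃ K : M.Elt, τ ∈ M.trisIn K := by
  obtain ⟨K, hK, h⟩ := M.fine_le τ.1 τ.2
  exact ⟨⟨K, hK⟩, mem_trisIn.2 h⟩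

lemma elt_unique {τ : M.Tri} {K K' : M.Elt} (h : τ ∈ M.trisIn K) (h' : τ ∈ M.trisIn K') :
    K = K' := by
  by_contra hne
  have hne' : K.1 ≠ K'.1 := fun h => hne (Subtype.ext h)
  refine (Tri.isTri τ).not_subset_hull
    (Triangulation.card_inter_le (T := M.coarse) K.2 K'.2 hne') ?_
  rw [← M.coarse.conforming _ K.2 _ K'.2]
  exact subset_inter (mem_trisIn.1 h) (mem_trisIn.1 h')

lemma sum_elts {A : Type*} [AddCommMonoid A] (f : M.Tri → A) :
    ∑ τ, f τ = ∑ K : M.Elt, ∑ τ ∈ M.trisIn K, f τ := by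
  rw [← Finset.sum_biUnion]
  · refine Finset.sum_congr ?_ fun _ _ => rfl
    ext τ
    simpa using exists_elt τ
  · intro K _ K' _ hne
    rw [Function.onFun, Finset.disjoint_left]
    exact fun τ h h' => hne (elt_unique h h')

lemma hull_subset_domain (τ : M.Tri) : hull τ.1 ⊆ M.domain := by
  obtain ⟨K, hK⟩ := exists_elt τ
  obtain ⟨σ, hσ, e, he, hc, hKe⟩ := Triangulation.mem_subdivide.1 K.2
  refine (mem_trisIn.1 hK).trans ?_
  rw [hKe]
  exact (Triangulation.hull_insert_center_subset (M.init.isTri hσ) he).trans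
    (subset_biUnion_of_mem (u := fun τ => hull τ) hσ)

lemma edgeOf_mem {K : M.Elt} {E : Finset Plane} (h : E ⊆ K.1) (hc : E.card = 2) :
    E ∈ edges (subdivide M.init) := mem_edges.2 ⟨K.1, K.2, h, hc⟩

/-- A coarse edge that contains an edge of a fine triangle in `K` is an edge of `K`. -/
lemma edge_subset_elt {K : M.Elt} {E : M.Edge} {e : Finset Plane} {τ : M.Tri}
    (hτ : τ ∈ M.trisIn K) (heτ : e ⊆ τ.1) (he : e ∈ M.edgesIn E) : E.1 ⊆ K.1 := by
  obtain ⟨K₀, hK₀, hE, hEc⟩ := mem_edges.1 E.2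
  -- A segment on the edge of `K₀` that also lies in `K ≠ K₀` lies on the common edge of both
  -- elements, which is then `E`.
  by_cases hne : K.1 = K₀
  · rw [hne]; exact hE
  · have hec := card_of_mem_edgesIn he
    obtain ⟨h1, h2⟩ := Triangulation.card_inter_eq_two (T := M.coarse) K.2 hK₀ hne hec
      ((hull_mono heτ).trans (mem_trisIn.1 hτ))
      ((mem_edgesIn.1 he).2.trans (hull_mono hE))
    have h3 : E.1 = K.1 ∩ K₀ := Triangulation.edge_unique (T := M.coarse) E.2
      (edgeOf_mem Finset.inter_subset_left h1) hec (mem_edgesIn.1 he).2 h2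
    rw [h3]
    exact Finset.inter_subset_left

lemma edgesIn_unique {E E' : M.Edge} {e : Finset Plane} (h : e ∈ M.edgesIn E)
    (h' : e ∈ M.edgesIn E') : E = E' :=
  Subtype.ext (Triangulation.edge_unique (T := M.coarse) E.2 E'.2 (card_of_mem_edgesIn h)
    (mem_edgesIn.1 h).2 (mem_edgesIn.1 h').2)

/-- A fine edge shared by triangles in different coarse elements lies on a common coarse edge. -/
lemma exists_common_edge {K K' : M.Elt} {τ τ' : M.Tri} {e : Finset Plane} (hne : K ≠ K')
    (hτ : τ ∈ M.trisIn K) (hτ' : τ' ∈ M.trisIn K') (h : e ⊆ τ.1) (h' : e ⊆ τ'.1)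
    (he : e.card = 2) : ∃ E : M.Edge, E.1 ⊆ K.1 ∧ E.1 ⊆ K'.1 ∧ e ∈ M.edgesIn E := by
  obtain ⟨h1, h2⟩ := Triangulation.card_inter_eq_two (T := M.coarse) K.2 K'.2
    (fun h => hne (Subtype.ext h)) he
    ((hull_mono h).trans (mem_trisIn.1 hτ)) ((hull_mono h').trans (mem_trisIn.1 hτ'))
  exact ⟨⟨K.1 ∩ K'.1, edgeOf_mem Finset.inter_subset_left h1⟩, Finset.inter_subset_left,
    Finset.inter_subset_right, mem_edgesIn.2 ⟨mem_fineEdges.2 ⟨τ, h, he⟩, h2⟩⟩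

/-- On a coarse edge of `K`, the outward normals of `K` and of the fine triangles in `K` agree. -/
lemma outwardNormal_fine {K : M.Elt} {E : M.Edge} {τ : M.Tri} {e : Finset Plane}
    (hτ : τ ∈ M.trisIn K) (hE : E.1 ⊆ K.1) (he : e ∈ M.edgesIn E) (heτ : e ⊆ τ.1) :
    outwardNormal τ.1 e = outwardNormal K.1 E.1 := by
  obtain ⟨a, b, z, hab, rfl, hτe, _, hD⟩ := (Tri.isTri τ).exists_edge heτ (card_of_mem_edgesIn he)
  obtain ⟨A, B, Z, hAB, hEe, hKe, _, hD'⟩ := (Elt.isTri K).exists_edge hE (Edge.card E)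
  rw [hτe, hKe, hEe]
  have hsub : hull {a, b} ⊆ hull {A, B} := by rw [← hEe]; exact (mem_edgesIn.1 he).2
  obtain ⟨s, t, _, _, hst, ha⟩ := mem_hull_pair.1 (hsub (mem_hull_self (x := a) (by simp)))
  obtain ⟨s', t', _, _, hst', hb⟩ := mem_hull_pair.1 (hsub (mem_hull_self (x := b) (by simp)))
  have hz : z ∈ hull {A, B, Z} := by
    rw [← hKe]
    exact mem_trisIn.1 hτ (mem_hull_self (by rw [hτe]; simp))
  obtain ⟨r, u, v, _, _, hv, hruv, hz'⟩ := mem_hull_triple.1 hz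
  obtain ⟨n1, n2, n3⟩ := outwardNormal_spec hD
  obtain ⟨m1, m2, m3⟩ := outwardNormal_spec hD'
  set n := outwardNormal {a, b, z} {a, b}
  set m := outwardNormal {A, B, Z} {A, B}
  have hba : b - a = (t' - t) • (B - A) := by
    rw [← ha, ← hb]
    have e1 : s = 1 - t := by linarith
    have e2 : s' = 1 - t' := by linarith
    subst e1 e2
    module
  have hm : ⟪m, b - a⟫ = 0 := by rw [hba, inner_smul_right, m2, mul_zero]
  have hu : b - a ≠ 0 := sub_ne_zero.2 hab.symm
  -- Both are unit normals of the same line; the opposite vertex `z` of the fine triangle lies in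
  -- `K`, which excludes opposite signs.
  rcases unit_normal_eq_or hu n1 m1 n2 hm with h | h
  · exact h
  · exfalso
    have hza : z - a = (u - t) • (B - A) + v • (Z - A) := by
      rw [← hz', ← ha]
      have e1 : s = 1 - t := by linarith
      have e2 : r = 1 - u - v := by linarith
      subst e1 e2
      module
    have h1 : ⟪m, z - a⟫ = v * ⟪m, Z - A⟫ := by
      rw [hza, inner_add_right, inner_smul_right, inner_smul_right, m2]
      ring
    have h2 : 0 < |cross (b - a) (z - a)| / ‖b - a‖ :=
      div_pos (abs_pos.2 hD) (norm_pos_iff.2 hu)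
    have h3 : 0 ≤ |cross (B - A) (Z - A)| / ‖B - A‖ := by positivity
    rw [h, inner_neg_left, h1, m3] at n3
    have h4 := mul_nonneg hv h3
    linarith

lemma flux_edge_neg {τ τ' : M.Tri} {e : Finset Plane} (hne : τ ≠ τ') (h : e ⊆ τ.1) (h' : e ⊆ τ'.1)
    (he : e.card = 2) : outwardNormal τ.1 e = -outwardNormal τ'.1 e :=
  Triangulation.outwardNormal_neg (T := M.fine) τ.2 τ'.2 (fun h => hne (Subtype.ext h)) h h' he

lemma fine_not_three {σ τ υ : M.Tri} {e : Finset Plane} (hσ : e ⊆ σ.1) (hτ : e ⊆ τ.1)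
    (hυ : e ⊆ υ.1) (he : e.card = 2) (h1 : σ ≠ τ) (h2 : σ ≠ υ) : τ = υ :=
  Subtype.ext (Triangulation.not_three (T := M.fine) σ.2 τ.2 υ.2 hσ hτ hυ he
    (fun h => h1 (Subtype.ext h)) (fun h => h2 (Subtype.ext h)))

lemma side_unique {K : M.Elt} {E : M.Edge} {τ τ' : M.Tri} {e : Finset Plane}
    (hE : E.1 ⊆ K.1) (he : e ∈ M.edgesIn E) (hτ : τ ∈ M.trisIn K) (hτ' : τ' ∈ M.trisIn K)
    (h : e ⊆ τ.1) (h' : e ⊆ τ'.1) : τ = τ' := by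
  -- The normals of two fine triangles at a common edge are opposite, yet both agree with the normal
  -- of `K`.
  by_contra hne
  have hec := card_of_mem_edgesIn he
  have h1 := flux_edge_neg hne h h' hec
  rw [outwardNormal_fine hτ hE he h, outwardNormal_fine hτ' hE he h'] at h1
  have h2 := Triangulation.norm_outwardNormal (T := M.coarse) K.2 hE (Edge.card E)
  have h3 : outwardNormal K.1 E.1 = 0 := by
    have h4 : (2 : ℝ) • outwardNormal K.1 E.1 = 0 := by
      rw [two_smul]; nth_rewrite 1 [h1]; simp
    simpa using h4
  rw [h3, norm_zero] at h2
  exact zero_ne_one h2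

/-- A fine edge on an edge of `K` belongs to exactly one fine triangle in `K`. -/
lemma exists_side {K : M.Elt} {E : M.Edge} {e : Finset Plane} (hE : E.1 ⊆ K.1)
    (he : e ∈ M.edgesIn E) :
    ∃ τ ∈ M.trisIn K, e ⊆ τ.1 ∧ (M.trisIn K).filter (fun τ => e ⊆ τ.1) = {τ} := by
  obtain ⟨hef, hsub⟩ := mem_edgesIn.1 he
  obtain ⟨τ₀, hτ₀, hc⟩ := mem_fineEdges.1 hef
  have hne := nonempty_of_card_two hc
  have hm : center e ∈ hull K.1 := hull_mono hE (hsub (center_mem_hull hne))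
  obtain ⟨τ, hτ, hτK, hmτ⟩ := M.fine_cover K.1 K.2 _ hm
  have heτ : e ⊆ τ := Triangulation.subset_of_center_mem hτ τ₀.2 hτ₀ hne hmτ
  refine ⟨⟨τ, hτ⟩, mem_trisIn.2 hτK, heτ, ?_⟩
  ext υ
  simp only [Finset.mem_filter, Finset.mem_singleton]
  constructor
  · rintro ⟨h1, h2⟩
    exact side_unique hE he h1 (mem_trisIn.2 hτK) h2 heτ
  · rintro rfl
    exact ⟨mem_trisIn.2 hτK, heτ⟩

/-- An edge of a fine triangle in `K` that does not lie on the boundary of `K` is shared with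
another fine triangle in `K`. -/
lemma exists_neighbour {K : M.Elt} {τ : M.Tri} {e : Finset Plane} (hτ : τ ∈ M.trisIn K)
    (heτ : e ⊆ τ.1) (hc : e.card = 2) (hE : ∀ E : M.Edge, E.1 ⊆ K.1 → e ∉ M.edgesIn E) :
    ∃ τ' ∈ M.trisIn K, τ' ≠ τ ∧ e ⊆ τ'.1 := by
  have hne := nonempty_of_card_two hc
  have hef : e ∈ M.fineEdges := mem_fineEdges.2 ⟨τ, heτ, hc⟩
  have heK : hull e ⊆ hull K.1 := (hull_mono heτ).trans (mem_trisIn.1 hτ)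
  have hmK : center e ∈ hull K.1 := heK (center_mem_hull hne)
  obtain ⟨w, hw0, hw1, hw2⟩ := Finset.mem_convexHull'.1 hmK
  -- The midpoint of `e` is interior to `K`: if one of its barycentric coordinates vanished, then
  -- `e` would lie on an edge of `K`.
  have hwpos : ∀ y ∈ K.1, 0 < w y := by
    intro y hy
    refine lt_of_le_of_ne (hw0 y hy) fun h0 => ?_
    have hcard : (K.1.erase y).card = 2 := by
      rw [Finset.card_erase_of_mem hy, (Elt.isTri K).1]
    have hmem : center e ∈ hull (K.1.erase y) := by
      rw [hull, Finset.mem_convexHull']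
      refine ⟨w, fun x hx => hw0 x (Finset.mem_of_mem_erase hx), ?_, ?_⟩
      · rw [← hw1]
        exact Finset.sum_erase _ h0.symm
      · rw [← hw2]
        exact Finset.sum_erase _ (by rw [← h0, zero_smul])
    have hsub := (Elt.isTri K).hull_subset_of_center_mem (Finset.erase_subset y K.1) heK hne hmem
    exact hE ⟨_, edgeOf_mem (Finset.erase_subset y K.1) hcard⟩ (Finset.erase_subset y K.1)
      (mem_edgesIn.2 ⟨hef, hsub⟩)
  obtain ⟨a, b, z, hab, rfl, hτe, hz, hD⟩ := (Tri.isTri τ).exists_edge heτ hc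
  have hzK : z ∈ hull K.1 := mem_trisIn.1 hτ (mem_hull_self (by rw [hτe]; simp))
  obtain ⟨ζ, hζ0, hζ1, hζ2⟩ := Finset.mem_convexHull'.1 hzK
  set m := center {a, b} with hm
  -- points slightly beyond the edge, seen from the opposite vertex
  set P : ℝ → Plane := fun t => m + t • (m - z) with hP
  have hP0 : P 0 = m := by simp [hP]
  have hPc : Continuous P := by fun_prop
  have hPw : ∀ t, ∑ y ∈ K.1, ((1 + t) * w y - t * ζ y) • y = P t := by
    intro t
    simp only [sub_smul, mul_smul, Finset.sum_sub_distrib, ← Finset.smul_sum]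
    rw [hw2, hζ2, hP]
    module
  have hPw1 : ∀ t, ∑ y ∈ K.1, ((1 + t) * w y - t * ζ y) = 1 := by
    intro t
    rw [Finset.sum_sub_distrib, ← Finset.mul_sum, ← Finset.mul_sum, hw1, hζ1]
    ring
  set Z : Set Plane := ⋃ υ ∈ (M.trisIn K).filter (fun υ => m ∉ hull υ.1), hull υ.1 with hZ
  have hZc : IsClosed Z := by
    refine Set.Finite.isClosed_biUnion (Finset.finite_toSet _) fun υ _ => isClosed_hull _
  have hmZ : m ∉ Z := by
    simp only [hZ, mem_iUnion, Finset.mem_filter, not_exists]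
    rintro υ ⟨_, h⟩ h'
    exact h h'
  -- Close to the midpoint `m`, such points avoid the fine triangles that do not contain `m`,
  have ev1 : ∀ᶠ t in nhdsWithin (0 : ℝ) (Ioi 0), P t ∉ Z := by
    refine (Filter.Tendsto.eventually (f := P) (l₂ := nhds m) ?_
      (hZc.isOpen_compl.mem_nhds hmZ)).filter_mono nhdsWithin_le_nhds
    rw [← hP0]
    exact hPc.tendsto 0
  -- and remain in `K`, since the barycentric coordinates of `m` are positive.
  have ev2 : ∀ᶠ t in nhdsWithin (0 : ℝ) (Ioi 0), ∀ y ∈ K.1, 0 < (1 + t) * w y - t * ζ y := by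
    rw [Filter.eventually_all_finset]
    intro y hy
    have hcont : Continuous fun t : ℝ => (1 + t) * w y - t * ζ y := by fun_prop
    refine (hcont.tendsto 0).eventually (lt_mem_nhds ?_) |>.filter_mono nhdsWithin_le_nhds
    simpa using hwpos y hy
  obtain ⟨t, ⟨h1, h2⟩, ht⟩ := ((ev1.and ev2).and self_mem_nhdsWithin).exists
  have ht0 : 0 < t := ht
  have hPK : P t ∈ hull K.1 :=
    Finset.mem_convexHull'.2 ⟨_, fun y hy => (h2 y hy).le, hPw1 t, hPw t⟩
  obtain ⟨υ, hυ, hυK, hPυ⟩ := M.fine_cover K.1 K.2 _ hPK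
  have hmυ : m ∈ hull υ := by
    by_contra hcon
    refine h1 (mem_biUnion (x := (⟨υ, hυ⟩ : M.Tri)) ?_ hPυ)
    rw [Finset.mem_coe, Finset.mem_filter]
    exact ⟨mem_trisIn.2 hυK, hcon⟩
  -- The covering triangle contains `m`, hence the edge; it is not `τ`, as `P t` lies on the other
  -- side of the edge.
  refine ⟨⟨υ, hυ⟩, mem_trisIn.2 hυK, ?_,
    Triangulation.subset_of_center_mem hυ τ.2 heτ hne hmυ⟩
  intro heq
  have hυτ : υ = {a, b, z} := by rw [← hτe, ← heq]
  rw [hυτ] at hPυ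
  obtain ⟨r, s, u, _, _, hu, hrsu, hx⟩ := mem_hull_triple.1 hPυ
  have e1 : cross (b - a) (P t - a) = u * cross (b - a) (z - a) := by
    rw [← hx]
    have : r = 1 - s - u := by linarith
    subst this
    simp only [cross, PiLp.add_apply, PiLp.smul_apply, PiLp.sub_apply, smul_eq_mul]
    ring
  have e2 : cross (b - a) (P t - a) = -t * cross (b - a) (z - a) := by
    simp only [hP, hm, center_pair hab]
    simp only [cross, PiLp.add_apply, PiLp.smul_apply, PiLp.sub_apply, smul_eq_mul]
    ring
  have := mul_right_cancel₀ hD (e1.symm.trans e2)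
  linarith

lemma eltsAt_nonempty (E : M.Edge) : (M.eltsAt E).Nonempty := by
  obtain ⟨K, hK, hE, _⟩ := mem_edges.1 E.2
  exact ⟨⟨K, hK⟩, mem_eltsAt.2 hE⟩

lemma normal_elt_neg {E : M.Edge} {K K' : M.Elt} (hne : K ≠ K') (h : E.1 ⊆ K.1) (h' : E.1 ⊆ K'.1) :
    outwardNormal K.1 E.1 = -outwardNormal K'.1 E.1 :=
  Triangulation.outwardNormal_neg (T := M.coarse) K.2 K'.2 (fun h => hne (Subtype.ext h)) h h'
    (Edge.card E)

lemma eltsAt_card_le (E : M.Edge) : (M.eltsAt E).card ≤ 2 := by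
  by_contra h
  obtain ⟨K, K', K'', hK, hK', hK'', h1, h2, h3⟩ := Finset.two_lt_card_iff.1 (not_le.1 h)
  rw [mem_eltsAt] at hK hK' hK''
  exact h3 (Subtype.ext (Triangulation.not_three (T := M.coarse) K.2 K'.2 K''.2 hK hK' hK''
    (Edge.card E) (fun h => h1 (Subtype.ext h)) (fun h => h2 (Subtype.ext h))))

variable (M) in
/-- The edges of a coarse element. -/
def edgesOf (K : M.Elt) : Finset M.Edge := Finset.univ.filter fun E => E.1 ⊆ K.1

lemma mem_edgesOf {K : M.Elt} {E : M.Edge} : E ∈ M.edgesOf K ↔ E.1 ⊆ K.1 := by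
  simp [edgesOf]

lemma edgesOf_card_le (K : M.Elt) : (M.edgesOf K).card ≤ 3 := by
  have h : ((M.edgesOf K).image Subtype.val).card = (M.edgesOf K).card :=
    Finset.card_image_of_injective _ Subtype.val_injective
  rw [← h]
  refine (Finset.card_le_card (t := K.1.powersetCard 2) ?_).trans ?_
  · intro e he
    obtain ⟨E, hE, rfl⟩ := Finset.mem_image.1 he
    exact Finset.mem_powersetCard.2 ⟨mem_edgesOf.1 hE, Edge.card E⟩
  · rw [Finset.card_powersetCard, (Elt.isTri K).1]
    decide

lemma onInit_iff {e : Finset Plane} (he : e ∈ M.fineEdges) :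
    M.OnInit e ↔ ∃ E : M.Edge, E.1 ∈ edges M.init.triangles ∧ e ∈ M.edgesIn E := by
  constructor
  · rintro ⟨E, hE, h⟩
    exact ⟨⟨E, Triangulation.edges_subset_edges_subdivide hE⟩, hE, mem_edgesIn.2 ⟨he, h⟩⟩
  · rintro ⟨E, hE, h⟩
    exact ⟨E.1, hE, (mem_edgesIn.1 h).2⟩

lemma IsDecoupled.mem {E : M.Edge} (h : M.IsDecoupled E) : E.1 ∈ edges M.init.triangles :=
  (Finset.mem_filter.1 h).1

lemma onInitInterior_iff {e : Finset Plane} (he : e ∈ M.fineEdges) :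
    M.OnInitInterior e ↔ ∃ E : M.Edge, M.IsDecoupled E ∧ e ∈ M.edgesIn E := by
  constructor
  · rintro ⟨E, hE, h⟩
    exact ⟨⟨E, Triangulation.edges_subset_edges_subdivide (Finset.mem_filter.1 hE).1⟩, hE,
      mem_edgesIn.2 ⟨he, h⟩⟩
  · rintro ⟨E, hE, h⟩
    exact ⟨E.1, hE, (mem_edgesIn.1 h).2⟩

lemma not_onInitInterior {E : M.Edge} {e : Finset Plane} (hE : ¬ M.IsDecoupled E)
    (he : e ∈ M.edgesIn E) : ¬ M.OnInitInterior e := by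
  rw [onInitInterior_iff (mem_edgesIn.1 he).1]
  rintro ⟨E', hE', h⟩
  exact hE (edgesIn_unique h he ▸ hE')

/-- Two edges of a fine triangle do not lie on the same coarse edge. -/
lemma edgesIn_tri_unique {E : M.Edge} {τ : M.Tri} {e e' : Finset Plane} (he : e ∈ M.edgesIn E)
    (he' : e' ∈ M.edgesIn E) (h : e ⊆ τ.1) (h' : e' ⊆ τ.1) : e = e' := by
  by_contra hne
  have hc := card_of_mem_edgesIn he
  have hc' := card_of_mem_edgesIn he'
  have hu : e ∪ e' = τ.1 := by
    refine Finset.eq_of_subset_of_card_le (Finset.union_subset h h') ?_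
    rw [(Tri.isTri τ).1]
    by_contra hlt
    have h1 : e = e ∪ e' :=
      Finset.eq_of_subset_of_card_le Finset.subset_union_left (by omega)
    have h2 : e' = e ∪ e' :=
      Finset.eq_of_subset_of_card_le Finset.subset_union_right (by omega)
    exact hne (h1.trans h2.symm)
  refine (Tri.isTri τ).not_subset_hull (Edge.card E).le ?_
  rw [← hu]
  refine hull_subset_hull fun x hx => ?_
  rcases Finset.mem_union.1 hx with hx | hx
  · exact (mem_edgesIn.1 he).2 (mem_hull_self hx)
  · exact (mem_edgesIn.1 he').2 (mem_hull_self hx)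

/-- A fine triangle has at most one edge on the initial triangulation. -/
lemma onInit_tri_unique {τ : M.Tri} {E E' : M.Edge} {e e' : Finset Plane}
    (hE : E.1 ∈ edges M.init.triangles) (hE' : E'.1 ∈ edges M.init.triangles)
    (he : e ∈ M.edgesIn E) (he' : e' ∈ M.edgesIn E') (h : e ⊆ τ.1) (h' : e' ⊆ τ.1) :
    E = E' ∧ e = e' := by
  obtain ⟨K, hK⟩ := exists_elt τ
  have h1 : E = E' := Subtype.ext (Triangulation.init_edge_unique K.2 hE hE'
    (edge_subset_elt hK h he) (edge_subset_elt hK h' he'))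
  subst h1
  exact ⟨rfl, edgesIn_tri_unique he he' h h'⟩

/-- The fine triangles in a coarse element are connected through common edges: a segment that
joins two of them and avoids the vertices of the mesh crosses from triangle to triangle only
through the interiors of edges. -/
lemma eq_of_adjacent_eq {K : M.Elt} {α : Type*} (p : M.Tri → α)
    (h : ∀ τ ∈ M.trisIn K, ∀ τ' ∈ M.trisIn K, τ ≠ τ' → ∀ e : Finset Plane, e.card = 2 →
      e ⊆ τ.1 → e ⊆ τ'.1 → p τ = p τ') :
    ∀ τ ∈ M.trisIn K, ∀ τ' ∈ M.trisIn K, p τ = p τ' := by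
  intro τ hτ τ' hτ'
  by_contra hne
  set V : Finset Plane := M.fine.triangles.biUnion id with hV
  have hxV : center τ.1 ∉ V := by
    simp only [hV, Finset.mem_biUnion, id, not_exists, not_and]
    exact fun σ hσ => Triangulation.center_notMem hσ τ.2
  -- The segments from the centroid of `τ` that meet a vertex have their endpoints on finitely many
  -- lines, which cannot cover the triangle `τ'`.
  obtain ⟨y, hy, hyV⟩ : ∃ y ∈ hull τ'.1, ∀ v ∈ V, v ∉ segment ℝ (center τ.1) y := by
    by_contra! hcon
    have hsub : hull τ'.1 ⊆ ⋃ v ∈ V, (affineSpan ℝ {center τ.1, v} : Set Plane) := by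
      intro y hy
      obtain ⟨v, hv, s, t, hs, ht, hst, hvy⟩ := hcon y hy
      refine mem_biUnion (x := v) hv ?_
      have ht0 : t ≠ 0 := by
        rintro rfl
        have : s = 1 := by linarith
        rw [this, one_smul, zero_smul, add_zero] at hvy
        exact hxV (hvy ▸ hv)
      have hline : y = AffineMap.lineMap (center τ.1) v (t⁻¹) := by
        rw [AffineMap.lineMap_apply_module, ← hvy, smul_add, smul_smul, smul_smul,
          inv_mul_cancel₀ ht0, one_smul, ← add_assoc, ← add_smul]
        have : 1 - t⁻¹ + t⁻¹ * s = 0 := by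
          have : s = 1 - t := by linarith
          rw [this]; field_simp; ring
        rw [this, zero_smul, zero_add]
      rw [hline]
      exact AffineMap.lineMap_mem_affineSpan_pair _ _ _
    have hnull : volume (⋃ v ∈ V, (affineSpan ℝ {center τ.1, v} : Set Plane)) = 0 := by
      refine (measure_biUnion_null_iff V.countable_toSet).2 fun v _ =>
        Measure.addHaar_affineSubspace _ _ ?_
      intro htop
      have h1 : Module.finrank ℝ (affineSpan ℝ ({center τ.1, v} : Set Plane)).direction ≤ 1 := by
        rw [direction_affineSpan, vectorSpan_pair]
        exact (finrank_span_le_card _).trans (by simp)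
      rw [htop, AffineSubspace.direction_top, finrank_top, finrank_euclideanSpace_fin] at h1
      omega
    have := (Tri.isTri τ').area_pos
    rw [area, measure_mono_null hsub hnull] at this
    simp at this
  have hx : center τ.1 ∈ hull τ.1 := center_mem_hull (Tri.isTri τ).nonempty
  set A : Set Plane := ⋃ υ ∈ (M.trisIn K).filter (fun υ => p υ = p τ), hull υ.1 with hA
  set B : Set Plane := ⋃ υ ∈ (M.trisIn K).filter (fun υ => p υ ≠ p τ), hull υ.1 with hB
  have hAc : IsClosed A :=
    Set.Finite.isClosed_biUnion (Finset.finite_toSet _) fun υ _ => isClosed_hull _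
  have hBc : IsClosed B :=
    Set.Finite.isClosed_biUnion (Finset.finite_toSet _) fun υ _ => isClosed_hull _
  have hsegK : segment ℝ (center τ.1) y ⊆ hull K.1 :=
    (convex_convexHull ℝ _).segment_subset (mem_trisIn.1 hτ hx) (mem_trisIn.1 hτ' hy)
  -- The triangles on which `p` takes the value `p τ`, and the others, form two closed sets that
  -- cover the connected segment, so they have a common point on it.
  have hcov : segment ℝ (center τ.1) y ⊆ A ∪ B := by
    intro z hz
    obtain ⟨υ, hυ, hυK, hzυ⟩ := M.fine_cover K.1 K.2 z (hsegK hz)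
    by_cases hp : p ⟨υ, hυ⟩ = p τ
    · left
      refine mem_biUnion (x := (⟨υ, hυ⟩ : M.Tri)) ?_ hzυ
      rw [Finset.mem_coe, Finset.mem_filter]
      exact ⟨mem_trisIn.2 hυK, hp⟩
    · right
      refine mem_biUnion (x := (⟨υ, hυ⟩ : M.Tri)) ?_ hzυ
      rw [Finset.mem_coe, Finset.mem_filter]
      exact ⟨mem_trisIn.2 hυK, hp⟩
  have hpre : IsPreconnected (segment ℝ (center τ.1) y) := (convex_segment _ _).isPreconnected
  obtain ⟨z, hz, hzA, hzB⟩ := isPreconnected_closed_iff.1 hpre A B hAc hBc hcov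
    ⟨_, left_mem_segment _ _ _, mem_biUnion (x := τ)
      (by rw [Finset.mem_coe, Finset.mem_filter]; exact ⟨hτ, rfl⟩) hx⟩
    ⟨_, right_mem_segment _ _ _, mem_biUnion (x := τ')
      (by rw [Finset.mem_coe, Finset.mem_filter]; exact ⟨hτ', fun h => hne h.symm⟩) hy⟩
  simp only [hA, hB, mem_iUnion, Finset.mem_filter] at hzA hzB
  obtain ⟨υ, ⟨hυ, hpυ⟩, hzυ⟩ := hzA
  obtain ⟨υ', ⟨hυ', hpυ'⟩, hzυ'⟩ := hzB
  have hυne : υ ≠ υ' := fun h => hpυ' (h ▸ hpυ)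
  have hzi : z ∈ hull (υ.1 ∩ υ'.1) := by
    rw [← M.fine.conforming _ υ.2 _ υ'.2]
    exact ⟨hzυ, hzυ'⟩
  have hle := Triangulation.card_inter_le (T := M.fine) υ.2 υ'.2 (fun h => hυne (Subtype.ext h))
  -- The common face of the two triangles at that point is not a vertex, hence an edge.
  have hcard : (υ.1 ∩ υ'.1).card = 2 := by
    refine le_antisymm hle ?_
    by_contra hlt
    obtain ⟨c, hc⟩ := Finset.card_le_one_iff_subset_singleton.1 (by omega : (υ.1 ∩ υ'.1).card ≤ 1)
    have hzc := hull_mono hc hzi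
    simp only [hull, Finset.coe_singleton, convexHull_singleton, mem_singleton_iff] at hzc
    have hne' : (υ.1 ∩ υ'.1).Nonempty := by
      by_contra h0
      rw [Finset.not_nonempty_iff_eq_empty] at h0
      rw [h0] at hzi
      simp [hull] at hzi
    obtain ⟨d, hd⟩ := hne'
    have hdc := Finset.mem_singleton.1 (hc hd)
    refine hyV z ?_ hz
    rw [hzc, ← hdc, hV]
    exact Finset.mem_biUnion.2 ⟨υ.1, υ.2, (Finset.mem_inter.1 hd).1⟩
  exact hpυ' ((h υ hυ υ' hυ' hυne _ hcard Finset.inter_subset_left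
    Finset.inter_subset_right).symm.trans hpυ)

/-- The area of a coarse element is the sum of the areas of the fine triangles in it. -/
lemma sum_area (K : M.Elt) : ∑ τ ∈ M.trisIn K, area τ.1 = area K.1 := by
  have hU : hull K.1 = ⋃ τ ∈ M.trisIn K, hull τ.1 := by
    refine Subset.antisymm (fun x hx => ?_) (iUnion₂_subset fun τ hτ => mem_trisIn.1 hτ)
    obtain ⟨τ, hτ, hτK, hxτ⟩ := M.fine_cover K.1 K.2 x hx
    exact mem_biUnion (x := (⟨τ, hτ⟩ : M.Tri)) (mem_trisIn.2 hτK) hxτ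
  have hfin : ∀ s : Finset Plane, volume (hull s) ≠ ⊤ := fun s => (isCompact_hull s).measure_ne_top
  unfold area
  rw [hU, measure_biUnion_finset₀, ENNReal.toReal_sum fun τ _ => hfin _]
  · intro τ _ τ' _ hne
    have hne' : τ.1 ≠ τ'.1 := fun h => hne (Subtype.ext h)
    rw [Function.onFun, AEDisjoint, M.fine.conforming _ τ.2 _ τ'.2]
    obtain ⟨a, b, hab⟩ :=
      exists_subset_pair (Triangulation.card_inter_le (T := M.fine) τ.2 τ'.2 hne')
    exact measure_mono_null (hull_mono hab) (volume_hull_pair a b)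
  · exact fun τ _ => (measurableSet_hull _).nullMeasurableSet

lemma area_pos (τ : M.Tri) : 0 < area τ.1 := (Tri.isTri τ).area_pos

lemma len_pos {e : Finset Plane} (h : e.card = 2) : 0 < len e := by
  obtain ⟨a, b, hab, rfl⟩ := Finset.card_eq_two.1 h
  rw [len_pair]
  exact norm_pos_iff.2 (sub_ne_zero.2 hab.symm)

lemma trisIn_nonempty (K : M.Elt) : (M.trisIn K).Nonempty := by
  obtain ⟨τ, hτ, hτK, _⟩ := M.fine_cover K.1 K.2 _ (center_mem_hull (Elt.isTri K).nonempty)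
  exact ⟨⟨τ, hτ⟩, mem_trisIn.2 hτK⟩

/-! ### Bilinear forms -/

variable (M) in
/-- A measurable coefficient that is bounded and bounded away from zero on the domain. -/
def Coeff (g : Plane → ℝ) : Prop :=
  Measurable g ∧ ∃ a b : ℝ, 0 < a ∧ ∀ x ∈ M.domain, a ≤ g x ∧ g x ≤ b

lemma Coeff.pos {g : Plane → ℝ} (hg : Coeff M g) {τ : M.Tri} {x : Plane} (hx : x ∈ hull τ.1) :
    0 < g x := by
  obtain ⟨_, a, b, ha, h⟩ := hg
  exact ha.trans_le (h x (hull_subset_domain τ hx)).1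

lemma Coeff.inv {g : Plane → ℝ} (hg : Coeff M g) : Coeff M (fun x => (g x)⁻¹) := by
  obtain ⟨hm, a, b, ha, h⟩ := hg
  by_cases hne : M.domain.Nonempty
  · obtain ⟨x₀, hx₀⟩ := hne
    have hb : 0 < b := ha.trans_le ((h x₀ hx₀).1.trans (h x₀ hx₀).2)
    refine ⟨hm.inv, b⁻¹, a⁻¹, inv_pos.2 hb, fun x hx => ⟨?_, ?_⟩⟩
    · exact inv_anti₀ (ha.trans_le (h x hx).1) (h x hx).2
    · exact inv_anti₀ ha (h x hx).1
  · exact ⟨hm.inv, 1, 1, one_pos, fun x hx => absurd ⟨x, hx⟩ hne⟩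

lemma Coeff.bound {g : Plane → ℝ} (hg : Coeff M g) (τ : M.Tri) :
    ∃ C, ∀ᵐ x ∂(volume.restrict (hull τ.1)), ‖g x‖ ≤ C := by
  obtain ⟨hm, a, b, ha, h⟩ := hg
  refine ⟨b, (ae_restrict_iff' (measurableSet_hull _)).2 (Filter.Eventually.of_forall ?_)⟩
  intro x hx
  have := h x (hull_subset_domain τ hx)
  rw [Real.norm_eq_abs, abs_of_pos (ha.trans_le this.1)]
  exact this.2

lemma Coeff.integrableOn_mul {g : Plane → ℝ} (hg : Coeff M g) (τ : M.Tri) {f : Plane → ℝ}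
    (hf : IntegrableOn f (hull τ.1)) : IntegrableOn (fun x => g x * f x) (hull τ.1) := by
  obtain ⟨C, hC⟩ := hg.bound τ
  exact hf.bdd_mul hg.1.aestronglyMeasurable hC

lemma integrableOn_hull {f : Plane → ℝ} (hf : Continuous f) (τ : Finset Plane) :
    IntegrableOn f (hull τ) :=
  hf.continuousOn.integrableOn_compact (isCompact_hull τ)

lemma continuous_velAt (v : M.Vel) (τ : M.Tri) : Continuous (velAt v τ) := by
  unfold velAt; fun_prop

lemma continuous_presAt (q : M.Pres) (τ : M.Tri) : Continuous (presAt q τ) := by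
  unfold presAt; fun_prop

lemma velAt_add (v w : M.Vel) (τ : M.Tri) (x : Plane) :
    velAt (v + w) τ x = velAt v τ x + velAt w τ x := by
  simp only [velAt, Pi.add_apply, Prod.fst_add, Prod.snd_add]
  module

lemma velAt_smul (c : ℝ) (v : M.Vel) (τ : M.Tri) (x : Plane) :
    velAt (c • v) τ x = c • velAt v τ x := by
  simp only [velAt, Pi.smul_apply, Prod.smul_fst, Prod.smul_snd, smul_eq_mul]
  module

variable {κ ρ : Plane → ℝ}

lemma integrableOn_massV (hκ : Coeff M κ) (τ : M.Tri) (v w : M.Vel) :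
    IntegrableOn (fun x => κ x * ⟪velAt v τ x, velAt w τ x⟫) (hull τ.1) :=
  hκ.integrableOn_mul τ (integrableOn_hull
    ((continuous_velAt v τ).inner (continuous_velAt w τ)) _)

lemma integrableOn_massQ (hρ : Coeff M ρ) (τ : M.Tri) (p q : M.Pres) :
    IntegrableOn (fun x => ρ x * (presAt p τ x * presAt q τ x)) (hull τ.1) :=
  hρ.integrableOn_mul τ (integrableOn_hull
    ((continuous_presAt p τ).mul (continuous_presAt q τ)) _)

lemma massV_comm (κ : Plane → ℝ) (S : Finset M.Tri) (v w : M.Vel) :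
    massV κ S v w = massV κ S w v := by
  unfold massV
  simp only [real_inner_comm]

lemma massQ_comm (ρ : Plane → ℝ) (p q : M.Pres) : massQ ρ p q = massQ ρ q p := by
  unfold massQ
  simp only [mul_comm (presAt p _ _)]

/-- `massV` as a bilinear form. -/
def massVB (hκ : Coeff M κ) (S : Finset M.Tri) : LinearMap.BilinForm ℝ M.Vel :=
  LinearMap.mk₂ ℝ (massV κ S)
    (by
      intro v v' w
      unfold massV
      rw [← Finset.sum_add_distrib]
      refine Finset.sum_congr rfl fun τ _ => ?_
      rw [← integral_add (integrableOn_massV hκ τ v w) (integrableOn_massV hκ τ v' w)]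
      simp only [velAt_add, inner_add_left, mul_add])
    (by
      intro c v w
      unfold massV
      rw [smul_eq_mul, Finset.mul_sum]
      refine Finset.sum_congr rfl fun τ _ => ?_
      rw [← integral_const_mul]
      simp only [velAt_smul, real_inner_smul_left, mul_left_comm])
    (by
      intro v w w'
      unfold massV
      rw [← Finset.sum_add_distrib]
      refine Finset.sum_congr rfl fun τ _ => ?_
      rw [← integral_add (integrableOn_massV hκ τ v w) (integrableOn_massV hκ τ v w')]
      simp only [velAt_add, inner_add_right, mul_add])
    (by
      intro c v w
      unfold massV
      rw [smul_eq_mul, Finset.mul_sum]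
      refine Finset.sum_congr rfl fun τ _ => ?_
      rw [← integral_const_mul]
      simp only [velAt_smul, real_inner_smul_right, mul_left_comm])

lemma massVB_apply (hκ : Coeff M κ) (S : Finset M.Tri) (v w : M.Vel) :
    massVB hκ S v w = massV κ S v w := rfl

/-- `massQ` as a bilinear form. -/
def massQB (hρ : Coeff M ρ) : LinearMap.BilinForm ℝ M.Pres :=
  LinearMap.mk₂ ℝ (massQ ρ)
    (by
      intro v v' w
      unfold massQ
      rw [← Finset.sum_add_distrib]
      refine Finset.sum_congr rfl fun τ _ => ?_
      rw [← integral_add (integrableOn_massQ hρ τ v w) (integrableOn_massQ hρ τ v' w)]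
      simp only [presAt_add, add_mul, mul_add])
    (by
      intro c v w
      unfold massQ
      rw [smul_eq_mul, Finset.mul_sum]
      refine Finset.sum_congr rfl fun τ _ => ?_
      rw [← integral_const_mul]
      simp only [presAt_smul, mul_assoc, mul_left_comm])
    (by
      intro v w w'
      unfold massQ
      rw [← Finset.sum_add_distrib]
      refine Finset.sum_congr rfl fun τ _ => ?_
      rw [← integral_add (integrableOn_massQ hρ τ v w) (integrableOn_massQ hρ τ v w')]
      simp only [presAt_add, mul_add])
    (by
      intro c v w
      unfold massQ
      rw [smul_eq_mul, Finset.mul_sum]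
      refine Finset.sum_congr rfl fun τ _ => ?_
      rw [← integral_const_mul]
      simp only [presAt_smul, mul_left_comm])

lemma massQB_apply (hρ : Coeff M ρ) (p q : M.Pres) : massQB hρ p q = massQ ρ p q := rfl

lemma massV_nonneg (hκ : Coeff M κ) (S : Finset M.Tri) (v : M.Vel) : 0 ≤ massV κ S v v := by
  refine Finset.sum_nonneg fun τ _ => setIntegral_nonneg (measurableSet_hull _) fun x hx => ?_
  exact mul_nonneg (hκ.pos hx).le real_inner_self_nonneg

lemma massV_mono (hκ : Coeff M κ) {S S' : Finset M.Tri} (h : S ⊆ S') (v : M.Vel) :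
    massV κ S v v ≤ massV κ S' v v := by
  refine Finset.sum_le_sum_of_subset_of_nonneg h fun τ _ _ =>
    setIntegral_nonneg (measurableSet_hull _) fun x hx => ?_
  exact mul_nonneg (hκ.pos hx).le real_inner_self_nonneg

lemma massQ_nonneg (hρ : Coeff M ρ) (q : M.Pres) : 0 ≤ massQ ρ q q := by
  refine Finset.sum_nonneg fun τ _ => setIntegral_nonneg (measurableSet_hull _) fun x hx => ?_
  exact mul_nonneg (hρ.pos hx).le (mul_self_nonneg _)

lemma massV_congr {S : Finset M.Tri} {v v' w w' : M.Vel} (h : ∀ τ ∈ S, v τ = v' τ)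
    (h' : ∀ τ ∈ S, w τ = w' τ) : massV κ S v w = massV κ S v' w' := by
  refine Finset.sum_congr rfl fun τ hτ => ?_
  simp only [velAt, h τ hτ, h' τ hτ]

lemma divForm_congr {S : Finset M.Tri} {q q' : M.Tri → ℝ} {w w' : M.Vel}
    (h : ∀ τ ∈ S, q τ = q' τ) (h' : ∀ τ ∈ S, w τ = w' τ) :
    divForm S q w = divForm S q' w' := by
  refine Finset.sum_congr rfl fun τ hτ => ?_
  simp only [dvg, h τ hτ, h' τ hτ]

lemma massV_univ (v w : M.Vel) :
    massV κ Finset.univ v w = ∑ K : M.Elt, massV κ (M.trisIn K) v w := sum_elts _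

lemma divForm_univ (q : M.Tri → ℝ) (w : M.Vel) :
    divForm Finset.univ q w = ∑ K : M.Elt, divForm (M.trisIn K) q w := sum_elts _

/-- `massV` over all triangles, when one field is supported in `S`. -/
lemma massV_univ_of_supp {S : Finset M.Tri} (v w : M.Vel) (h : ∀ τ, τ ∉ S → w τ = 0) :
    massV κ Finset.univ v w = massV κ S v w := by
  symm
  refine Finset.sum_subset (Finset.subset_univ _) fun τ _ hτ => ?_
  simp [velAt, h τ hτ]

lemma divForm_univ_of_supp {S : Finset M.Tri} (q : M.Tri → ℝ) (w : M.Vel)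
    (h : ∀ τ, τ ∉ S → w τ = 0) : divForm Finset.univ q w = divForm S q w := by
  symm
  refine Finset.sum_subset (Finset.subset_univ _) fun τ _ hτ => ?_
  simp [dvg, h τ hτ]

lemma divForm_univ_of_supp' {S : Finset M.Tri} (q : M.Tri → ℝ) (w : M.Vel)
    (h : ∀ τ, τ ∉ S → q τ = 0) : divForm Finset.univ q w = divForm S q w := by
  symm
  refine Finset.sum_subset (Finset.subset_univ _) fun τ _ hτ => ?_
  simp [h τ hτ]

lemma dvg_add (v w : M.Vel) (τ : M.Tri) : dvg (v + w) τ = dvg v τ + dvg w τ := by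
  simp only [dvg, Pi.add_apply, Prod.snd_add]; ring

lemma dvg_smul (c : ℝ) (v : M.Vel) (τ : M.Tri) : dvg (c • v) τ = c * dvg v τ := by
  simp only [dvg, Pi.smul_apply, Prod.smul_snd, smul_eq_mul]; ring

/-- `divForm` as a bilinear map. -/
def divB (S : Finset M.Tri) : (M.Tri → ℝ) →ₗ[ℝ] M.Vel →ₗ[ℝ] ℝ :=
  LinearMap.mk₂ ℝ (divForm S)
    (by
      intro p q w
      unfold divForm
      rw [← Finset.sum_add_distrib]
      exact Finset.sum_congr rfl fun τ _ => by simp only [Pi.add_apply]; ring)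
    (by
      intro c q w
      unfold divForm
      rw [smul_eq_mul, Finset.mul_sum]
      exact Finset.sum_congr rfl fun τ _ => by simp only [Pi.smul_apply, smul_eq_mul]; ring)
    (by
      intro q v w
      unfold divForm
      rw [← Finset.sum_add_distrib]
      exact Finset.sum_congr rfl fun τ _ => by rw [dvg_add]; ring)
    (by
      intro c q w
      unfold divForm
      rw [smul_eq_mul, Finset.mul_sum]
      exact Finset.sum_congr rfl fun τ _ => by rw [dvg_smul]; ring)

lemma divB_apply (S : Finset M.Tri) (q : M.Tri → ℝ) (w : M.Vel) : divB S q w = divForm S q w := rfl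

/-- The outward normal component on an edge of a triangle, as a linear functional. -/
def fluxL (τ : M.Tri) (e : Finset Plane) : M.Vel →ₗ[ℝ] ℝ where
  toFun v := flux v τ e
  map_add' v w := flux_add v w τ e
  map_smul' c v := flux_smul c v τ e

/-- The outward normal component on `e` from the side of the coarse element `K`. -/
def sideFlux (K : M.Elt) (e : Finset Plane) : M.Vel →ₗ[ℝ] ℝ :=
  ∑ τ ∈ (M.trisIn K).filter (fun τ => e ⊆ τ.1), fluxL τ e

lemma sideFlux_apply (K : M.Elt) (e : Finset Plane) (v : M.Vel) :
    sideFlux K e v = ∑ τ ∈ (M.trisIn K).filter (fun τ => e ⊆ τ.1), flux v τ e := by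
  simp [sideFlux, fluxL]

lemma sideFlux_eq_flux {K : M.Elt} {E : M.Edge} {e : Finset Plane} {τ : M.Tri} (hE : E.1 ⊆ K.1)
    (he : e ∈ M.edgesIn E) (hτ : τ ∈ M.trisIn K) (heτ : e ⊆ τ.1) (v : M.Vel) :
    sideFlux K e v = flux v τ e := by
  obtain ⟨υ, hυ, heυ, hf⟩ := exists_side hE he
  rw [sideFlux_apply, hf, Finset.sum_singleton, side_unique hE he hτ hυ heτ heυ]

lemma sideInner_eq {K : M.Elt} {E : M.Edge} (hE : E.1 ⊆ K.1) (v w : M.Vel) :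
    sideInner K E v w = ∑ e ∈ M.edgesIn E, len e * (sideFlux K e v * sideFlux K e w) := by
  unfold sideInner
  refine Finset.sum_congr rfl fun e he => ?_
  obtain ⟨υ, hυ, heυ, hf⟩ := exists_side hE he
  rw [sideFlux_apply, sideFlux_apply, hf, Finset.sum_singleton, Finset.sum_singleton,
    Finset.sum_singleton]

lemma flux_congr {v w : M.Vel} {τ : M.Tri} (h : v τ = w τ) (e : Finset Plane) :
    flux v τ e = flux w τ e := by
  simp only [flux, comp, velAt, h]

lemma sideFlux_congr {K : M.Elt} {v w : M.Vel} (h : ∀ τ ∈ M.trisIn K, v τ = w τ)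
    (e : Finset Plane) : sideFlux K e v = sideFlux K e w := by
  rw [sideFlux_apply, sideFlux_apply]
  exact Finset.sum_congr rfl fun τ hτ => flux_congr (h τ (Finset.mem_filter.1 hτ).1) e

/-- The jump on a fine edge of a coarse edge is the sum of the contributions of the two sides. -/
lemma jump_eq {E : M.Edge} {e : Finset Plane} (he : e ∈ M.edgesIn E) (w : M.Vel) :
    jump w e = ∑ K ∈ M.eltsAt E, sideFlux K e w := by
  simp only [sideFlux_apply]
  rw [← Finset.sum_biUnion]
  · refine Finset.sum_congr ?_ fun _ _ => rfl
    ext τ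
    simp only [mem_trisAt, Finset.mem_biUnion, Finset.mem_filter]
    constructor
    · intro h
      obtain ⟨K, hK⟩ := exists_elt τ
      exact ⟨K, mem_eltsAt.2 (edge_subset_elt hK h he), hK, h⟩
    · rintro ⟨K, _, _, h⟩
      exact h
  · intro K _ K' _ hne
    rw [Function.onFun, Finset.disjoint_left]
    intro τ h h'
    exact hne (elt_unique (Finset.mem_filter.1 h).1 (Finset.mem_filter.1 h').1)

/-- The divergence theorem on a coarse element for fields with continuous normal components inside
the element: the contributions of the interior fine edges cancel. -/
lemma gauss_elt {K : M.Elt} {w : M.Vel} (hw : ConformingIn K w) :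
    ∑ τ ∈ M.trisIn K, area τ.1 * dvg w τ =
      ∑ E ∈ M.edgesOf K, ∑ e ∈ M.edgesIn E, len e * sideFlux K e w := by
  -- On a single triangle this is the divergence theorem for an affine field.
  have h1 : ∀ τ : M.Tri, area τ.1 * dvg w τ =
      ∑ e ∈ M.fineEdges.filter (fun e => e ⊆ τ.1), len e * flux w τ e := by
    intro τ
    rw [dvg, ← (Tri.isTri τ).gauss (w τ).1 (w τ).2]
    refine Finset.sum_congr ?_ fun e _ => rfl
    ext e
    simp only [Finset.mem_powersetCard, Finset.mem_filter]
    exact ⟨fun ⟨h, h'⟩ => ⟨mem_fineEdges.2 ⟨τ, h, h'⟩, h⟩,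
      fun ⟨h, h'⟩ => ⟨h', card_of_mem_fineEdges h⟩⟩
  have h2 : ∑ τ ∈ M.trisIn K, area τ.1 * dvg w τ =
      ∑ e ∈ M.fineEdges, len e * sideFlux K e w := by
    simp only [h1, sideFlux_apply, Finset.mul_sum]
    refine Finset.sum_comm' ?_
    intro τ e
    simp only [Finset.mem_filter]
    tauto
  rw [h2, ← Finset.sum_biUnion]
  · symm
    refine Finset.sum_subset ?_ ?_
    · intro e he
      obtain ⟨E, _, h⟩ := Finset.mem_biUnion.1 he
      exact (mem_edgesIn.1 h).1
    -- A fine edge off the edges of `K` lies between exactly two triangles of `K`, whose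
    -- contributions cancel.
    · intro e hef hen
      have hc := card_of_mem_fineEdges hef
      have hE : ∀ E : M.Edge, E.1 ⊆ K.1 → e ∉ M.edgesIn E := by
        intro E hE he
        exact hen (Finset.mem_biUnion.2 ⟨E, mem_edgesOf.2 hE, he⟩)
      rw [sideFlux_apply]
      rcases ((M.trisIn K).filter (fun τ => e ⊆ τ.1)).eq_empty_or_nonempty with h0 | ⟨τ, hτ⟩
      · rw [h0, Finset.sum_empty, mul_zero]
      · obtain ⟨hτK, heτ⟩ := Finset.mem_filter.1 hτ
        obtain ⟨τ', hτ'K, hne, heτ'⟩ := exists_neighbour hτK heτ hc hE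
        have hset : (M.trisIn K).filter (fun τ => e ⊆ τ.1) = {τ, τ'} := by
          ext υ
          simp only [Finset.mem_filter, Finset.mem_insert, Finset.mem_singleton]
          constructor
          · rintro ⟨_, h⟩
            by_cases hυ : υ = τ
            · exact Or.inl hυ
            · exact Or.inr (fine_not_three heτ h heτ' hc (fun h => hυ h.symm) hne.symm)
          · rintro (rfl | rfl)
            · exact ⟨hτK, heτ⟩
            · exact ⟨hτ'K, heτ'⟩
        rw [hset, Finset.sum_pair hne.symm, hw e hef τ hτK τ' hτ'K hne.symm heτ heτ', mul_zero]
  · intro E _ E' _ hne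
    rw [Function.onFun, Finset.disjoint_left]
    exact fun e h h' => hne (edgesIn_unique h h')

/-! ### Local velocity spaces -/

/-- The fields with continuous normal components inside `K`. -/
def confSub (K : M.Elt) : Submodule ℝ M.Vel where
  carrier := {v | ConformingIn K v}
  add_mem' := by
    intro v w hv hw e he τ hτ τ' hτ' hne h h'
    have h1 := hv e he τ hτ τ' hτ' hne h h'
    have h2 := hw e he τ hτ τ' hτ' hne h h'
    simp only [FluxContinuous, flux_add] at *
    linarith
  zero_mem' := by
    intro e _ τ _ τ' _ _ _ _
    simp [FluxContinuous, flux_zero]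
  smul_mem' := by
    intro c v hv e he τ hτ τ' hτ' hne h h'
    have h1 := hv e he τ hτ τ' hτ' hne h h'
    simp only [FluxContinuous, flux_smul] at *
    rw [← mul_add, h1, mul_zero]

lemma confSub_congr {K : M.Elt} {v w : M.Vel} (h : ∀ τ ∈ M.trisIn K, v τ = w τ)
    (hv : v ∈ confSub K) : w ∈ confSub K := by
  intro e he τ hτ τ' hτ' hne h1 h2
  have := hv e he τ hτ τ' hτ' hne h1 h2
  rwa [FluxContinuous, flux_congr (h τ hτ), flux_congr (h τ' hτ')] at this

lemma localV_iff {K : M.Elt} {w : M.Vel} : LocalV K w ↔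
    (∀ τ, τ ∉ M.trisIn K → w τ = 0) ∧ ConformingIn K w ∧
      ∀ E : M.Edge, E.1 ⊆ K.1 → ∀ e ∈ M.edgesIn E, sideFlux K e w = 0 := by
  refine and_congr_right fun _ => and_congr_right fun _ =>
    forall_congr' fun E => forall_congr' fun hE => forall_congr' fun e => forall_congr' fun he => ?_
  constructor
  · intro h
    obtain ⟨τ, hτ, heτ, _⟩ := exists_side hE he
    rw [sideFlux_eq_flux hE he hτ heτ]
    exact h τ hτ heτ
  · intro h τ hτ heτ
    rwa [← sideFlux_eq_flux hE he hτ heτ]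

/-- The fields `v` for which `∫_K κ v · w = ∫_K p ∇·w` on `V_{h,0}(K)`, for some pressure `p`. -/
def potentialSub (hκ : Coeff M κ) (K : M.Elt) : Submodule ℝ M.Vel where
  carrier := {v | ∃ p : M.Tri → ℝ, ∀ w, LocalV K w →
    massVB hκ (M.trisIn K) v w = divB (M.trisIn K) p w}
  add_mem' := by
    rintro v v' ⟨p, hp⟩ ⟨p', hp'⟩
    refine ⟨p + p', fun w hw => ?_⟩
    simp only [map_add, LinearMap.add_apply, hp w hw, hp' w hw]
  zero_mem' := ⟨0, fun w _ => by simp only [map_zero, LinearMap.zero_apply]⟩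
  smul_mem' := by
    rintro c v ⟨p, hp⟩
    refine ⟨c • p, fun w hw => ?_⟩
    simp only [map_smul, LinearMap.smul_apply, hp w hw]

lemma potentialSub_congr (hκ : Coeff M κ) {K : M.Elt} {v w : M.Vel}
    (h : ∀ τ ∈ M.trisIn K, v τ = w τ) (hv : v ∈ potentialSub hκ K) : w ∈ potentialSub hκ K := by
  obtain ⟨p, hp⟩ := hv
  refine ⟨p, fun u hu => ?_⟩
  rw [← hp u hu, massVB_apply, massVB_apply]
  exact massV_congr (fun τ hτ => (h τ hτ).symm) fun _ _ => rfl

/-- Fields in `V_{h,0}(K)` have mean-zero divergence. -/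
lemma LocalV.div_mean {K : M.Elt} {w : M.Vel} (hw : LocalV K w) (c : ℝ) :
    divForm (M.trisIn K) (fun _ => c) w = 0 := by
  have h := gauss_elt hw.2.1
  have h0 : ∑ E ∈ M.edgesOf K, ∑ e ∈ M.edgesIn E, len e * sideFlux K e w = 0 :=
    Finset.sum_eq_zero fun E hE => Finset.sum_eq_zero fun e he => by
      rw [(localV_iff.1 hw).2.2 E (mem_edgesOf.1 hE) e he, mul_zero]
  rw [h0] at h
  unfold divForm
  have : ∀ τ : M.Tri, area τ.1 * (c * dvg w τ) = c * (area τ.1 * dvg w τ) := fun τ => by ring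
  simp only [this]
  rw [← Finset.mul_sum, h, mul_zero]

lemma restr_of_mem {K : M.Elt} {τ : M.Tri} (h : τ ∈ M.trisIn K) (v : M.Vel) :
    restr K v τ = v τ := if_pos h

lemma restr_of_notMem {K : M.Elt} {τ : M.Tri} (h : τ ∉ M.trisIn K) (v : M.Vel) :
    restr K v τ = 0 := if_neg h

/-- The outward normal component of a field in `V_{h,0}(K)` vanishes on all fine edges of coarse
edges. -/
lemma LocalV.sideFlux_eq_zero {K : M.Elt} {w : M.Vel} (hw : LocalV K w) {K' : M.Elt}
    {E : M.Edge} (hE : E.1 ⊆ K'.1) {e : Finset Plane} (he : e ∈ M.edgesIn E) :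
    sideFlux K' e w = 0 := by
  by_cases h : K' = K
  · subst h
    exact (localV_iff.1 hw).2.2 E hE e he
  · obtain ⟨τ, hτ, heτ, _⟩ := exists_side hE he
    rw [sideFlux_eq_flux hE he hτ heτ,
      flux_congr (w := 0) (hw.1 τ fun hτK => h (elt_unique hτ hτK)), flux_zero]

/-- A field in `V_{h}(K)` for every `K` belongs to the decoupled fine velocity space, if its normal
component is continuous across the coarse edges that are not decoupled. -/
lemma mem_fineV_of {v : M.Vel} (h : ∀ K, ConformingIn K v)
    (h' : ∀ E : M.Edge, ¬ M.IsDecoupled E → ∀ e ∈ M.edgesIn E, ∀ K ∈ M.eltsAt E,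
      ∀ K' ∈ M.eltsAt E, K ≠ K' → sideFlux K e v + sideFlux K' e v = 0) : v ∈ M.fineV := by
  intro e hef hnot τ τ' hne heτ heτ'
  obtain ⟨K, hK⟩ := exists_elt τ
  obtain ⟨K', hK'⟩ := exists_elt τ'
  by_cases hKK : K = K'
  · subst hKK
    exact h K e hef τ hK τ' hK' hne heτ heτ'
  · obtain ⟨E, hE, hE', he⟩ := exists_common_edge hKK hK hK' heτ heτ' (card_of_mem_fineEdges hef)
    have hdec : ¬ M.IsDecoupled E := fun hd =>
      hnot ((onInitInterior_iff hef).2 ⟨E, hd, he⟩)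
    have := h' E hdec e he K (mem_eltsAt.2 hE) K' (mem_eltsAt.2 hE') hKK
    rwa [sideFlux_eq_flux hE he hK heτ, sideFlux_eq_flux hE' he hK' heτ'] at this

lemma conformingIn_of_mem_fineV {v : M.Vel} (hv : v ∈ M.fineV) (K : M.Elt) :
    ConformingIn K v := by
  intro e hef τ hτ τ' hτ' hne h h'
  refine hv e hef ?_ τ τ' hne h h'
  rw [onInitInterior_iff hef]
  rintro ⟨E, _, he⟩
  exact hne (side_unique (edge_subset_elt hτ h he) he hτ hτ' h h')

lemma sideFlux_add_of_mem_fineV {v : M.Vel} (hv : v ∈ M.fineV) {E : M.Edge}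
    (hE : ¬ M.IsDecoupled E) {e : Finset Plane} (he : e ∈ M.edgesIn E) {K K' : M.Elt}
    (hK : E.1 ⊆ K.1) (hK' : E.1 ⊆ K'.1) (hne : K ≠ K') :
    sideFlux K e v + sideFlux K' e v = 0 := by
  obtain ⟨τ, hτ, heτ, _⟩ := exists_side hK he
  obtain ⟨τ', hτ', heτ', _⟩ := exists_side hK' he
  rw [sideFlux_eq_flux hK he hτ heτ, sideFlux_eq_flux hK' he hτ' heτ']
  refine hv e (mem_edgesIn.1 he).1 (not_onInitInterior hE he) τ τ' ?_ heτ heτ'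
  rintro rfl
  exact hne (elt_unique hτ hτ')

lemma LocalV.conforming {K : M.Elt} {w : M.Vel} (hw : LocalV K w) (K' : M.Elt) :
    ConformingIn K' w := by
  by_cases h : K' = K
  · subst h; exact hw.2.1
  · intro e _ τ hτ τ' hτ' _ _ _
    rw [FluxContinuous, flux_congr (w := 0) (hw.1 τ fun hτK => h (elt_unique hτ hτK)),
      flux_congr (w := 0) (hw.1 τ' fun hτK => h (elt_unique hτ' hτK)), flux_zero, flux_zero,
      add_zero]

lemma LocalV.mem_fineV {K : M.Elt} {w : M.Vel} (hw : LocalV K w) : w ∈ M.fineV := by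
  refine mem_fineV_of hw.conforming fun E _ e he K₁ h₁ K₂ h₂ _ => ?_
  rw [hw.sideFlux_eq_zero (mem_eltsAt.1 h₁) he, hw.sideFlux_eq_zero (mem_eltsAt.1 h₂) he, add_zero]

/-! ### Pressure spaces -/

/-- `partI` as a linear map. -/
def partIL : M.Pres →ₗ[ℝ] (M.Tri → ℝ) where
  toFun := partI
  map_add' p q := by funext τ; exact presAt_add ..
  map_smul' c q := by funext τ; exact presAt_smul ..

lemma partIL_apply (q : M.Pres) : partIL q = partI q := rfl

/-- `const` as a linear map. -/
def constL : (M.Tri → ℝ) →ₗ[ℝ] M.Pres where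
  toFun := const
  map_add' p q := by funext τ; simp [const]
  map_smul' c q := by funext τ; simp [const]

lemma constL_apply (q : M.Tri → ℝ) : constL q = const q := rfl

/-- `partB` as a linear map. -/
def partBL : M.Pres →ₗ[ℝ] M.Pres := LinearMap.id - constL.comp partIL

lemma partBL_apply (q : M.Pres) : partBL q = partB q := rfl

/-- The value at a point as a linear functional. -/
def presAtL (τ : M.Tri) (x : Plane) : M.Pres →ₗ[ℝ] ℝ where
  toFun q := presAt q τ x
  map_add' _ _ := presAt_add ..
  map_smul' _ _ := presAt_smul ..

/-- `presOn` as a linear functional. -/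
def presOnL (e : Finset Plane) : M.Pres →ₗ[ℝ] ℝ :=
  ((M.trisAt e).card : ℝ)⁻¹ • ∑ τ ∈ M.trisAt e, presAtL τ (center e)

lemma presOnL_apply (e : Finset Plane) (q : M.Pres) : presOnL e q = presOn q e := by
  simp [presOnL, presOn, presAtL]

/-- `jump` as a linear functional. -/
def jumpL (e : Finset Plane) : M.Vel →ₗ[ℝ] ℝ := ∑ τ ∈ M.trisAt e, fluxL τ e

lemma jumpL_apply (e : Finset Plane) (w : M.Vel) : jumpL e w = jump w e := by
  simp [jumpL, jump, fluxL]

/-- `jumpForm` as a bilinear map. -/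
def jumpB : M.Pres →ₗ[ℝ] M.Vel →ₗ[ℝ] ℝ :=
  ∑ e ∈ M.fineEdges.filter M.OnInitInterior,
    len e • (LinearMap.mul ℝ ℝ).compl₁₂ ((presOnL e).comp partBL) (jumpL e)

lemma jumpB_apply (q : M.Pres) (w : M.Vel) : jumpB q w = jumpForm q w := by
  simp [jumpB, jumpForm, presOnL_apply, jumpL_apply, partBL_apply]

/-- The coupling form `∫ q^{(I)} ∇·w - ∑ ∫ q^{(B)} [w · n]` of pressures and velocities. -/
def coupling : M.Pres →ₗ[ℝ] M.Vel →ₗ[ℝ] ℝ := (divB Finset.univ).comp partIL - jumpB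

lemma coupling_apply (q : M.Pres) (w : M.Vel) :
    coupling q w = divForm Finset.univ (partI q) w - jumpForm q w := by
  simp [coupling, jumpB_apply, divB_apply, partIL_apply]

lemma presAt_const (c : M.Tri → ℝ) (τ : M.Tri) (x : Plane) : presAt (const c) τ x = c τ := by
  simp [presAt, const]

lemma partI_const (c : M.Tri → ℝ) : partI (const c) = c := by
  funext τ; exact presAt_const ..

lemma partB_const (c : M.Tri → ℝ) : partB (const c) = 0 := by
  rw [partB, partI_const, sub_self]

lemma partI_add_partB (q : M.Pres) : const (partI q) + partB q = q := by
  rw [partB]; abel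

lemma partI_of_mem_bubbleQ {q : M.Pres} (hq : q ∈ M.bubbleQ) : partI q = 0 := by
  funext τ; exact hq.2.1 τ

lemma partB_of_mem_bubbleQ {q : M.Pres} (hq : q ∈ M.bubbleQ) : partB q = q := by
  rw [partB, partI_of_mem_bubbleQ hq, ← constL_apply, map_zero, sub_zero]

lemma const_mem_fineQ (c : M.Tri → ℝ) : const c ∈ M.fineQ := fun _ => rfl

lemma const_mem_fineQhat (c : M.Tri → ℝ) : const c ∈ M.fineQhat :=
  Submodule.mem_sup_left (const_mem_fineQ c)

lemma partB_mem_bubbleQ {q : M.Pres} (hq : q ∈ M.fineQhat) : partB q ∈ M.bubbleQ := by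
  obtain ⟨q₁, h₁, q₂, h₂, rfl⟩ := Submodule.mem_sup.1 hq
  have e : q₁ = const fun τ => (q₁ τ).1 := by
    funext τ
    exact Prod.ext rfl (h₁ τ)
  rw [← partBL_apply, map_add, partBL_apply, partBL_apply, partB_of_mem_bubbleQ h₂, e, partB_const,
    zero_add]
  exact h₂

lemma jumpForm_const (c : M.Tri → ℝ) (w : M.Vel) : jumpForm (const c) w = 0 := by
  refine Finset.sum_eq_zero fun e _ => ?_
  rw [partB_const, ← presOnL_apply, map_zero]
  ring

variable (M) in
/-- The coarse edges across which velocities are decoupled. -/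
def decoupledEdges : Finset M.Edge := Finset.univ.filter M.IsDecoupled

lemma mem_decoupledEdges {E : M.Edge} : E ∈ M.decoupledEdges ↔ M.IsDecoupled E := by
  simp [decoupledEdges]

lemma sum_onInitInterior (f : Finset Plane → ℝ) :
    ∑ e ∈ M.fineEdges.filter M.OnInitInterior, f e =
      ∑ E ∈ M.decoupledEdges, ∑ e ∈ M.edgesIn E, f e := by
  rw [← Finset.sum_biUnion]
  · refine Finset.sum_congr ?_ fun _ _ => rfl
    ext e
    simp only [Finset.mem_filter, Finset.mem_biUnion, mem_decoupledEdges]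
    constructor
    · rintro ⟨he, h⟩
      exact (onInitInterior_iff he).1 h
    · rintro ⟨E, hE, he⟩
      exact ⟨(mem_edgesIn.1 he).1, (onInitInterior_iff (mem_edgesIn.1 he).1).2 ⟨E, hE, he⟩⟩
  · intro E _ E' _ hne
    rw [Function.onFun, Finset.disjoint_left]
    exact fun e h h' => hne (edgesIn_unique h h')

/-- The jump form as a sum over the sides of the decoupled coarse edges. -/
lemma jumpForm_eq (q : M.Pres) (w : M.Vel) :
    jumpForm q w = ∑ E ∈ M.decoupledEdges, ∑ K ∈ M.eltsAt E,
      ∑ e ∈ M.edgesIn E, len e * (presOn (partB q) e * sideFlux K e w) := by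
  rw [jumpForm, sum_onInitInterior]
  refine Finset.sum_congr rfl fun E _ => ?_
  rw [Finset.sum_comm]
  refine Finset.sum_congr rfl fun e he => ?_
  rw [jump_eq he, Finset.mul_sum, Finset.mul_sum]

lemma LocalV.jumpForm_eq_zero {K : M.Elt} {w : M.Vel} (hw : LocalV K w) (q : M.Pres) :
    jumpForm q w = 0 := by
  rw [jumpForm_eq]
  refine Finset.sum_eq_zero fun E _ => Finset.sum_eq_zero fun K' hK' =>
    Finset.sum_eq_zero fun e he => ?_
  rw [hw.sideFlux_eq_zero (mem_eltsAt.1 hK') he, mul_zero, mul_zero]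

lemma inner_normal_center {τ e : Finset Plane} (hτ : IsTri τ) (h : e ⊆ τ) (hc : e.card = 2) :
    0 < ⟪outwardNormal τ e, center e - center τ⟫ ∧
      ∀ x ∈ e, ⟪outwardNormal τ e, x⟫ = ⟪outwardNormal τ e, center e⟫ := by
  obtain ⟨a, b, z, hab, rfl, rfl, _, hD⟩ := hτ.exists_edge h hc
  obtain ⟨n1, n2, n3⟩ := outwardNormal_spec hD
  set n := outwardNormal {a, b, z} {a, b}
  have e1 : center {a, b} - center {a, b, z} =
      (1 / 6 : ℝ) • (b - a) - (1 / 3 : ℝ) • (z - a) := by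
    rw [center_pair hab, center_triple hτ]
    module
  have e2 : ⟪n, b⟫ = ⟪n, a⟫ := by
    rw [inner_sub_right] at n2
    linarith
  constructor
  · rw [e1, inner_sub_right, inner_smul_right, inner_smul_right, n2, n3]
    have : 0 < |cross (b - a) (z - a)| / ‖b - a‖ :=
      div_pos (abs_pos.2 hD) (norm_pos_iff.2 (sub_ne_zero.2 hab.symm))
    linarith
  · intro x hx
    rw [center_pair hab, inner_add_right, inner_smul_right, inner_smul_right, e2]
    rcases Finset.mem_insert.1 hx with rfl | hx
    · ring
    · rw [Finset.mem_singleton.1 hx, e2]; ring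

lemma presAt_edgePressure {E : M.Edge} (g : Finset Plane → ℝ) {τ : M.Tri} {e : Finset Plane}
    (he : e ∈ M.edgesIn E) (heτ : e ⊆ τ.1) (x : Plane) :
    presAt (edgePressure E g) τ x = g e / ⟪outwardNormal τ.1 e, center e - center τ.1⟫ *
      ⟪outwardNormal τ.1 e, x - center τ.1⟫ := by
  have hf : (M.edgesIn E).filter (fun e => e ⊆ τ.1) = {e} := by
    ext e'
    simp only [Finset.mem_filter, Finset.mem_singleton]
    constructor
    · rintro ⟨h, h'⟩
      exact edgesIn_tri_unique h he h' heτ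
    · rintro rfl
      exact ⟨he, heτ⟩
  rw [presAt, edgePressure, hf, Finset.sum_singleton]
  simp only [real_inner_smul_left, inner_sub_right]
  ring

lemma edgePressure_eq_zero {E : M.Edge} (g : Finset Plane → ℝ) {τ : M.Tri}
    (h : ∀ e ∈ M.edgesIn E, ¬ e ⊆ τ.1) : edgePressure E g τ = 0 := by
  rw [edgePressure, Finset.filter_false_of_mem h, Finset.sum_empty]

lemma presAt_edgePressure_center {E : M.Edge} (g : Finset Plane → ℝ) {τ : M.Tri}
    {e : Finset Plane} (he : e ∈ M.edgesIn E) (heτ : e ⊆ τ.1) :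
    presAt (edgePressure E g) τ (center e) = g e := by
  rw [presAt_edgePressure g he heτ, div_mul_cancel₀]
  exact (inner_normal_center (Tri.isTri τ) heτ (card_of_mem_edgesIn he)).1.ne'

lemma presAt_edgePressure_other {E E' : M.Edge} (hE : E.1 ∈ edges M.init.triangles)
    (hE' : E'.1 ∈ edges M.init.triangles) (hne : E' ≠ E) (g : Finset Plane → ℝ) {τ : M.Tri}
    {e : Finset Plane} (he : e ∈ M.edgesIn E') (heτ : e ⊆ τ.1) (x : Plane) :
    presAt (edgePressure E g) τ x = 0 := by
  have : edgePressure E g τ = 0 := edgePressure_eq_zero g fun e' he' h =>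
    hne (onInit_tri_unique hE' hE he he' heτ h).1
  simp [presAt, this]

/-- The functions attached to the edge data `g` on a decoupled coarse edge satisfy all conditions of
`bubbleQ`: a fine triangle has at most one edge on the initial triangulation, so the data on
different edges do not interact. -/
lemma edgePressure_mem_bubbleQ {E : M.Edge} (hE : M.IsDecoupled E) (g : Finset Plane → ℝ) :
    edgePressure E g ∈ M.bubbleQ := by
  have key : ∀ e ∈ M.fineEdges, M.OnInit e → e ∉ M.edgesIn E → ∀ τ ∈ M.trisAt e, ∀ x,
      presAt (edgePressure E g) τ x = 0 := by
    intro e hef hon hne τ hτ x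
    obtain ⟨E', hE', he⟩ := (onInit_iff hef).1 hon
    exact presAt_edgePressure_other hE.mem hE' (fun h => hne (h ▸ he)) g he (mem_trisAt.1 hτ) x
  refine ⟨fun τ h => ?_, fun τ => ?_, fun e hef hon τ hτ x hx => ?_,
    fun e hef hon τ hτ τ' hτ' => ?_, fun e hef hon hnot τ hτ => ?_⟩
  · refine edgePressure_eq_zero g fun e he heτ => ?_
    exact h e (mem_edgesIn.1 he).1 heτ ⟨E.1, hE.mem, (mem_edgesIn.1 he).2⟩
  · by_cases h : ∃ e ∈ M.edgesIn E, e ⊆ τ.1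
    · obtain ⟨e, he, heτ⟩ := h
      rw [presAt_edgePressure g he heτ, sub_self, inner_zero_right, mul_zero]
    · have : edgePressure E g τ = 0 :=
        edgePressure_eq_zero g fun e he heτ => h ⟨e, he, heτ⟩
      simp [presAt, this]
  · by_cases he : e ∈ M.edgesIn E
    · have heτ := mem_trisAt.1 hτ
      rw [presAt_edgePressure g he heτ, presAt_edgePressure g he heτ, inner_sub_right,
        inner_sub_right,
        (inner_normal_center (Tri.isTri τ) heτ (card_of_mem_edgesIn he)).2 x hx]
    · rw [key e hef hon he τ hτ, key e hef hon he τ hτ]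
  · by_cases he : e ∈ M.edgesIn E
    · rw [presAt_edgePressure_center g he (mem_trisAt.1 hτ),
        presAt_edgePressure_center g he (mem_trisAt.1 hτ')]
    · have hon' : M.OnInit e := by
        obtain ⟨E', hE', h⟩ := (onInitInterior_iff hef).1 hon
        exact (onInit_iff hef).2 ⟨E', hE'.mem, h⟩
      rw [key e hef hon' he τ hτ, key e hef hon' he τ' hτ']
  · refine key e hef hon (fun he => hnot ?_) τ hτ _
    exact (onInitInterior_iff hef).2 ⟨E, hE, he⟩

lemma trisAt_nonempty {e : Finset Plane} (he : e ∈ M.fineEdges) : (M.trisAt e).Nonempty := by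
  obtain ⟨τ, h, _⟩ := mem_fineEdges.1 he
  exact ⟨τ, mem_trisAt.2 h⟩

lemma trisAt_card_le {e : Finset Plane} (he : e.card = 2) : (M.trisAt e).card ≤ 2 := by
  by_contra h
  obtain ⟨σ, τ, υ, hσ, hτ, hυ, h1, h2, h3⟩ := Finset.two_lt_card_iff.1 (not_le.1 h)
  rw [mem_trisAt] at hσ hτ hυ
  exact h3 (fine_not_three hσ hτ hυ he h1 h2)

/-- An average of equal values. -/
lemma avg_eq {ι : Type*} {s : Finset ι} (hs : s.Nonempty) {f : ι → ℝ} {c : ℝ}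
    (h : ∀ i ∈ s, f i = c) : (s.card : ℝ)⁻¹ * ∑ i ∈ s, f i = c := by
  rw [Finset.sum_congr rfl h, Finset.sum_const, nsmul_eq_mul, inv_mul_cancel_left₀]
  exact_mod_cast hs.card_ne_zero

lemma presOn_edgePressure {E : M.Edge} (g : Finset Plane → ℝ) {e : Finset Plane}
    (he : e ∈ M.edgesIn E) : presOn (edgePressure E g) e = g e :=
  avg_eq (trisAt_nonempty (mem_edgesIn.1 he).1) fun _ hτ =>
    presAt_edgePressure_center g he (mem_trisAt.1 hτ)

lemma presOn_edgePressure_other {E E' : M.Edge} (hE : M.IsDecoupled E) (hE' : M.IsDecoupled E')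
    (hne : E' ≠ E) (g : Finset Plane → ℝ) {e : Finset Plane} (he : e ∈ M.edgesIn E') :
    presOn (edgePressure E g) e = 0 :=
  avg_eq (trisAt_nonempty (mem_edgesIn.1 he).1) fun _ hτ =>
    presAt_edgePressure_other hE.mem hE'.mem hne g he (mem_trisAt.1 hτ) _

lemma presAt_affine (q : M.Pres) (τ : M.Tri) {r s t : ℝ} (h : r + s + t = 1) (a b c : Plane) :
    presAt q τ (r • a + s • b + t • c) =
      r * presAt q τ a + s * presAt q τ b + t * presAt q τ c := by
  simp only [presAt, inner_add_right, inner_smul_right]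
  linear_combination (-(q τ).1) * h

lemma diam_le_h (τ : M.Tri) : Metric.diam (hull τ.1) ≤ M.h :=
  le_ciSup (f := fun τ : M.Tri => Metric.diam (hull τ.1)) (Set.finite_range _).bddAbove τ

lemma h_nonneg : 0 ≤ M.h := Real.iSup_nonneg fun _ => Metric.diam_nonneg

lemma abs_cross_le (u v : Plane) : |cross u v| ≤ ‖u‖ * ‖v‖ := by
  have h := abs_real_inner_le_norm (rot u) v
  rwa [inner_rot, abs_neg, norm_rot] at h

/-- On a fine triangle with an edge `e` on the initial triangulation, a function of `bubbleQ` with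
value `g` on `e` has value `-2 g` at the opposite vertex, so it is bounded by `2 |g|`; the area is
at most `h |e| / 2`. -/
lemma bubble_tri_le (hρ : Coeff M ρ) {R : ℝ} (hR : ∀ x ∈ M.domain, ρ x ≤ R) {q : M.Pres}
    (hq : q ∈ M.bubbleQ) {τ : M.Tri} {e : Finset Plane} (hef : e ∈ M.fineEdges)
    (hon : M.OnInit e) (heτ : e ⊆ τ.1) :
    ∫ x in hull τ.1, ρ x * (presAt q τ x * presAt q τ x) ≤
      2 * R * M.h * (len e * presAt q τ (center e) ^ 2) := by
  have hR0 : 0 ≤ R := by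
    have hx := center_mem_hull (Tri.isTri τ).nonempty
    exact (hρ.pos hx).le.trans (hR _ (hull_subset_domain τ hx))
  set g := presAt q τ (center e) with hg
  have hτe := mem_trisAt.2 heτ
  have hconst := hq.2.2.1 e hef hon τ hτe
  have hbound : ∀ x ∈ hull τ.1, presAt q τ x * presAt q τ x ≤ 4 * g ^ 2 := by
    obtain ⟨a, b, z, hab, rfl, hτz, _, hD⟩ :=
      (Tri.isTri τ).exists_edge heτ (card_of_mem_fineEdges hef)
    have ha := hconst a (by simp)
    have hb := hconst b (by simp)
    -- The value at the centroid, the mean of the values at the vertices, is zero.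
    have hz : presAt q τ z = -2 * g := by
      have h0 := hq.2.1 τ
      have hT := Tri.isTri τ
      rw [hτz] at hT
      rw [hτz, center_triple hT, presAt_affine q τ (by norm_num), ha, hb] at h0
      linarith
    intro x hx
    rw [hτz] at hx
    obtain ⟨r, s, t, hr, hs, ht, hsum, rfl⟩ := mem_hull_triple.1 hx
    rw [presAt_affine q τ hsum, ha, hb, hz]
    have e1 : r * g + s * g + t * (-2 * g) = (1 - 3 * t) * g := by
      have : r = 1 - s - t := by linarith
      subst this; ring
    rw [← hg, e1]
    have ht1 : t ≤ 1 := by linarith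
    have : (1 - 3 * t) ^ 2 ≤ 4 := by nlinarith
    nlinarith [sq_nonneg g]
  have harea : area τ.1 ≤ M.h * len e / 2 := by
    obtain ⟨a, b, z, hab, rfl, hτz, _, hD⟩ :=
      (Tri.isTri τ).exists_edge heτ (card_of_mem_fineEdges hef)
    have hdist : ‖z - a‖ ≤ M.h := by
      rw [← dist_eq_norm]
      refine (Metric.dist_le_diam_of_mem (isCompact_hull τ.1).isBounded ?_ ?_).trans (diam_le_h τ)
      · exact mem_hull_self (by rw [hτz]; simp)
      · exact mem_hull_self (by rw [hτz]; simp)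
    rw [len_pair]
    nth_rewrite 1 [hτz]
    rw [area_triple hD]
    have h1 := abs_cross_le (b - a) (z - a)
    have h2 := mul_le_mul_of_nonneg_left hdist (norm_nonneg (b - a))
    linarith
  have hle : ∫ x in hull τ.1, ρ x * (presAt q τ x * presAt q τ x) ≤
      ∫ _x in hull τ.1, R * (4 * g ^ 2) := by
    refine setIntegral_mono_on (integrableOn_massQ hρ τ q q)
      (integrableOn_hull continuous_const _) (measurableSet_hull _) fun x hx => ?_
    exact mul_le_mul (hR x (hull_subset_domain τ hx)) (hbound x hx) (mul_self_nonneg _) hR0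
  rw [setIntegral_const, smul_eq_mul] at hle
  refine hle.trans ?_
  change area τ.1 * _ ≤ _
  have h3 : 0 ≤ R * (4 * g ^ 2) := by positivity
  calc area τ.1 * (R * (4 * g ^ 2)) ≤ M.h * len e / 2 * (R * (4 * g ^ 2)) :=
        mul_le_mul_of_nonneg_right harea h3
    _ = 2 * R * M.h * (len e * g ^ 2) := by ring

/-- The `Q`-norm of a function of `bubbleQ` in terms of its values on the decoupled edges. -/
lemma bubble_norm_le (hρ : Coeff M ρ) {R : ℝ} (hR0 : 0 ≤ R) (hR : ∀ x ∈ M.domain, ρ x ≤ R)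
    {q : M.Pres} (hq : q ∈ M.bubbleQ) :
    massQ ρ q q ≤ 4 * R * M.h *
      ∑ E ∈ M.decoupledEdges, ∑ e ∈ M.edgesIn E, len e * presOn q e ^ 2 := by
  rw [← sum_onInitInterior]
  set F := M.fineEdges.filter M.OnInitInterior with hF
  have hterm : ∀ e ∈ F, 0 ≤ 2 * R * M.h * (len e * presOn q e ^ 2) := by
    intro e he
    have := (len_pos (card_of_mem_fineEdges (Finset.mem_filter.1 he).1)).le
    have := h_nonneg (M := M)
    positivity
  have h1 : ∀ τ : M.Tri, ∫ x in hull τ.1, ρ x * (presAt q τ x * presAt q τ x) ≤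
      ∑ e ∈ F.filter (fun e => e ⊆ τ.1), 2 * R * M.h * (len e * presOn q e ^ 2) := by
    intro τ
    have hnn : 0 ≤ ∑ e ∈ F.filter (fun e => e ⊆ τ.1), 2 * R * M.h * (len e * presOn q e ^ 2) :=
      Finset.sum_nonneg fun e he => hterm e (Finset.mem_filter.1 he).1
    by_cases h : ∃ e ∈ M.fineEdges, e ⊆ τ.1 ∧ M.OnInit e
    · obtain ⟨e, hef, heτ, hon⟩ := h
      refine (bubble_tri_le hρ hR hq hef hon heτ).trans ?_
      -- On a decoupled edge the values from both sides agree with `presOn`; on the boundary of the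
      -- domain the value is zero.
      by_cases hint : M.OnInitInterior e
      · have hval : presAt q τ (center e) = presOn q e :=
          (avg_eq (trisAt_nonempty hef) fun υ hυ =>
            hq.2.2.2.1 e hef hint υ hυ τ (mem_trisAt.2 heτ)).symm
        rw [hval]
        exact Finset.single_le_sum (f := fun e => 2 * R * M.h * (len e * presOn q e ^ 2))
          (fun e he => hterm e (Finset.mem_filter.1 he).1)
          (Finset.mem_filter.2 ⟨Finset.mem_filter.2 ⟨hef, hint⟩, heτ⟩)
      · rw [hq.2.2.2.2 e hef hon hint τ (mem_trisAt.2 heτ)]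
        simpa using hnn
    · push Not at h
      have h0 : q τ = 0 := hq.1 τ fun e hef heτ => h e hef heτ
      simpa [presAt, h0] using hnn
  calc massQ ρ q q ≤ ∑ τ : M.Tri, ∑ e ∈ F.filter (fun e => e ⊆ τ.1),
        2 * R * M.h * (len e * presOn q e ^ 2) := Finset.sum_le_sum fun τ _ => h1 τ
    _ = ∑ e ∈ F, ∑ _τ ∈ M.trisAt e, 2 * R * M.h * (len e * presOn q e ^ 2) := by
        refine Finset.sum_comm' ?_
        intro τ e
        simp only [Finset.mem_filter, mem_trisAt, Finset.mem_univ, true_and]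
        tauto
    -- Every edge belongs to at most two triangles.
    _ ≤ ∑ e ∈ F, 2 * (2 * R * M.h * (len e * presOn q e ^ 2)) := by
        refine Finset.sum_le_sum fun e he => ?_
        rw [Finset.sum_const, nsmul_eq_mul]
        refine mul_le_mul_of_nonneg_right ?_ (hterm e he)
        exact_mod_cast trisAt_card_le (card_of_mem_fineEdges (Finset.mem_filter.1 he).1)
    _ = _ := by
        rw [Finset.mul_sum]
        exact Finset.sum_congr rfl fun e _ => by ring

end StaggeredMesh

/-! ### Expansions in orthonormal families of full dimension -/

/-- A family of `card S - 1` functions on `S` that is orthonormal for the weights `r` and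
annihilated by a nonzero functional spans the kernel of that functional. -/
lemma orthonormal_expansion {ι : Type*} (S : Finset ι) {r a : ι → ℝ} (ha : ∀ i ∈ S, 0 < a i)
    {N : ℕ} (hN : N = S.card - 1) (p : Fin N → ι → ℝ)
    (h0 : ∀ j, ∑ i ∈ S, a i * p j i = 0)
    (h1 : ∀ j k, ∑ i ∈ S, r i * (p j i * p k i) = if j = k then 1 else 0) {q : ι → ℝ}
    (hq : ∑ i ∈ S, a i * q i = 0) :
    ∀ i ∈ S, q i = ∑ j, (∑ i ∈ S, r i * (q i * p j i)) * p j i := by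
  intro i₀ hi₀
  have hcard : 0 < S.card := Finset.card_pos.2 ⟨i₀, hi₀⟩
  set l : (S → ℝ) →ₗ[ℝ] ℝ := ∑ i : S, a i • LinearMap.proj i with hl
  have hl_apply : ∀ f : S → ℝ, l f = ∑ i : S, a i * f i := by
    intro f; simp [hl]
  have hl_res : ∀ f : ι → ℝ, l (fun i => f i) = ∑ i ∈ S, a i * f i := by
    intro f
    rw [hl_apply, Finset.sum_coe_sort S (fun i => a i * f i)]
  have hrange : LinearMap.range l = ⊤ := by
    refine LinearMap.range_eq_top.2 fun c => ⟨Pi.single ⟨i₀, hi₀⟩ (c / a i₀), ?_⟩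
    rw [hl_apply, Finset.sum_eq_single ⟨i₀, hi₀⟩]
    · have := (ha i₀ hi₀).ne'
      simp; field_simp
    · intro b _ hb
      simp [hb]
    · simp
  -- The kernel of the functional has dimension `card S - 1`.
  have hfin : Module.finrank ℝ (LinearMap.ker l) = N := by
    have h := LinearMap.finrank_range_add_finrank_ker l
    rw [hrange, finrank_top, Module.finrank_self, Module.finrank_fintype_fun_eq_card,
      Fintype.card_coe] at h
    omega
  set P : Fin N → LinearMap.ker l := fun j => ⟨fun i => p j i, by
    rw [LinearMap.mem_ker, hl_res, h0]⟩ with hP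
  have hcomb : ∀ (c : Fin N → ℝ) (k : Fin N) (f : ι → ℝ),
      (∀ i ∈ S, ∑ j, c j * p j i = f i) → ∑ i ∈ S, r i * (f i * p k i) = c k := by
    intro c k f hf
    calc ∑ i ∈ S, r i * (f i * p k i)
        = ∑ i ∈ S, ∑ j, c j * (r i * (p j i * p k i)) := by
          refine Finset.sum_congr rfl fun i hi => ?_
          rw [← hf i hi, Finset.sum_mul, Finset.mul_sum]
          exact Finset.sum_congr rfl fun j _ => by ring
      _ = c k := by
          rw [Finset.sum_comm]
          simp only [← Finset.mul_sum, h1]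
          simp
  -- Orthonormal functions are independent, so `N` of them span the kernel.
  have hind : LinearIndependent ℝ P := by
    rw [Fintype.linearIndependent_iff]
    intro c hc k
    rw [← hcomb c k 0]
    · simp
    · intro i hi
      have := congrArg (fun f : LinearMap.ker l => f.1 ⟨i, hi⟩) hc
      simpa [hP] using this
  have hspan : Submodule.span ℝ (Set.range P) = ⊤ := by
    rcases Nat.eq_zero_or_pos N with h | h
    · subst h
      have : Subsingleton (LinearMap.ker l) := Module.finrank_zero_iff.1 hfin
      exact Subsingleton.elim _ _
    · have : Nonempty (Fin N) := ⟨⟨0, h⟩⟩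
      exact hind.span_eq_top_of_card_eq_finrank (by rw [Fintype.card_fin, hfin])
  have hqm : (⟨fun i => q i, by rw [LinearMap.mem_ker, hl_res, hq]⟩ : LinearMap.ker l) ∈
      Submodule.span ℝ (Set.range P) := by rw [hspan]; trivial
  obtain ⟨c, hc⟩ := (Submodule.mem_span_range_iff_exists_fun ℝ).1 hqm
  have hc' : ∀ i ∈ S, ∑ j, c j * p j i = q i := by
    intro i hi
    have := congrArg (fun f : LinearMap.ker l => f.1 ⟨i, hi⟩) hc
    simpa [hP] using this
  rw [← hc' i₀ hi₀]
  exact Finset.sum_congr rfl fun j _ => by rw [hcomb c j q hc']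

/-- Parseval's identity for the expansions of `orthonormal_expansion`. -/
lemma orthonormal_parseval {ι : Type*} (S : Finset ι) {r : ι → ℝ} {N : ℕ} (p : Fin N → ι → ℝ)
    (h1 : ∀ j k, ∑ i ∈ S, r i * (p j i * p k i) = if j = k then 1 else 0) (c : Fin N → ℝ) :
    ∑ i ∈ S, r i * ((∑ j, c j * p j i) * (∑ j, c j * p j i)) = ∑ j, c j ^ 2 := by
  calc ∑ i ∈ S, r i * ((∑ j, c j * p j i) * (∑ j, c j * p j i))
      = ∑ i ∈ S, ∑ j, ∑ k, c j * c k * (r i * (p j i * p k i)) := by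
        refine Finset.sum_congr rfl fun i _ => ?_
        rw [Finset.sum_mul_sum, Finset.mul_sum]
        refine Finset.sum_congr rfl fun j _ => ?_
        rw [Finset.mul_sum]
        exact Finset.sum_congr rfl fun k _ => by ring
    _ = ∑ j, ∑ k, c j * c k * (if j = k then 1 else 0) := by
        rw [Finset.sum_comm]
        refine Finset.sum_congr rfl fun j _ => ?_
        rw [Finset.sum_comm]
        refine Finset.sum_congr rfl fun k _ => ?_
        rw [← Finset.mul_sum, h1]
    _ = _ := by
        refine Finset.sum_congr rfl fun j _ => ?_
        simp [sq]

namespace StaggeredMesh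

variable {M : StaggeredMesh} {κ ρ : Plane → ℝ}

/-! ### Surjectivity of the divergence on an element -/

/-- The Raviart-Thomas shape function of a fine triangle and one of its edges. -/
lemma exists_rt (τ : M.Tri) {e : Finset Plane} (heτ : e ⊆ τ.1) (hc : e.card = 2) :
    ∃ v : M.Vel, (∀ υ, υ ≠ τ → v υ = 0) ∧ area τ.1 * dvg v τ = 2 ∧ len e * flux v τ e = 2 ∧
      ∀ e', e' ⊆ τ.1 → e'.card = 2 → e' ≠ e → flux v τ e' = 0 := by
  obtain ⟨a, b, z, hab, rfl, hτ, hz, hD⟩ := (Tri.isTri τ).exists_edge heτ hc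
  have hA := (area_pos τ).ne'
  set α := (area τ.1)⁻¹ with hα
  set v : M.Vel := Pi.single τ (-(α • z), α) with hv
  have hvτ : v τ = (-(α • z), α) := by simp [hv]
  have hdvg : area τ.1 * dvg v τ = 2 := by
    rw [dvg, hvτ, hα]; field_simp
  have hzero : ∀ e', e' ⊆ τ.1 → e'.card = 2 → e' ≠ {a, b} → flux v τ e' = 0 := by
    intro e' he' hc' hne
    have hze : z ∈ e' := by
      by_contra hz'
      refine hne (Finset.eq_of_subset_of_card_le ?_ (by rw [hc, hc']))
      intro x hx
      have := he' hx
      rw [hτ] at this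
      simp only [Finset.mem_insert, Finset.mem_singleton] at this ⊢
      rcases this with h | h | h
      · exact Or.inl h
      · exact Or.inr h
      · exact absurd (h ▸ hx) hz'
    rw [flux, comp, velAt, hvτ]
    have h := (inner_normal_center (Tri.isTri τ) he' hc').2 z hze
    simp only
    rw [neg_add_eq_sub, ← smul_sub, real_inner_smul_left, inner_sub_left,
      real_inner_comm, real_inner_comm (outwardNormal τ.1 e') z, h, sub_self, mul_zero]
  refine ⟨v, fun υ hυ => by simp [hv, hυ], hdvg, ?_, hzero⟩
  have hg := (Tri.isTri τ).gauss (v τ).1 (v τ).2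
  rw [Finset.sum_eq_single {a, b}] at hg
  · rw [← hdvg, dvg, ← hg]
    rfl
  · intro e' he' hne
    obtain ⟨h1, h2⟩ := Finset.mem_powersetCard.1 he'
    have := hzero e' h1 h2 hne
    rw [flux, comp, velAt] at this
    rw [this, mul_zero]
  · intro h
    exact absurd (Finset.mem_powersetCard.2 ⟨heτ, hc⟩) h

lemma flux_sub (v w : M.Vel) (τ : M.Tri) (e : Finset Plane) :
    flux (v - w) τ e = flux v τ e - flux w τ e := map_sub (fluxL τ e) v w

/-- A pressure that is orthogonal to all divergences of fields in `V_{h,0}(K)` is constant. -/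
lemma eq_of_divForm_eq_zero {K : M.Elt} {p : M.Tri → ℝ}
    (hp : ∀ w, LocalV K w → divForm (M.trisIn K) p w = 0) :
    ∀ τ ∈ M.trisIn K, ∀ τ' ∈ M.trisIn K, p τ = p τ' := by
  refine eq_of_adjacent_eq p fun τ hτ τ' hτ' hne e hc h h' => ?_
  -- For two adjacent triangles, the difference of their shape functions at the common edge lies in
  -- `V_{h,0}(K)`; testing with it compares the two values of `p`.
  obtain ⟨v, hv0, hvd, hvf, hvz⟩ := exists_rt τ h hc
  obtain ⟨v', hv0', hvd', hvf', hvz'⟩ := exists_rt τ' h' hc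
  have hlen := (len_pos hc).ne'
  have hz : ∀ υ e', e' ⊆ υ.1 → e'.card = 2 → e' ≠ e → flux (v - v') υ e' = 0 := by
    intro υ e' he' hc' hee
    have h1 : flux v υ e' = 0 := by
      by_cases hυ : υ = τ
      · subst hυ; exact hvz e' he' hc' hee
      · rw [flux_congr (w := 0) (hv0 υ hυ), flux_zero]
    have h2 : flux v' υ e' = 0 := by
      by_cases hυ : υ = τ'
      · subst hυ; exact hvz' e' he' hc' hee
      · rw [flux_congr (w := 0) (hv0' υ hυ), flux_zero]
    rw [flux_sub, h1, h2, sub_zero]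
  have hfτ : flux (v - v') τ e = 2 / len e := by
    rw [flux_sub, flux_congr (v := v') (w := 0) (hv0' τ hne), flux_zero, sub_zero, ← hvf]
    field_simp
  have hfτ' : flux (v - v') τ' e = -(2 / len e) := by
    rw [flux_sub, flux_congr (v := v) (w := 0) (hv0 τ' hne.symm), flux_zero, zero_sub, ← hvf']
    field_simp
  have hloc : LocalV K (v - v') := by
    refine ⟨?_, ?_, ?_⟩
    · intro υ hυ
      have h1 : υ ≠ τ := fun h => hυ (h ▸ hτ)
      have h2 : υ ≠ τ' := fun h => hυ (h ▸ hτ')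
      rw [Pi.sub_apply, hv0 υ h1, hv0' υ h2, sub_zero]
    · intro e' he' υ _ υ' _ hυ h1 h2
      rw [FluxContinuous]
      by_cases hee : e' = e
      · subst hee
        by_cases hυτ : υ = τ
        · subst hυτ
          have : υ' = τ' := fine_not_three h1 h2 h' hc hυ hne
          subst this
          rw [hfτ, hfτ']; ring
        · have h3 : υ = τ' := fine_not_three h h1 h' hc (fun h => hυτ h.symm) hne
          subst h3
          have h4 : υ' = τ := fine_not_three h1 h2 h hc hυ hne.symm
          subst h4
          rw [hfτ, hfτ']; ring
      · rw [hz υ e' h1 (card_of_mem_fineEdges he') hee,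
          hz υ' e' h2 (card_of_mem_fineEdges he') hee, add_zero]
    · intro E hE e' he' υ hυ h1
      by_cases hee : e' = e
      · subst hee
        exact absurd (side_unique hE he' hτ hτ' h h') hne
      · exact hz υ e' h1 (card_of_mem_edgesIn he') hee
  have hdiv := hp _ hloc
  rw [← divB_apply, map_sub, divB_apply, divB_apply] at hdiv
  have e1 : divForm (M.trisIn K) p v = 2 * p τ := by
    unfold divForm
    rw [Finset.sum_eq_single τ]
    · rw [← hvd]; ring
    · intro υ _ hυ
      simp [dvg, hv0 υ hυ]
    · exact fun h => absurd hτ h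
  have e2 : divForm (M.trisIn K) p v' = 2 * p τ' := by
    unfold divForm
    rw [Finset.sum_eq_single τ']
    · rw [← hvd']; ring
    · intro υ _ hυ
      simp [dvg, hv0' υ hυ]
    · exact fun h => absurd hτ' h
  rw [e1, e2] at hdiv
  linarith

/-- `∫_τ ρ` -/
def wt (ρ : Plane → ℝ) (τ : M.Tri) : ℝ := ∫ x in hull τ.1, ρ x

lemma massQ_const (ρ : Plane → ℝ) (p q : M.Tri → ℝ) :
    massQ ρ (const p) (const q) = ∑ τ, wt ρ τ * (p τ * q τ) := by
  unfold massQ wt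
  simp only [presAt_const, integral_mul_const]

lemma massQ_const_of_supp {K : M.Elt} (ρ : Plane → ℝ) (p : M.Tri → ℝ) {q : M.Tri → ℝ}
    (hq : ∀ τ, τ ∉ M.trisIn K → q τ = 0) :
    massQ ρ (const p) (const q) = ∑ τ ∈ M.trisIn K, wt ρ τ * (p τ * q τ) := by
  rw [massQ_const]
  symm
  exact Finset.sum_subset (Finset.subset_univ _) fun τ _ hτ => by rw [hq τ hτ]; ring

/-! ### Multiscale basis functions -/

namespace Basis

variable (B : Basis M κ ρ)

/-- The sign of the fixed normal of `E` relative to the outward normal of `K`. -/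
def sgn (K : M.Elt) (E : M.Edge) : ℝ := ⟪B.normal E, outwardNormal K.1 E.1⟫

lemma sgn_spec {K : M.Elt} {E : M.Edge} (h : E.1 ⊆ K.1) :
    B.sgn K E ^ 2 = 1 ∧ outwardNormal K.1 E.1 = B.sgn K E • B.normal E := by
  obtain ⟨K₀, hK₀, hn⟩ := B.normal_spec E
  have h1 : ‖outwardNormal K.1 E.1‖ = 1 :=
    Triangulation.norm_outwardNormal (T := M.coarse) K.2 h (Edge.card E)
  have h2 : ⟪outwardNormal K.1 E.1, outwardNormal K.1 E.1⟫ = 1 := by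
    rw [real_inner_self_eq_norm_sq, h1, one_pow]
  unfold sgn
  by_cases hK : K = K₀
  · subst hK
    rw [hn, h2]; simp
  · have h3 := normal_elt_neg (fun h => hK h.symm) (mem_eltsAt.1 hK₀) h
    rw [hn, h3, inner_neg_left, h2]
    simp

lemma sgn_add {K K' : M.Elt} {E : M.Edge} (h : E.1 ⊆ K.1) (h' : E.1 ⊆ K'.1) (hne : K ≠ K') :
    B.sgn K E + B.sgn K' E = 0 := by
  unfold sgn
  rw [normal_elt_neg hne h h', inner_neg_right]
  ring

end Basis

namespace IsLocalSolution

variable {B : Basis M κ ρ} {E : M.Edge} {g : Finset Plane → ℝ} {c : M.Elt → ℝ} {φ : M.Vel}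

lemma eq_zero {ν : Plane} (h : IsLocalSolution κ E ν g c φ) {K : M.Elt} (hK : K ∉ M.eltsAt E)
    {τ : M.Tri} (hτ : τ ∈ M.trisIn K) : φ τ = 0 := by
  refine h.supp τ fun hp => ?_
  obtain ⟨K', hK', hτ'⟩ := mem_patch.1 hp
  exact hK (elt_unique hτ hτ' ▸ hK')

/-- The outward normal component of a local solution from the side of `K`. -/
lemma sideFlux_eq (h : IsLocalSolution κ E (B.normal E) g c φ) {K : M.Elt} {E' : M.Edge}
    (hE' : E'.1 ⊆ K.1) {e : Finset Plane} (he : e ∈ M.edgesIn E') :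
    sideFlux K e φ = if E' = E then B.sgn K E * g e else 0 := by
  obtain ⟨τ, hτ, heτ, _⟩ := exists_side hE' he
  rw [sideFlux_eq_flux hE' he hτ heτ]
  split_ifs with hEE
  · subst hEE
    have h1 := h.trace K (mem_eltsAt.2 hE') τ hτ e he heτ
    rw [flux, outwardNormal_fine hτ hE' he heτ, (B.sgn_spec hE').2, ← h1, comp, comp,
      real_inner_smul_right]
  · by_cases hK : K ∈ M.eltsAt E
    · exact h.trace_zero K hK E' hEE hE' τ hτ e he heτ
    · rw [flux_congr (w := 0) (h.eq_zero hK hτ), flux_zero]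

lemma conformingIn {ν : Plane} (h : IsLocalSolution κ E ν g c φ) (K : M.Elt) :
    ConformingIn K φ := by
  by_cases hK : K ∈ M.eltsAt E
  · exact h.conforming K hK
  · exact confSub_congr (v := 0) (fun τ hτ => (h.eq_zero hK hτ).symm) (confSub K).zero_mem

lemma mem_potentialSub {ν : Plane} (h : IsLocalSolution κ E ν g c φ) (hκ : Coeff M κ)
    (K : M.Elt) : φ ∈ potentialSub hκ K := by
  by_cases hK : K ∈ M.eltsAt E
  · obtain ⟨p, hp, _⟩ := h.eqs K hK
    exact ⟨p, fun w hw => sub_eq_zero.1 (hp w hw)⟩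
  · exact potentialSub_congr hκ (v := 0) (fun τ hτ => (h.eq_zero hK hτ).symm)
      (potentialSub hκ K).zero_mem

lemma dvg_eq {ν : Plane} (h : IsLocalSolution κ E ν g c φ) {K : M.Elt} (hK : K ∈ M.eltsAt E)
    {τ : M.Tri} (hτ : τ ∈ M.trisIn K) : dvg φ τ = c K := by
  obtain ⟨_, _, h2⟩ := h.eqs K hK
  -- The divergence condition is stated weakly; it is tested with the indicator of one triangle.
  have := h2 (Pi.single τ 1)
  unfold divForm at this
  rw [Finset.sum_eq_single τ, Finset.sum_eq_single τ] at this
  · simpa [(area_pos τ).ne'] using this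
  · intro υ _ hυ; simp [hυ]
  · exact fun h => absurd hτ h
  · intro υ _ hυ; simp [hυ]
  · exact fun h => absurd hτ h

/-- The divergence of a local solution is constant on every coarse element, so mean-zero
functions do not see it. -/
lemma divForm_eq_zero {ν : Plane} (h : IsLocalSolution κ E ν g c φ) {K : M.Elt} {q : M.Tri → ℝ}
    (hq : ∑ τ ∈ M.trisIn K, area τ.1 * q τ = 0) : divForm (M.trisIn K) q φ = 0 := by
  by_cases hK : K ∈ M.eltsAt E
  · unfold divForm
    rw [Finset.sum_congr rfl fun τ hτ => by rw [h.dvg_eq hK hτ, ← mul_assoc], ← Finset.sum_mul,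
      hq, zero_mul]
  · refine Finset.sum_eq_zero fun τ hτ => ?_
    simp [dvg, h.eq_zero hK hτ]

lemma mem_fineV (h : IsLocalSolution κ E (B.normal E) g c φ) : φ ∈ M.fineV := by
  refine mem_fineV_of h.conformingIn fun E' _ e he K hK K' hK' hne => ?_
  rw [mem_eltsAt] at hK hK'
  rw [h.sideFlux_eq hK he, h.sideFlux_eq hK' he]
  split_ifs with hEE
  · subst hEE
    rw [← add_mul, B.sgn_add hK hK' hne, zero_mul]
  · ring

end IsLocalSolution

lemma sideFlux_restr (K K' : M.Elt) (v : M.Vel) (e : Finset Plane) :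
    sideFlux K' e (restr K v) = if K' = K then sideFlux K e v else 0 := by
  split_ifs with h
  · subst h
    exact sideFlux_congr (fun τ hτ => restr_of_mem hτ v) e
  · rw [sideFlux_congr (w := 0) (fun τ hτ => restr_of_notMem (fun hK => h (elt_unique hτ hK)) v),
      map_zero]

lemma conformingIn_restr {K : M.Elt} {v : M.Vel} (hv : ConformingIn K v) (K' : M.Elt) :
    ConformingIn K' (restr K v) := by
  by_cases h : K' = K
  · subst h
    exact confSub_congr (fun τ hτ => (restr_of_mem hτ v).symm) hv
  · exact confSub_congr (v := 0)
      (fun τ hτ => (restr_of_notMem (fun hK => h (elt_unique hτ hK)) v).symm)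
      (confSub K').zero_mem

/-- Local solutions at decoupled edges may be restricted to one side. -/
lemma IsLocalSolution.restr_mem_fineV {B : Basis M κ ρ} {E : M.Edge} {g : Finset Plane → ℝ}
    {c : M.Elt → ℝ} {φ : M.Vel} (h : IsLocalSolution κ E (B.normal E) g c φ)
    (hE : M.IsDecoupled E) (K : M.Elt) : restr K φ ∈ M.fineV := by
  refine mem_fineV_of (conformingIn_restr (h.conformingIn K)) fun E' hE' e he K₁ h₁ K₂ h₂ _ => ?_
  have hne : E' ≠ E := fun h => hE' (h ▸ hE)
  have key : ∀ K' ∈ M.eltsAt E', sideFlux K' e (restr K φ) = 0 := by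
    intro K' hK'
    rw [sideFlux_restr]
    split_ifs with hKK
    · subst hKK
      rw [h.sideFlux_eq (mem_eltsAt.1 hK') he, if_neg hne]
    · rfl
  rw [key K₁ h₁, key K₂ h₂, add_zero]

namespace Basis

variable (B : Basis M κ ρ)

/-- The normal component of a snapshot eigenfunction on its edge. -/
def trace (E : M.Edge) (j : Fin (M.dimEdge E)) : Finset Plane → ℝ :=
  compOn (B.second E j) (B.normal E)

lemma second_spec (E : M.Edge) (j : Fin (M.dimEdge E)) :
    IsLocalSolution κ E (B.normal E) (B.trace E j) (fun _ => 0) (B.second E j) ∧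
      ∑ e ∈ M.edgesIn E, len e * B.trace E j e = 0 := by
  obtain ⟨δ, hδ, h⟩ := B.second_mem E j
  -- On `E` the average `compOn` of the values from the adjacent triangles is the prescribed datum.
  have htr : ∀ e ∈ M.edgesIn E, B.trace E j e = δ e := by
    intro e he
    refine avg_eq (trisAt_nonempty (mem_edgesIn.1 he).1) fun τ hτ => ?_
    obtain ⟨K, hK⟩ := exists_elt τ
    exact h.trace K (mem_eltsAt.2 (edge_subset_elt hK (mem_trisAt.1 hτ) he)) τ hK e he
      (mem_trisAt.1 hτ)
  refine ⟨⟨h.supp, h.conforming, h.eqs, ?_, h.trace_zero⟩, ?_⟩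
  · intro K hK τ hτ e he heτ
    rw [htr e he]
    exact h.trace K hK τ hτ e he heτ
  · rw [← hδ]
    exact Finset.sum_congr rfl fun e he => by rw [htr e he]

lemma sideFlux_first {K : M.Elt} {E E' : M.Edge} (hE' : E'.1 ⊆ K.1) {e : Finset Plane}
    (he : e ∈ M.edgesIn E') :
    sideFlux K e (B.first E) = if E' = E then B.sgn K E else 0 := by
  rw [(B.first_spec E).sideFlux_eq hE' he, mul_one]

lemma sideFlux_second {K : M.Elt} {E E' : M.Edge} (hE' : E'.1 ⊆ K.1) {e : Finset Plane}
    (he : e ∈ M.edgesIn E') (j : Fin (M.dimEdge E)) :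
    sideFlux K e (B.second E j) = if E' = E then B.sgn K E * B.trace E j e else 0 :=
  (B.second_spec E j).1.sideFlux_eq hE' he

lemma trace_orthonormal (E : M.Edge) (i j : Fin (M.dimEdge E)) :
    ∑ e ∈ M.edgesIn E, len e * (B.trace E i e * B.trace E j e) = if i = j then 1 else 0 := by
  rw [← B.second_orthonormal E i j]
  symm
  refine avg_eq (eltsAt_nonempty E) fun K hK => ?_
  have hE := mem_eltsAt.1 hK
  rw [sideInner_eq hE]
  refine Finset.sum_congr rfl fun e he => ?_
  rw [B.sideFlux_second hE he, B.sideFlux_second hE he, if_pos rfl, if_pos rfl]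
  have := (B.sgn_spec hE).1
  linear_combination len e * (B.trace E i e * B.trace E j e) * this

/-- The fine edges on a coarse edge add up to its length, by the divergence theorem for the first
basis function. -/
lemma sum_len (B : Basis M κ ρ) (E : M.Edge) : ∑ e ∈ M.edgesIn E, len e = len E.1 := by
  obtain ⟨K, hK⟩ := eltsAt_nonempty E
  have hE := mem_eltsAt.1 hK
  have h := gauss_elt ((B.first_spec E).conformingIn K)
  have hs := (B.sgn_spec hE).1
  have hA : area K.1 ≠ 0 := (Elt.isTri K).area_pos.ne'
  rw [Finset.sum_congr rfl fun τ hτ => by rw [(B.first_spec E).dvg_eq hK hτ], ← Finset.sum_mul,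
    sum_area, Finset.sum_eq_single E] at h
  · rw [Finset.sum_congr rfl fun e he => by rw [B.sideFlux_first hE he, if_pos rfl],
      ← Finset.sum_mul] at h
    have h' : area K.1 * (B.sgn K E * (len E.1 / area K.1)) = B.sgn K E * len E.1 := by
      field_simp
    change area K.1 * (B.sgn K E * (len E.1 / area K.1)) = _ at h
    rw [h'] at h
    linear_combination (-(∑ e ∈ M.edgesIn E, len e) + len E.1) * hs - B.sgn K E * h
  · intro E' hE' hne
    refine Finset.sum_eq_zero fun e he => ?_
    rw [B.sideFlux_first (mem_edgesOf.1 hE') he, if_neg hne, mul_zero]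
  · exact fun h => absurd (mem_edgesOf.2 hE) h

lemma edge_len_pos (E : M.Edge) : 0 < len E.1 := len_pos (Edge.card E)

/-- Expansion of piecewise constant functions on `E`: the mean plus the components along the traces
of the eigenfunctions. -/
lemma edge_expansion (E : M.Edge) (u : Finset Plane → ℝ) : ∀ e ∈ M.edgesIn E,
    u e = (len E.1)⁻¹ * ∑ e ∈ M.edgesIn E, len e * u e +
      ∑ j, (∑ e ∈ M.edgesIn E, len e * (u e * B.trace E j e)) * B.trace E j e := by
  intro e he
  set m := (len E.1)⁻¹ * ∑ e ∈ M.edgesIn E, len e * u e with hm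
  have h := orthonormal_expansion (M.edgesIn E) (r := len) (a := len)
    (N := M.dimEdge E)
    (fun e he => len_pos (card_of_mem_edgesIn he)) rfl (B.trace E)
    (fun j => (B.second_spec E j).2) (B.trace_orthonormal E) (q := fun e => u e - m) ?_ e he
  · have h2 : ∀ j, ∑ e ∈ M.edgesIn E, len e * ((u e - m) * B.trace E j e) =
        ∑ e ∈ M.edgesIn E, len e * (u e * B.trace E j e) := by
      intro j
      have h3 := (B.second_spec E j).2
      have h4 : ∀ e, len e * ((u e - m) * B.trace E j e) =
          len e * (u e * B.trace E j e) - m * (len e * B.trace E j e) := fun e => by ring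
      simp only [h4]
      rw [Finset.sum_sub_distrib, ← Finset.mul_sum, h3, mul_zero, sub_zero]
    beta_reduce at h
    simp only [h2] at h
    linarith
  · simp only [mul_sub]
    rw [Finset.sum_sub_distrib, ← Finset.sum_mul, B.sum_len, hm,
      mul_inv_cancel_left₀ (edge_len_pos E).ne', sub_self]

/-- Expansion of mean-zero piecewise constant functions on `K` in the eigenfunctions. -/
lemma elt_expansion (K : M.Elt) {q : M.Tri → ℝ} (hq : ∑ τ ∈ M.trisIn K, area τ.1 * q τ = 0) :
    ∀ τ ∈ M.trisIn K, q τ = ∑ j, massQ ρ (const q) (const (B.thirdQ K j)) * B.thirdQ K j τ := by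
  intro τ hτ
  have horth : ∀ i j, ∑ τ ∈ M.trisIn K, wt ρ τ * (B.thirdQ K i τ * B.thirdQ K j τ) =
      if i = j then 1 else 0 := by
    intro i j
    rw [← massQ_const_of_supp ρ _ (B.third_eq K j).pres_supp]
    exact B.third_orthonormal K i j
  rw [orthonormal_expansion (M.trisIn K) (r := wt ρ) (a := fun τ => area τ.1)
    (fun τ _ => area_pos τ) rfl (B.thirdQ K) (fun j => (B.third_eq K j).pres_mean) horth hq τ hτ]
  exact Finset.sum_congr rfl fun j _ => by
    rw [massQ_const_of_supp ρ _ (B.third_eq K j).pres_supp]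

/-- The eigenfunctions of an element are orthogonal in the velocity norm as well. -/
lemma massV_third (K : M.Elt) (i j : Fin (M.dimElt K)) :
    massV κ (M.trisIn K) (B.thirdV K i) (B.thirdV K j) =
      if i = j then B.eigK K j else 0 := by
  have h1 := (B.third_eq K i).eq_v _ (B.third_eq K j).vel_mem
  have h2 := (B.third_eq K j).eq_p _ (B.third_eq K i).pres_supp (B.third_eq K i).pres_mean
  rw [B.third_orthonormal K j i] at h2
  rw [sub_eq_zero.1 h1, h2]
  by_cases h : i = j
  · subst h; simp
  · rw [if_neg h, if_neg (fun h' => h h'.symm), mul_zero]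

lemma divForm_third (K : M.Elt) (i j : Fin (M.dimElt K)) :
    divForm (M.trisIn K) (B.thirdQ K i) (B.thirdV K j) = if i = j then B.eigK K j else 0 := by
  rw [← B.massV_third K i j]
  exact (sub_eq_zero.1 ((B.third_eq K i).eq_v _ (B.third_eq K j).vel_mem)).symm

/-- Cauchy-Schwarz for `massV`. -/
lemma _root_.MixedGMsFEM.StaggeredMesh.massV_sq_le (hκ : Coeff M κ) (S : Finset M.Tri)
    (v w : M.Vel) : massV κ S v w ^ 2 ≤ massV κ S v v * massV κ S w w := by
  have h := (massVB hκ S).apply_mul_apply_le_of_forall_zero_le (massV_nonneg hκ S) v w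
  simp only [massVB_apply] at h
  rw [massV_comm κ S w v, ← sq] at h
  exact h

/-- The eigenvalues of an element are positive, because pressures of mean zero are controlled by
divergences. -/
lemma eigK_pos (hκ : Coeff M κ) (K : M.Elt) (j : Fin (M.dimElt K)) : 0 < B.eigK K j := by
  have h1 := B.massV_third K j j
  rw [if_pos rfl] at h1
  have h2 : 0 ≤ B.eigK K j := h1 ▸ massV_nonneg hκ _ _
  refine lt_of_le_of_ne h2 fun h0 => ?_
  rw [← h0] at h1
  -- If the eigenvalue is zero, then so is the velocity, and the pressure is orthogonal to all
  -- divergences; hence it is constant, and of mean zero, which contradicts the normalisation.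
  have hp : ∀ w, LocalV K w → divForm (M.trisIn K) (B.thirdQ K j) w = 0 := by
    intro w hw
    have h3 := massV_sq_le hκ (M.trisIn K) (B.thirdV K j) w
    rw [h1, zero_mul] at h3
    have h4 : massV κ (M.trisIn K) (B.thirdV K j) w = 0 :=
      pow_eq_zero_iff two_ne_zero |>.1 (le_antisymm h3 (sq_nonneg _))
    have h5 := (B.third_eq K j).eq_v w hw
    linarith
  have hc := eq_of_divForm_eq_zero hp
  obtain ⟨τ₀, hτ₀⟩ := trisIn_nonempty K
  have hmean := (B.third_eq K j).pres_mean
  have hz : B.thirdQ K j τ₀ = 0 := by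
    rw [Finset.sum_congr rfl fun τ hτ => by rw [hc τ hτ τ₀ hτ₀], ← Finset.sum_mul, sum_area] at hmean
    exact (mul_eq_zero.1 hmean).resolve_left (Elt.isTri K).area_pos.ne'
  have hone := B.third_orthonormal K j j
  rw [if_pos rfl, massQ_const_of_supp ρ _ (B.third_eq K j).pres_supp,
    Finset.sum_eq_zero fun τ hτ => by rw [hc τ hτ τ₀ hτ₀, hz]; ring] at hone
  exact zero_ne_one hone

lemma massV_second (E : M.Edge) (i j : Fin (M.dimEdge E)) :
    B.eigE E i * massV κ (M.patch E) (B.second E i) (B.second E j) = if i = j then 1 else 0 := by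
  rw [← B.second_orthonormal E i j, B.second_eq E i _ (B.second_mem E j)]

lemma eigE_pos (hκ : Coeff M κ) (E : M.Edge) (j : Fin (M.dimEdge E)) : 0 < B.eigE E j := by
  have h := B.massV_second E j j
  rw [if_pos rfl] at h
  by_contra hneg
  have := mul_nonpos_of_nonpos_of_nonneg (not_lt.1 hneg)
    (massV_nonneg hκ (M.patch E) (B.second E j))
  linarith

/-- The snapshot eigenfunctions are orthogonal in the velocity norm as well. -/
lemma massV_second_eq (hκ : Coeff M κ) (E : M.Edge) (i j : Fin (M.dimEdge E)) :
    massV κ (M.patch E) (B.second E i) (B.second E j) =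
      if i = j then (B.eigE E j)⁻¹ else 0 := by
  have h := B.massV_second E i j
  have hpos := (B.eigE_pos hκ E i).ne'
  by_cases hij : i = j
  · subst hij
    rw [if_pos rfl] at h ⊢
    exact eq_inv_of_mul_eq_one_right h
  · rw [if_neg hij] at h ⊢
    exact (mul_eq_zero.1 h).resolve_left hpos

lemma coarseV_le_fineV (nE : M.Edge → ℕ) (mK : M.Elt → ℕ) : B.coarseV nE mK ≤ M.fineV := by
  refine Submodule.span_le.2 ?_
  rintro w ((((⟨E, _, rfl⟩ | ⟨E, hE, K, _, rfl⟩) | ⟨E, _, j, _, rfl⟩) | ⟨E, hE, K, _, j, _, rfl⟩) |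
    ⟨K, j, _, rfl⟩)
  · exact (B.first_spec E).mem_fineV
  · exact (B.first_spec E).restr_mem_fineV hE K
  · exact (B.second_spec E j).1.mem_fineV
  · exact (B.second_spec E j).1.restr_mem_fineV hE K
  · exact (B.third_eq K j).vel_mem.mem_fineV

lemma coarseQ_le_fineQhat (nE : M.Edge → ℕ) (mK : M.Elt → ℕ) : B.coarseQ nE mK ≤ M.fineQhat := by
  refine Submodule.span_le.2 ?_
  rintro q (((⟨K, rfl⟩ | ⟨K, j, _, rfl⟩) | ⟨E, hE, rfl⟩) | ⟨E, hE, j, _, rfl⟩)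
  · exact const_mem_fineQhat _
  · exact const_mem_fineQhat _
  · exact Submodule.mem_sup_right (edgePressure_mem_bubbleQ hE _)
  · exact Submodule.mem_sup_right (edgePressure_mem_bubbleQ hE _)

end Basis

namespace Basis

variable (B : Basis M κ ρ)

/-! ### Interpolants -/

/-- `sideInner` as a linear functional of its first argument. -/
def sideInnerL (K : M.Elt) (E : M.Edge) (w : M.Vel) : M.Vel →ₗ[ℝ] ℝ :=
  ∑ e ∈ M.edgesIn E, len e •
    ∑ τ ∈ (M.trisIn K).filter (fun τ => e ⊆ τ.1), flux w τ e • fluxL τ e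

lemma sideInnerL_apply (K : M.Elt) (E : M.Edge) (v w : M.Vel) :
    sideInnerL K E w v = sideInner K E v w := by
  simp [sideInnerL, sideInner, fluxL, mul_comm]

/-- The interpolation of velocities as a linear map. -/
def interpVL (nE : M.Edge → ℕ) (mK : M.Elt → ℕ) : M.Vel →ₗ[ℝ] M.Vel :=
  ∑ K : M.Elt, (
    (∑ E : M.Edge, if E.1 ⊆ K.1 then
      ((len E.1)⁻¹ • sideInnerL K E (B.first E)).smulRight (restr K (B.first E)) +
        ∑ j : Fin (M.dimEdge E), if j.1 < nE E then
          (sideInnerL K E (B.second E j)).smulRight (restr K (B.second E j)) else 0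
      else 0) +
    ∑ j : Fin (M.dimElt K), if j.1 < mK K then
      ((B.eigK K j)⁻¹ • divB (M.trisIn K) (B.thirdQ K j)).smulRight (B.thirdV K j) else 0)

/-- Evaluation commutes with a choice between a linear map and zero. -/
lemma ite_apply_zero {V W : Type*} [AddCommGroup V] [Module ℝ V] [AddCommGroup W] [Module ℝ W]
    (c : Prop) [Decidable c] (f : V →ₗ[ℝ] W) (v : V) :
    (if c then f else 0) v = if c then f v else 0 := by
  split_ifs <;> rfl

lemma interpVL_apply (nE : M.Edge → ℕ) (mK : M.Elt → ℕ) (v : M.Vel) :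
    B.interpVL nE mK v = B.interpV nE mK v := by
  simp only [interpVL, interpV, coefC0, coefC, coefD, LinearMap.sum_apply, LinearMap.add_apply,
    ite_apply_zero, LinearMap.smulRight_apply, LinearMap.smul_apply, sideInnerL_apply, divB_apply,
    smul_eq_mul]

/-- `coefA0` as a linear functional. -/
def coefA0L (_B : Basis M κ ρ) (K : M.Elt) : (M.Tri → ℝ) →ₗ[ℝ] ℝ :=
  (∑ τ ∈ M.trisIn K, area τ.1)⁻¹ • ∑ τ ∈ M.trisIn K, area τ.1 • LinearMap.proj τ

lemma coefA0L_apply (K : M.Elt) (p : M.Tri → ℝ) : B.coefA0L K p = B.coefA0 p K := by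
  simp [coefA0L, coefA0]

/-- `coefA` as a linear functional. -/
def coefAL (hρ : Coeff M ρ) (K : M.Elt) (j : Fin (M.dimElt K)) : (M.Tri → ℝ) →ₗ[ℝ] ℝ :=
  ((massQB hρ).flip (const (B.thirdQ K j))).comp
    (constL.comp (LinearMap.id - (B.coefA0L K).smulRight (1 : M.Tri → ℝ)))

lemma coefAL_apply (hρ : Coeff M ρ) (K : M.Elt) (j : Fin (M.dimElt K)) (p : M.Tri → ℝ) :
    B.coefAL hρ K j p = B.coefA p K j := by
  have : p - B.coefA0L K p • (1 : M.Tri → ℝ) = fun τ => p τ - B.coefA0 p K := by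
    funext τ; simp [coefA0L_apply]
  simp only [coefAL, LinearMap.comp_apply, LinearMap.sub_apply, LinearMap.id_apply,
    LinearMap.smulRight_apply, this]
  rfl

/-- The piecewise constant function `interpI`. -/
def valI (mK : M.Elt → ℕ) (p : M.Tri → ℝ) : M.Tri → ℝ :=
  ∑ K : M.Elt, ((fun τ => if τ ∈ M.trisIn K then B.coefA0 p K else 0) +
    ∑ j : Fin (M.dimElt K), if j.1 < mK K then B.coefA p K j • B.thirdQ K j else 0)

lemma interpI_eq (mK : M.Elt → ℕ) (p : M.Pres) :
    B.interpI mK p = const (B.valI mK (partI p)) := by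
  simp only [interpI, valI, ← constL_apply, map_sum, map_add]
  refine Finset.sum_congr rfl fun K _ => ?_
  congr 1
  refine Finset.sum_congr rfl fun j _ => ?_
  split_ifs
  · rw [map_smul]
  · rw [map_zero]

/-- The interpolation of piecewise constant functions as a linear map. -/
def valIL (hρ : Coeff M ρ) (mK : M.Elt → ℕ) : (M.Tri → ℝ) →ₗ[ℝ] (M.Tri → ℝ) :=
  ∑ K : M.Elt, ((B.coefA0L K).smulRight (fun τ => if τ ∈ M.trisIn K then (1 : ℝ) else 0) +
    ∑ j : Fin (M.dimElt K), if j.1 < mK K then (B.coefAL hρ K j).smulRight (B.thirdQ K j) else 0)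

lemma valIL_apply (hρ : Coeff M ρ) (mK : M.Elt → ℕ) (p : M.Tri → ℝ) :
    B.valIL hρ mK p = B.valI mK p := by
  simp only [valIL, valI, LinearMap.sum_apply, LinearMap.add_apply, ite_apply_zero,
    LinearMap.smulRight_apply, coefAL_apply, coefA0L_apply]
  refine Finset.sum_congr rfl fun K _ => ?_
  congr 1
  funext τ
  simp

/-- The interpolation of functions of `bubbleQ` as a linear map. -/
def interpBL (nE : M.Edge → ℕ) : M.Pres →ₗ[ℝ] M.Pres :=
  ∑ E : M.Edge, if M.IsDecoupled E then
    ((len E.1)⁻¹ • ∑ e ∈ M.edgesIn E, len e • (presOnL e).comp partBL).smulRight (B.edgeQ1 E) +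
      ∑ j : Fin (M.dimEdge E), if j.1 < nE E then
        (∑ e ∈ M.edgesIn E, len e • B.trace E j e • (presOnL e).comp partBL).smulRight
          (B.edgeQ2 E j) else 0
  else 0

lemma interpBL_apply (nE : M.Edge → ℕ) (p : M.Pres) :
    B.interpBL nE p = B.interpB nE p := by
  simp only [interpBL, interpB, coefB0, coefB, LinearMap.sum_apply, LinearMap.add_apply,
    ite_apply_zero, LinearMap.smulRight_apply, LinearMap.smul_apply, LinearMap.comp_apply,
    presOnL_apply, partBL_apply, smul_eq_mul, mul_comm (B.trace _ _ _)]
  rfl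

/-- The interpolation of pressures as a linear map. -/
def interpQL (hρ : Coeff M ρ) (nE : M.Edge → ℕ) (mK : M.Elt → ℕ) : M.Pres →ₗ[ℝ] M.Pres :=
  constL.comp ((B.valIL hρ mK).comp partIL) + B.interpBL nE

lemma interpQL_apply (hρ : Coeff M ρ) (nE : M.Edge → ℕ) (mK : M.Elt → ℕ) (p : M.Pres) :
    B.interpQL hρ nE mK p = B.interpI mK p + B.interpB nE p := by
  rw [interpQL, LinearMap.add_apply, LinearMap.comp_apply, LinearMap.comp_apply, interpBL_apply,
    valIL_apply, interpI_eq]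
  rfl

lemma interpB_mem_bubbleQ (nE : M.Edge → ℕ) (p : M.Pres) : B.interpB nE p ∈ M.bubbleQ := by
  refine Submodule.sum_mem _ fun E _ => ?_
  split_ifs with hE
  · refine Submodule.add_mem _ (Submodule.smul_mem _ _ (edgePressure_mem_bubbleQ hE _))
      (Submodule.sum_mem _ fun j _ => ?_)
    split_ifs
    · exact Submodule.smul_mem _ _ (edgePressure_mem_bubbleQ hE _)
    · exact Submodule.zero_mem _
  · exact Submodule.zero_mem _

lemma partI_interp (nE : M.Edge → ℕ) (mK : M.Elt → ℕ) (p : M.Pres) :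
    partI (B.interpI mK p + B.interpB nE p) = B.valI mK (partI p) := by
  rw [← partIL_apply, map_add, partIL_apply, partIL_apply, interpI_eq, partI_const,
    partI_of_mem_bubbleQ (B.interpB_mem_bubbleQ nE p), add_zero]

lemma partB_interp (nE : M.Edge → ℕ) (mK : M.Elt → ℕ) (p : M.Pres) :
    partB (B.interpI mK p + B.interpB nE p) = B.interpB nE p := by
  rw [← partBL_apply, map_add, partBL_apply, partBL_apply, interpI_eq, partB_const,
    partB_of_mem_bubbleQ (B.interpB_mem_bubbleQ nE p), zero_add]

/-! ### Values of the interpolants -/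

lemma valI_apply (mK : M.Elt → ℕ) (p : M.Tri → ℝ) {K : M.Elt} {τ : M.Tri}
    (hτ : τ ∈ M.trisIn K) :
    B.valI mK p τ = B.coefA0 p K +
      ∑ j : Fin (M.dimElt K), if j.1 < mK K then B.coefA p K j * B.thirdQ K j τ else 0 := by
  rw [valI, Finset.sum_apply, Finset.sum_eq_single K]
  · rw [Pi.add_apply, if_pos hτ, Finset.sum_apply]
    congr 1
    refine Finset.sum_congr rfl fun j _ => ?_
    split_ifs <;> simp
  · intro K' _ hne
    have hn : τ ∉ M.trisIn K' := fun h => hne (elt_unique h hτ)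
    rw [Pi.add_apply, if_neg hn, Finset.sum_apply, zero_add]
    refine Finset.sum_eq_zero fun j _ => ?_
    split_ifs
    · simp [(B.third_eq K' j).pres_supp τ hn]
    · rfl
  · exact fun h => absurd (Finset.mem_univ _) h

/-- The components of the interpolation error of a piecewise constant function: it has mean zero,
and its components along the selected eigenfunctions vanish. -/
lemma valI_error (mK : M.Elt → ℕ) (p : M.Tri → ℝ) (K : M.Elt) :
    ∑ τ ∈ M.trisIn K, area τ.1 * (p τ - B.valI mK p τ) = 0 ∧
    ∀ j, massQ ρ (const (p - B.valI mK p)) (const (B.thirdQ K j)) =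
      if j.1 < mK K then 0 else B.coefA p K j := by
  have hA : ∑ τ ∈ M.trisIn K, area τ.1 ≠ 0 := by
    rw [sum_area]; exact (Elt.isTri K).area_pos.ne'
  constructor
  · have h1 : ∀ τ ∈ M.trisIn K, area τ.1 * (p τ - B.valI mK p τ) =
        area τ.1 * p τ - area τ.1 * B.coefA0 p K -
          ∑ j : Fin (M.dimElt K), (if j.1 < mK K then B.coefA p K j else 0) *
            (area τ.1 * B.thirdQ K j τ) := by
      intro τ hτ
      rw [B.valI_apply mK p hτ, mul_sub, mul_add, Finset.mul_sum, ← sub_sub]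
      congr 1
      refine Finset.sum_congr rfl fun j _ => ?_
      split_ifs <;> ring
    rw [Finset.sum_congr rfl h1, Finset.sum_sub_distrib, Finset.sum_sub_distrib, ← Finset.sum_mul,
      Finset.sum_comm]
    simp only [← Finset.mul_sum]
    rw [Finset.sum_eq_zero (s := (Finset.univ : Finset (Fin (M.dimElt K)))) fun j _ => by
        rw [(B.third_eq K j).pres_mean, mul_zero], coefA0,
      mul_inv_cancel_left₀ hA, sub_self, sub_zero]
  · intro j
    have hsupp := (B.third_eq K j).pres_supp
    -- By orthonormality, subtracting the truncated expansion removes exactly the selected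
    -- components.
    have h1 : ∀ τ ∈ M.trisIn K, wt ρ τ * ((p - B.valI mK p) τ * B.thirdQ K j τ) =
        wt ρ τ * ((p τ - B.coefA0 p K) * B.thirdQ K j τ) -
          ∑ i : Fin (M.dimElt K), (if i.1 < mK K then B.coefA p K i else 0) *
            (wt ρ τ * (B.thirdQ K i τ * B.thirdQ K j τ)) := by
      intro τ hτ
      rw [Pi.sub_apply, B.valI_apply mK p hτ]
      have : ∀ i : Fin (M.dimElt K), (if i.1 < mK K then B.coefA p K i else 0) *
            (wt ρ τ * (B.thirdQ K i τ * B.thirdQ K j τ)) =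
          (wt ρ τ * B.thirdQ K j τ) *
            (if i.1 < mK K then B.coefA p K i * B.thirdQ K i τ else 0) := by
        intro i
        split_ifs <;> ring
      simp only [this, ← Finset.mul_sum]
      ring
    rw [massQ_const_of_supp ρ _ hsupp, Finset.sum_congr rfl h1, Finset.sum_sub_distrib,
      Finset.sum_comm, ← massQ_const_of_supp ρ _ hsupp]
    simp only [← Finset.mul_sum, ← massQ_const_of_supp ρ _ hsupp, B.third_orthonormal]
    simp only [mul_ite, mul_one, mul_zero, Finset.sum_ite_eq', Finset.mem_univ, if_true]
    change B.coefA p K j - _ = _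
    split_ifs <;> ring

lemma presOn_interpB (nE : M.Edge → ℕ) (p : M.Pres) {E : M.Edge} (hE : M.IsDecoupled E)
    {e : Finset Plane} (he : e ∈ M.edgesIn E) :
    presOn (B.interpB nE p) e = B.coefB0 p E +
      ∑ j : Fin (M.dimEdge E), if j.1 < nE E then B.coefB p E j * B.trace E j e else 0 := by
  rw [← presOnL_apply, interpB, map_sum, Finset.sum_eq_single E]
  · rw [if_pos hE, map_add, map_smul, presOnL_apply, edgeQ1, presOn_edgePressure _ he, smul_eq_mul,
      mul_one, map_sum]
    congr 1
    refine Finset.sum_congr rfl fun j _ => ?_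
    split_ifs
    · rw [map_smul, presOnL_apply, edgeQ2, presOn_edgePressure _ he, smul_eq_mul]
      rfl
    · rw [map_zero]
  · intro E' _ hne
    split_ifs with hE'
    · rw [map_add, map_smul, presOnL_apply, edgeQ1,
        presOn_edgePressure_other hE' hE hne.symm _ he, smul_zero, zero_add, map_sum]
      refine Finset.sum_eq_zero fun j _ => ?_
      split_ifs
      · rw [map_smul, presOnL_apply, edgeQ2, presOn_edgePressure_other hE' hE hne.symm _ he,
          smul_zero]
      · rw [map_zero]
    · rw [map_zero]
  · exact fun h => absurd (Finset.mem_univ _) h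

/-- Truncated expansions on an edge: the remainder consists of the discarded components. -/
lemma edge_remainder (E : M.Edge) (n : ℕ) (u : Finset Plane → ℝ) {e : Finset Plane}
    (he : e ∈ M.edgesIn E) :
    u e - ((len E.1)⁻¹ * ∑ e ∈ M.edgesIn E, len e * u e +
      ∑ j : Fin (M.dimEdge E), if j.1 < n then
        (∑ e ∈ M.edgesIn E, len e * (u e * B.trace E j e)) * B.trace E j e else 0) =
    ∑ j : Fin (M.dimEdge E), (if j.1 < n then 0 else
        ∑ e ∈ M.edgesIn E, len e * (u e * B.trace E j e)) * B.trace E j e := by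
  have h := B.edge_expansion E u e he
  have h2 : ∑ j : Fin (M.dimEdge E),
        (∑ e ∈ M.edgesIn E, len e * (u e * B.trace E j e)) * B.trace E j e =
      ∑ j : Fin (M.dimEdge E), (if j.1 < n then
        (∑ e ∈ M.edgesIn E, len e * (u e * B.trace E j e)) * B.trace E j e else 0) +
      ∑ j : Fin (M.dimEdge E), (if j.1 < n then 0 else
        ∑ e ∈ M.edgesIn E, len e * (u e * B.trace E j e)) * B.trace E j e := by
    rw [← Finset.sum_add_distrib]
    refine Finset.sum_congr rfl fun j _ => ?_
    split_ifs <;> ring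
  rw [h2] at h
  linarith

lemma presOn_error (nE : M.Edge → ℕ) (p : M.Pres) {E : M.Edge} (hE : M.IsDecoupled E)
    {e : Finset Plane} (he : e ∈ M.edgesIn E) :
    presOn (partB p - B.interpB nE p) e =
      ∑ j : Fin (M.dimEdge E), (if j.1 < nE E then 0 else B.coefB p E j) * B.trace E j e := by
  rw [← presOnL_apply, map_sub, presOnL_apply, presOnL_apply, B.presOn_interpB nE p hE he]
  exact B.edge_remainder E (nE E) (presOn (partB p)) he

/-- Mean values and selected components of the remainder of a truncated expansion vanish. -/
lemma remainder_orthogonal (E : M.Edge) (c : Fin (M.dimEdge E) → ℝ) :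
    ∑ e ∈ M.edgesIn E, len e * ∑ j, c j * B.trace E j e = 0 ∧
    ∀ k, ∑ e ∈ M.edgesIn E, len e * ((∑ j, c j * B.trace E j e) * B.trace E k e) = c k := by
  constructor
  · simp only [Finset.mul_sum]
    rw [Finset.sum_comm]
    refine Finset.sum_eq_zero fun j _ => ?_
    rw [Finset.sum_congr rfl fun e _ => by rw [mul_left_comm], ← Finset.mul_sum,
      (B.second_spec E j).2, mul_zero]
  · intro k
    have : ∀ e, len e * ((∑ j, c j * B.trace E j e) * B.trace E k e) =
        ∑ j, c j * (len e * (B.trace E j e * B.trace E k e)) := by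
      intro e
      rw [Finset.sum_mul, Finset.mul_sum]
      exact Finset.sum_congr rfl fun j _ => by ring
    simp only [this]
    rw [Finset.sum_comm]
    simp only [← Finset.mul_sum, B.trace_orthonormal]
    simp

/-- The component of the outward normal component of `v` from the side of `K` along a trace. -/
def sideCoef (v : M.Vel) (K : M.Elt) (E : M.Edge) (j : Fin (M.dimEdge E)) : ℝ :=
  ∑ e ∈ M.edgesIn E, len e * (sideFlux K e v * B.trace E j e)

lemma coefC_eq (v : M.Vel) {K : M.Elt} {E : M.Edge} (hE : E.1 ⊆ K.1) (j : Fin (M.dimEdge E)) :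
    B.coefC v K E j = B.sgn K E * B.sideCoef v K E j := by
  rw [coefC, sideInner_eq hE, sideCoef, Finset.mul_sum]
  refine Finset.sum_congr rfl fun e he => ?_
  rw [B.sideFlux_second hE he, if_pos rfl]
  ring

lemma coefC0_eq (v : M.Vel) {K : M.Elt} {E : M.Edge} (hE : E.1 ⊆ K.1) :
    B.coefC0 v K E = B.sgn K E * ((len E.1)⁻¹ * ∑ e ∈ M.edgesIn E, len e * sideFlux K e v) := by
  rw [coefC0, sideInner_eq hE, Finset.mul_sum, Finset.mul_sum, Finset.mul_sum]
  refine Finset.sum_congr rfl fun e he => ?_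
  rw [B.sideFlux_first hE he, if_pos rfl]
  ring

/-- The interpolant of `v` on `K`, before restriction. -/
def localV (nE : M.Edge → ℕ) (mK : M.Elt → ℕ) (v : M.Vel) (K : M.Elt) : M.Vel :=
  ∑ E ∈ M.edgesOf K, (B.coefC0 v K E • B.first E +
    ∑ j : Fin (M.dimEdge E), if j.1 < nE E then B.coefC v K E j • B.second E j else 0) +
  ∑ j : Fin (M.dimElt K), if j.1 < mK K then B.coefD v K j • B.thirdV K j else 0

/-- On `K`, the global interpolant is the local one. -/
lemma interpV_apply (nE : M.Edge → ℕ) (mK : M.Elt → ℕ) (v : M.Vel) {K : M.Elt} {τ : M.Tri}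
    (hτ : τ ∈ M.trisIn K) : B.interpV nE mK v τ = B.localV nE mK v K τ := by
  rw [interpV, Finset.sum_apply, Finset.sum_eq_single K]
  · rw [localV, Pi.add_apply, Pi.add_apply, ← Finset.sum_filter]
    congr 1
    rw [Finset.sum_apply, Finset.sum_apply]
    refine Finset.sum_congr rfl fun E _ => ?_
    rw [Pi.add_apply, Pi.add_apply, Pi.smul_apply, Pi.smul_apply, restr_of_mem hτ,
      Finset.sum_apply, Finset.sum_apply]
    congr 1
    refine Finset.sum_congr rfl fun j _ => ?_
    split_ifs
    · rw [Pi.smul_apply, Pi.smul_apply, restr_of_mem hτ]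
    · rfl
  · intro K' _ hne
    have hn : τ ∉ M.trisIn K' := fun h => hne (elt_unique h hτ)
    rw [Pi.add_apply, Finset.sum_apply, Finset.sum_apply]
    rw [Finset.sum_eq_zero, Finset.sum_eq_zero, add_zero]
    · intro j _
      split_ifs
      · rw [Pi.smul_apply, (B.third_eq K' j).vel_mem.1 τ hn, smul_zero]
      · rfl
    · intro E _
      split_ifs
      · rw [Pi.add_apply, Pi.smul_apply, restr_of_notMem hn, smul_zero, zero_add,
          Finset.sum_apply]
        refine Finset.sum_eq_zero fun j _ => ?_
        split_ifs
        · rw [Pi.smul_apply, restr_of_notMem hn, smul_zero]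
        · rfl
      · rfl
  · exact fun h => absurd (Finset.mem_univ _) h

/-- A subspace that contains all basis functions contains the local interpolants. -/
lemma localV_mem (nE : M.Edge → ℕ) (mK : M.Elt → ℕ) (v : M.Vel) (K : M.Elt)
    (S : Submodule ℝ M.Vel) (h1 : ∀ E, B.first E ∈ S) (h2 : ∀ E j, B.second E j ∈ S)
    (h3 : ∀ j, B.thirdV K j ∈ S) : B.localV nE mK v K ∈ S := by
  refine S.add_mem (S.sum_mem fun E _ => S.add_mem (S.smul_mem _ (h1 E)) (S.sum_mem fun j _ => ?_))
    (S.sum_mem fun j _ => ?_)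
  · split_ifs
    · exact S.smul_mem _ (h2 E j)
    · exact S.zero_mem
  · split_ifs
    · exact S.smul_mem _ (h3 j)
    · exact S.zero_mem

lemma conformingIn_interpV (nE : M.Edge → ℕ) (mK : M.Elt → ℕ) (v : M.Vel) (K : M.Elt) :
    B.interpV nE mK v ∈ confSub K :=
  confSub_congr (fun _ hτ => (B.interpV_apply nE mK v hτ).symm)
    (B.localV_mem nE mK v K (confSub K) (fun E => (B.first_spec E).conformingIn K)
      (fun E j => (B.second_spec E j).1.conformingIn K)
      (fun j => (B.third_eq K j).vel_mem.conforming K))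

lemma interpV_mem_potentialSub (hκ : Coeff M κ) (nE : M.Edge → ℕ) (mK : M.Elt → ℕ) (v : M.Vel)
    (K : M.Elt) : B.interpV nE mK v ∈ potentialSub hκ K :=
  potentialSub_congr hκ (fun _ hτ => (B.interpV_apply nE mK v hτ).symm)
    (B.localV_mem nE mK v K (potentialSub hκ K) (fun E => (B.first_spec E).mem_potentialSub hκ K)
      (fun E j => (B.second_spec E j).1.mem_potentialSub hκ K)
      (fun j => ⟨B.thirdQ K j, fun w hw => sub_eq_zero.1 ((B.third_eq K j).eq_v w hw)⟩))

/-- The normal component of the interpolation error on an edge of `K` consists of the discarded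
components. -/
lemma sideFlux_error (nE : M.Edge → ℕ) (mK : M.Elt → ℕ) (v : M.Vel) {K : M.Elt} {E : M.Edge}
    (hE : E.1 ⊆ K.1) {e : Finset Plane} (he : e ∈ M.edgesIn E) :
    sideFlux K e (v - B.interpV nE mK v) =
      ∑ j : Fin (M.dimEdge E), (if j.1 < nE E then 0 else B.sideCoef v K E j) * B.trace E j e := by
  -- On `E`, only the basis functions of `E` have a nonzero normal component, and the sign of the
  -- fixed normal enters twice.
  have h1 : sideFlux K e (B.interpV nE mK v) =
      (len E.1)⁻¹ * ∑ e ∈ M.edgesIn E, len e * sideFlux K e v +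
      ∑ j : Fin (M.dimEdge E), if j.1 < nE E then B.sideCoef v K E j * B.trace E j e else 0 := by
    have hs := (B.sgn_spec hE).1
    rw [sideFlux_congr (fun _ hτ => B.interpV_apply nE mK v hτ), localV, map_add, map_sum, map_sum,
      Finset.sum_eq_zero (s := Finset.univ), add_zero, Finset.sum_eq_single E]
    · rw [map_add, map_smul, B.sideFlux_first hE he, if_pos rfl, map_sum, B.coefC0_eq v hE,
        smul_eq_mul]
      congr 1
      · linear_combination ((len E.1)⁻¹ * ∑ e ∈ M.edgesIn E, len e * sideFlux K e v) * hs
      · refine Finset.sum_congr rfl fun j _ => ?_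
        split_ifs
        · rw [map_smul, B.sideFlux_second hE he, if_pos rfl, B.coefC_eq v hE, smul_eq_mul]
          linear_combination (B.sideCoef v K E j * B.trace E j e) * hs
        · rw [map_zero]
    · intro E' _ hne
      rw [map_add, map_smul, B.sideFlux_first hE he, if_neg hne.symm, smul_zero, zero_add, map_sum]
      refine Finset.sum_eq_zero fun j _ => ?_
      split_ifs
      · rw [map_smul, B.sideFlux_second hE he, if_neg hne.symm, smul_zero]
      · rw [map_zero]
    · exact fun h => absurd (mem_edgesOf.2 hE) h
    · intro j _
      split_ifs
      · rw [map_smul, (B.third_eq K j).vel_mem.sideFlux_eq_zero hE he, smul_zero]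
      · rw [map_zero]
  rw [map_sub, h1]
  exact B.edge_remainder E (nE E) (fun e => sideFlux K e v) he

/-- The components of the divergence of the interpolation error along the pressure
eigenfunctions. -/
lemma divForm_error (hκ : Coeff M κ) (nE : M.Edge → ℕ) (mK : M.Elt → ℕ) (v : M.Vel) (K : M.Elt)
    (j : Fin (M.dimElt K)) :
    divForm (M.trisIn K) (B.thirdQ K j) (v - B.interpV nE mK v) =
      if j.1 < mK K then 0 else divForm (M.trisIn K) (B.thirdQ K j) v := by
  have hmean := (B.third_eq K j).pres_mean
  -- Local solutions have constant divergence on `K`, so only the eigenfunctions of `K` contribute.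
  have h1 : divForm (M.trisIn K) (B.thirdQ K j) (B.interpV nE mK v) =
      if j.1 < mK K then divForm (M.trisIn K) (B.thirdQ K j) v else 0 := by
    rw [divForm_congr (fun _ _ => rfl) (fun _ hτ => B.interpV_apply nE mK v hτ), localV,
      ← divB_apply, map_add, map_sum, map_sum, Finset.sum_eq_zero (s := M.edgesOf K), zero_add,
      Finset.sum_eq_single j]
    · split_ifs
      · rw [map_smul, divB_apply, B.divForm_third, if_pos rfl, coefD, smul_eq_mul]
        have := (B.eigK_pos hκ K j).ne'
        field_simp
      · rw [map_zero]
    · intro i _ hij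
      split_ifs
      · rw [map_smul, divB_apply, B.divForm_third, if_neg hij.symm, smul_zero]
      · rw [map_zero]
    · exact fun h => absurd (Finset.mem_univ _) h
    · intro E _
      rw [map_add, map_smul, divB_apply, (B.first_spec E).divForm_eq_zero hmean, smul_zero,
        zero_add, map_sum]
      refine Finset.sum_eq_zero fun i _ => ?_
      split_ifs
      · rw [map_smul, divB_apply, (B.second_spec E i).1.divForm_eq_zero hmean, smul_zero]
      · rw [map_zero]
  rw [← divB_apply, map_sub, divB_apply, divB_apply, h1]
  split_ifs <;> ring

end Basis

/-! ### Galerkin orthogonality of the interpolants -/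

namespace Basis

variable (B : Basis M κ ρ)

lemma divForm_univ_local {E : M.Edge} {ν : Plane} {g : Finset Plane → ℝ} {c : M.Elt → ℝ}
    {φ : M.Vel} (h : IsLocalSolution κ E ν g c φ) {q : M.Tri → ℝ}
    (hq : ∀ K : M.Elt, ∑ τ ∈ M.trisIn K, area τ.1 * q τ = 0) :
    divForm Finset.univ q φ = 0 := by
  rw [divForm_univ]
  exact Finset.sum_eq_zero fun K _ => h.divForm_eq_zero (hq K)

lemma divForm_univ_restr {E : M.Edge} {ν : Plane} {g : Finset Plane → ℝ} {c : M.Elt → ℝ}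
    {φ : M.Vel} (h : IsLocalSolution κ E ν g c φ) {q : M.Tri → ℝ}
    (hq : ∀ K : M.Elt, ∑ τ ∈ M.trisIn K, area τ.1 * q τ = 0) (K : M.Elt) :
    divForm Finset.univ q (restr K φ) = 0 := by
  rw [divForm_univ_of_supp q _ fun τ hτ => restr_of_notMem hτ φ,
    divForm_congr (fun _ _ => rfl) fun τ hτ => restr_of_mem hτ φ]
  exact h.divForm_eq_zero (hq K)

lemma jumpForm_local {E : M.Edge} {g : Finset Plane → ℝ} {c : M.Elt → ℝ}
    {φ : M.Vel} (h : IsLocalSolution κ E (B.normal E) g c φ) (hE : ¬ M.IsDecoupled E)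
    (q : M.Pres) : jumpForm q φ = 0 := by
  rw [jumpForm_eq]
  refine Finset.sum_eq_zero fun E' hE' => Finset.sum_eq_zero fun K hK =>
    Finset.sum_eq_zero fun e he => ?_
  have hne : E' ≠ E := fun h => hE (h ▸ mem_decoupledEdges.1 hE')
  rw [h.sideFlux_eq (mem_eltsAt.1 hK) he, if_neg hne, mul_zero, mul_zero]

lemma jumpForm_restr {E : M.Edge} {g : Finset Plane → ℝ} {c : M.Elt → ℝ}
    {φ : M.Vel} (h : IsLocalSolution κ E (B.normal E) g c φ) (hE : M.IsDecoupled E)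
    {K : M.Elt} (hK : K ∈ M.eltsAt E) (q : M.Pres) :
    jumpForm q (restr K φ) =
      B.sgn K E * ∑ e ∈ M.edgesIn E, len e * (presOn (partB q) e * g e) := by
  rw [jumpForm_eq, Finset.sum_eq_single E, Finset.sum_eq_single K, Finset.mul_sum]
  · refine Finset.sum_congr rfl fun e he => ?_
    rw [sideFlux_restr, if_pos rfl, h.sideFlux_eq (mem_eltsAt.1 hK) he, if_pos rfl]
    ring
  · intro K' _ hne
    refine Finset.sum_eq_zero fun e _ => ?_
    rw [sideFlux_restr, if_neg hne, mul_zero, mul_zero]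
  · exact fun h => absurd hK h
  · intro E' _ hne
    refine Finset.sum_eq_zero fun K' hK' => Finset.sum_eq_zero fun e he => ?_
    rw [sideFlux_restr]
    split_ifs with hKK
    · subst hKK
      rw [h.sideFlux_eq (mem_eltsAt.1 hK') he, if_neg hne, mul_zero, mul_zero]
    · rw [mul_zero, mul_zero]
  · exact fun h => absurd (mem_decoupledEdges.2 hE) h

/-- The divergence of a velocity eigenfunction against a function of mean zero on `K`. -/
lemma divForm_thirdV (K : M.Elt) (j : Fin (M.dimElt K)) {q : M.Tri → ℝ}
    (hq : ∑ τ ∈ M.trisIn K, area τ.1 * q τ = 0) :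
    divForm (M.trisIn K) q (B.thirdV K j) =
      B.eigK K j * massQ ρ (const q) (const (B.thirdQ K j)) := by
  set q' : M.Tri → ℝ := fun τ => if τ ∈ M.trisIn K then q τ else 0 with hq'
  have hqq : ∀ τ ∈ M.trisIn K, q' τ = q τ := fun τ hτ => if_pos hτ
  have h := (B.third_eq K j).eq_p q' (fun τ hτ => if_neg hτ)
    (by rw [← hq]; exact Finset.sum_congr rfl fun τ hτ => by rw [hqq τ hτ])
  rw [divForm_congr (fun τ hτ => (hqq τ hτ).symm) fun _ _ => rfl, h, massQ_comm,
    massQ_const_of_supp ρ _ (B.third_eq K j).pres_supp,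
    massQ_const_of_supp ρ _ (B.third_eq K j).pres_supp]
  congr 1
  exact Finset.sum_congr rfl fun τ hτ => by rw [hqq τ hτ]

/-- The pressure interpolation error is not seen by the divergences and jumps of the multiscale
velocities. -/
lemma coupling_pres_error (nE : M.Edge → ℕ) (mK : M.Elt → ℕ) (p : M.Pres) {w : M.Vel}
    (hw : w ∈ B.coarseV nE mK) :
    coupling (p - (B.interpI mK p + B.interpB nE p)) w = 0 := by
  set q := p - (B.interpI mK p + B.interpB nE p) with hq
  have hI : partI q = partI p - B.valI mK (partI p) := by
    rw [hq, ← partIL_apply, map_sub, partIL_apply, partIL_apply, B.partI_interp]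
  have hB : partB q = partB p - B.interpB nE p := by
    rw [hq, ← partBL_apply, map_sub, partBL_apply, partBL_apply, B.partB_interp]
  have hmean : ∀ K : M.Elt, ∑ τ ∈ M.trisIn K, area τ.1 * partI q τ = 0 := by
    intro K
    rw [hI]
    exact (B.valI_error mK (partI p) K).1
  -- On decoupled edges the error has only discarded components.
  have hpres : ∀ E, M.IsDecoupled E → ∀ e ∈ M.edgesIn E, presOn (partB q) e =
      ∑ j : Fin (M.dimEdge E), (if j.1 < nE E then 0 else B.coefB p E j) * B.trace E j e := by
    intro E hE e he
    rw [hB]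
    exact B.presOn_error nE p hE he
  have hgen : ∀ E, M.IsDecoupled E → ∀ g : Finset Plane → ℝ,
      ∑ e ∈ M.edgesIn E, len e * (presOn (partB q) e * g e) =
      ∑ e ∈ M.edgesIn E, len e * ((∑ j : Fin (M.dimEdge E),
        (if j.1 < nE E then 0 else B.coefB p E j) * B.trace E j e) * g e) := by
    intro E hE g
    exact Finset.sum_congr rfl fun e he => by rw [hpres E hE e he]
  rw [← LinearMap.mem_ker]
  refine Submodule.span_le (p := LinearMap.ker (coupling q)).2 ?_ hw
  -- Local solutions have constant divergence on each element and see only the jump form, and that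
  -- only after restriction at a decoupled edge; the eigenfunctions of an element see only the
  -- divergence form.
  rintro w ((((⟨E, hE, rfl⟩ | ⟨E, hE, K, hK, rfl⟩) | ⟨E, hE, j, _, rfl⟩) |
    ⟨E, hE, K, hK, j, hj, rfl⟩) | ⟨K, j, hj, rfl⟩) <;>
    rw [SetLike.mem_coe, LinearMap.mem_ker, coupling_apply]
  · rw [divForm_univ_local (B.first_spec E) hmean, B.jumpForm_local (B.first_spec E) hE, sub_zero]
  · rw [divForm_univ_restr (B.first_spec E) hmean, B.jumpForm_restr (B.first_spec E) hE hK,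
      hgen E hE]
    simp only [mul_one]
    rw [(B.remainder_orthogonal E _).1, mul_zero, sub_zero]
  · rw [divForm_univ_local (B.second_spec E j).1 hmean,
      B.jumpForm_local (B.second_spec E j).1 hE, sub_zero]
  · rw [divForm_univ_restr (B.second_spec E j).1 hmean,
      B.jumpForm_restr (B.second_spec E j).1 hE hK, hgen E hE,
      (B.remainder_orthogonal E _).2, if_pos hj, mul_zero, sub_zero]
  · have hv := (B.third_eq K j).vel_mem
    rw [hv.jumpForm_eq_zero, sub_zero, divForm_univ_of_supp _ _ hv.1,
      B.divForm_thirdV K j (hmean K), hI, (B.valI_error mK (partI p) K).2, if_pos hj, mul_zero]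

/-- The velocity interpolation error is not seen by the multiscale pressures. -/
lemma coupling_vel_error (hκ : Coeff M κ) (nE : M.Edge → ℕ) (mK : M.Elt → ℕ) {v : M.Vel}
    (hv : v ∈ M.fineV) {q : M.Pres} (hq : q ∈ B.coarseQ nE mK) :
    coupling q (v - B.interpV nE mK v) = 0 := by
  have hflux : ∀ (E : M.Edge) (K : M.Elt), E.1 ⊆ K.1 → ∀ g : Finset Plane → ℝ,
      ∑ e ∈ M.edgesIn E, len e * (g e * sideFlux K e (v - B.interpV nE mK v)) =
      ∑ e ∈ M.edgesIn E, len e * ((∑ j : Fin (M.dimEdge E),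
        (if j.1 < nE E then 0 else B.sideCoef v K E j) * B.trace E j e) * g e) := by
    intro E K hE g
    exact Finset.sum_congr rfl fun e he => by
      rw [B.sideFlux_error nE mK v hE he, mul_comm (g e)]
  -- An edge pressure sees only the normal components on its own edge.
  have hedge : ∀ E, M.IsDecoupled E → ∀ g : Finset Plane → ℝ,
      (∀ K, E.1 ⊆ K.1 → ∑ e ∈ M.edgesIn E,
        len e * (g e * sideFlux K e (v - B.interpV nE mK v)) = 0) →
      coupling (edgePressure E g) (v - B.interpV nE mK v) = 0 := by
    intro E hE g hg
    have hmem := edgePressure_mem_bubbleQ hE g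
    rw [coupling_apply, partI_of_mem_bubbleQ hmem, ← divB_apply, map_zero, LinearMap.zero_apply,
      zero_sub, neg_eq_zero, jumpForm_eq, partB_of_mem_bubbleQ hmem]
    refine Finset.sum_eq_zero fun E' hE' => Finset.sum_eq_zero fun K hK => ?_
    by_cases hEE : E' = E
    · subst hEE
      rw [← hg K (mem_eltsAt.1 hK)]
      exact Finset.sum_congr rfl fun e he => by rw [presOn_edgePressure g he]
    · refine Finset.sum_eq_zero fun e he => ?_
      rw [presOn_edgePressure_other hE (mem_decoupledEdges.1 hE') hEE g he]
      ring
  have hconf : ∀ K, ConformingIn K (v - B.interpV nE mK v) := fun K =>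
    (confSub K).sub_mem (conformingIn_of_mem_fineV hv K) (B.conformingIn_interpV nE mK v K)
  rw [← LinearMap.flip_apply, ← LinearMap.mem_ker]
  refine Submodule.span_le
    (p := LinearMap.ker (coupling.flip (v - B.interpV nE mK v))).2 ?_ hq
  -- For the indicator of `K`, the divergence theorem leaves the means of the normal components over
  -- the edges of `K`, which the interpolation preserves.
  rintro q (((⟨K, rfl⟩ | ⟨K, j, hj, rfl⟩) | ⟨E, hE, rfl⟩) | ⟨E, hE, j, hj, rfl⟩) <;>
    rw [SetLike.mem_coe, LinearMap.mem_ker, LinearMap.flip_apply]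
  · rw [coupling_apply, jumpForm_const, sub_zero, partI_const,
      divForm_univ_of_supp' (S := M.trisIn K) _ _ fun τ hτ => if_neg hτ, divForm]
    rw [Finset.sum_congr rfl fun τ hτ => by rw [if_pos hτ, one_mul], gauss_elt (hconf K)]
    refine Finset.sum_eq_zero fun E hE => ?_
    have := hflux E K (mem_edgesOf.1 hE) fun _ => 1
    simp only [one_mul, mul_one] at this
    rw [this, (B.remainder_orthogonal E _).1]
  · rw [coupling_apply, jumpForm_const, sub_zero, partI_const,
      divForm_univ_of_supp' _ _ (B.third_eq K j).pres_supp, B.divForm_error hκ, if_pos hj]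
  · refine hedge E hE _ fun K hK => ?_
    rw [hflux E K hK]
    simp only [mul_one]
    rw [(B.remainder_orthogonal E _).1]
  · refine hedge E hE _ fun K hK => ?_
    rw [hflux E K hK]
    exact ((B.remainder_orthogonal E _).2 j).trans (if_pos hj)

/-- A field supported in `ω_E` is the sum of its restrictions to the elements at `E`. -/
lemma sum_restr {E : M.Edge} {φ : M.Vel} (h : ∀ τ, τ ∉ M.patch E → φ τ = 0) :
    ∑ K ∈ M.eltsAt E, restr K φ = φ := by
  funext τ
  rw [Finset.sum_apply]
  obtain ⟨K, hK⟩ := exists_elt τ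
  by_cases hKE : K ∈ M.eltsAt E
  · rw [Finset.sum_eq_single K, restr_of_mem hK]
    · intro K' _ hne
      exact restr_of_notMem (fun h => hne (elt_unique h hK)) φ
    · exact fun h => absurd hKE h
  · rw [h τ, Finset.sum_eq_zero]
    · intro K' hK'
      exact restr_of_notMem (fun h => hKE (elt_unique h hK ▸ hK')) φ
    · intro hp
      obtain ⟨K', hK', hτ'⟩ := mem_patch.1 hp
      exact hKE (elt_unique hK hτ' ▸ hK')

/-- The contribution of one edge to the velocity interpolant is a multiscale velocity: at an edge
that is not decoupled, the coefficients from both sides agree. -/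
lemma sum_restr_mem {E : M.Edge} {φ : M.Vel} {g : Finset Plane → ℝ} {c : M.Elt → ℝ}
    (h : IsLocalSolution κ E (B.normal E) g c φ) {v : M.Vel} (hv : v ∈ M.fineV)
    (S : Submodule ℝ M.Vel) (h1 : ¬ M.IsDecoupled E → φ ∈ S)
    (h2 : M.IsDecoupled E → ∀ K ∈ M.eltsAt E, restr K φ ∈ S) (s : ℝ) :
    ∑ K ∈ M.eltsAt E, (s * sideInner K E v φ) • restr K φ ∈ S := by
  by_cases hE : M.IsDecoupled E
  · exact S.sum_mem fun K hK => S.smul_mem _ (h2 hE K hK)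
  · obtain ⟨K₀, hK₀⟩ := eltsAt_nonempty E
    -- Both normal components change their sign from one side to the other, so their product does
    -- not.
    have hcoef : ∀ K ∈ M.eltsAt E, sideInner K E v φ = sideInner K₀ E v φ := by
      intro K hK
      by_cases hne : K = K₀
      · rw [hne]
      · rw [mem_eltsAt] at hK hK₀
        rw [sideInner_eq hK, sideInner_eq hK₀]
        refine Finset.sum_congr rfl fun e he => ?_
        have e1 := sideFlux_add_of_mem_fineV hv hE he hK hK₀ hne
        have e2 := sideFlux_add_of_mem_fineV h.mem_fineV hE he hK hK₀ hne
        rw [eq_neg_of_add_eq_zero_left e1, eq_neg_of_add_eq_zero_left e2]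
        ring
    rw [Finset.sum_congr rfl fun K hK => by rw [hcoef K hK], ← Finset.smul_sum, sum_restr h.supp]
    exact S.smul_mem _ (h1 hE)

/-- The interpolant of a velocity is a multiscale velocity. -/
lemma interpV_mem (nE : M.Edge → ℕ) (mK : M.Elt → ℕ) {v : M.Vel} (hv : v ∈ M.fineV) :
    B.interpV nE mK v ∈ B.coarseV nE mK := by
  have hswap : ∀ f : M.Elt → M.Edge → M.Vel,
      ∑ K : M.Elt, ∑ E : M.Edge, (if E.1 ⊆ K.1 then f K E else 0) =
        ∑ E : M.Edge, ∑ K ∈ M.eltsAt E, f K E := by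
    intro f
    rw [Finset.sum_comm]
    refine Finset.sum_congr rfl fun E _ => ?_
    rw [← Finset.sum_filter]
    rfl
  rw [interpV, Finset.sum_add_distrib, hswap]
  refine Submodule.add_mem _ (Submodule.sum_mem _ fun E _ => ?_)
    (Submodule.sum_mem _ fun K _ => Submodule.sum_mem _ fun j _ => ?_)
  · rw [Finset.sum_add_distrib, Finset.sum_comm]
    refine Submodule.add_mem _ ?_ (Submodule.sum_mem _ fun j _ => ?_)
    · exact B.sum_restr_mem (B.first_spec E) hv _
        (fun hE => Submodule.subset_span (Or.inl (Or.inl (Or.inl (Or.inl ⟨E, hE, rfl⟩)))))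
        (fun hE K hK => Submodule.subset_span
          (Or.inl (Or.inl (Or.inl (Or.inr ⟨E, hE, K, hK, rfl⟩))))) _
    · split_ifs with hj
      · have := B.sum_restr_mem (B.second_spec E j).1 hv (B.coarseV nE mK)
          (fun hE => Submodule.subset_span (Or.inl (Or.inl (Or.inr ⟨E, hE, j, hj, rfl⟩))))
          (fun hE K hK => Submodule.subset_span
            (Or.inl (Or.inr ⟨E, hE, K, hK, j, hj, rfl⟩))) 1
        simp only [one_mul] at this
        exact this
      · rw [Finset.sum_const_zero]
        exact Submodule.zero_mem _
  · split_ifs with hj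
    · exact Submodule.smul_mem _ _ (Submodule.subset_span (Or.inr ⟨K, j, hj, rfl⟩))
    · exact Submodule.zero_mem _

lemma interpQ_mem (nE : M.Edge → ℕ) (mK : M.Elt → ℕ) (p : M.Pres) :
    B.interpI mK p + B.interpB nE p ∈ B.coarseQ nE mK := by
  refine Submodule.add_mem _ (Submodule.sum_mem _ fun K _ => Submodule.add_mem _ ?_
    (Submodule.sum_mem _ fun j _ => ?_)) (Submodule.sum_mem _ fun E _ => ?_)
  · have : const (fun τ => if τ ∈ M.trisIn K then B.coefA0 (partI p) K else 0) =
        B.coefA0 (partI p) K • const fun τ => if τ ∈ M.trisIn K then (1 : ℝ) else 0 := by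
      rw [← constL_apply, ← constL_apply, ← map_smul]
      congr 1
      funext τ
      simp
    rw [this]
    exact Submodule.smul_mem _ _ (Submodule.subset_span (Or.inl (Or.inl (Or.inl ⟨K, rfl⟩))))
  · split_ifs with hj
    · exact Submodule.smul_mem _ _
        (Submodule.subset_span (Or.inl (Or.inl (Or.inr ⟨K, j, hj, rfl⟩))))
    · exact Submodule.zero_mem _
  · split_ifs with hE
    · refine Submodule.add_mem _ (Submodule.smul_mem _ _
        (Submodule.subset_span (Or.inl (Or.inr ⟨E, hE, rfl⟩)))) (Submodule.sum_mem _ fun j _ => ?_)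
      split_ifs with hj
      · exact Submodule.smul_mem _ _ (Submodule.subset_span (Or.inr ⟨E, hE, j, hj, rfl⟩))
      · exact Submodule.zero_mem _
    · exact Submodule.zero_mem _

end Basis

end StaggeredMesh

/-! ### Spatial interpolation errors -/

/-- Bessel's inequality for a weighted sum, applied to some of the coefficients of `u`. -/
lemma orthonormal_bessel {ι : Type*} (S : Finset ι) {r : ι → ℝ} (hr : ∀ i ∈ S, 0 ≤ r i) {N : ℕ}
    (p : Fin N → ι → ℝ)
    (h1 : ∀ j k, ∑ i ∈ S, r i * (p j i * p k i) = if j = k then 1 else 0) (u : ι → ℝ)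
    (c : Fin N → ℝ) (hc : ∀ j, c j = 0 ∨ c j = ∑ i ∈ S, r i * (u i * p j i)) :
    ∑ j, c j ^ 2 ≤ ∑ i ∈ S, r i * (u i * u i) := by
  have h2 := orthonormal_parseval S p h1 c
  have h3 : ∑ i ∈ S, r i * (u i * ∑ j, c j * p j i) = ∑ j, c j ^ 2 := by
    have : ∀ i ∈ S, r i * (u i * ∑ j, c j * p j i) = ∑ j, c j * (r i * (u i * p j i)) := by
      intro i _
      rw [Finset.mul_sum, Finset.mul_sum]
      exact Finset.sum_congr rfl fun j _ => by ring
    rw [Finset.sum_congr rfl this, Finset.sum_comm]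
    refine Finset.sum_congr rfl fun j _ => ?_
    rw [← Finset.mul_sum]
    rcases hc j with h | h
    · rw [h]; ring
    · rw [← h]; ring
  have h4 : 0 ≤ ∑ i ∈ S, r i * ((u i - ∑ j, c j * p j i) * (u i - ∑ j, c j * p j i)) :=
    Finset.sum_nonneg fun i hi => mul_nonneg (hr i hi) (mul_self_nonneg _)
  have h5 : ∑ i ∈ S, r i * ((u i - ∑ j, c j * p j i) * (u i - ∑ j, c j * p j i)) =
      ∑ i ∈ S, r i * (u i * u i) - 2 * ∑ i ∈ S, r i * (u i * ∑ j, c j * p j i) +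
        ∑ i ∈ S, r i * ((∑ j, c j * p j i) * ∑ j, c j * p j i) := by
    rw [Finset.mul_sum, ← Finset.sum_sub_distrib, ← Finset.sum_add_distrib]
    exact Finset.sum_congr rfl fun i _ => by ring
  linarith

/-- The final step in both pressure estimates: with `x` the square of the error, Cauchy-Schwarz
gives `x ^ 2 ≤ a (m x)`. -/
lemma le_of_sq_le {x a m : ℝ} (ha : 0 ≤ a) (hm : 0 ≤ m) (h : x ^ 2 ≤ a * (m * x)) :
    x ≤ m * a := by
  by_contra! hlt
  have hx : 0 < x := lt_of_le_of_lt (mul_nonneg hm ha) hlt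
  have := mul_lt_mul_of_pos_right hlt hx
  nlinarith

namespace StaggeredMesh

variable {M : StaggeredMesh} {κ ρ : Plane → ℝ}

lemma massV_add_le (hκ : Coeff M κ) (S : Finset M.Tri) (v w : M.Vel) :
    massV κ S (v + w) (v + w) ≤ 2 * massV κ S v v + 2 * massV κ S w w := by
  have h1 := massV_nonneg hκ S (v - w)
  simp only [← massVB_apply hκ, map_add, map_sub, LinearMap.add_apply, LinearMap.sub_apply]
    at h1 ⊢
  linarith

lemma massQ_add_le (hρ : Coeff M ρ) (p q : M.Pres) :
    massQ ρ (p + q) (p + q) ≤ 2 * massQ ρ p p + 2 * massQ ρ q q := by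
  have h1 := massQ_nonneg hρ (p - q)
  simp only [← massQB_apply hρ, map_add, map_sub, LinearMap.add_apply, LinearMap.sub_apply]
    at h1 ⊢
  linarith

lemma massV_sum_le (hκ : Coeff M κ) (S : Finset M.Tri) {ι : Type*} (s : Finset ι)
    (f : ι → M.Vel) :
    massV κ S (∑ i ∈ s, f i) (∑ i ∈ s, f i) ≤ s.card * ∑ i ∈ s, massV κ S (f i) (f i) := by
  have h1 : massV κ S (∑ i ∈ s, f i) (∑ i ∈ s, f i) =
      ∑ i ∈ s, ∑ j ∈ s, massV κ S (f i) (f j) := by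
    simp only [← massVB_apply hκ, map_sum, LinearMap.sum_apply]
    rw [Finset.sum_comm]
  have h2 : ∀ i j, massV κ S (f i) (f j) ≤
      (massV κ S (f i) (f i) + massV κ S (f j) (f j)) / 2 := by
    intro i j
    have h1 := massV_nonneg hκ S (f i - f j)
    have h2 := massV_comm κ S (f i) (f j)
    simp only [← massVB_apply hκ, map_sub, LinearMap.sub_apply] at h1 h2 ⊢
    linarith
  rw [h1]
  refine (Finset.sum_le_sum fun i _ => Finset.sum_le_sum fun j _ => h2 i j).trans (le_of_eq ?_)
  simp only [← Finset.sum_div, Finset.sum_add_distrib, Finset.sum_const, nsmul_eq_mul,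
    ← Finset.mul_sum]
  ring

lemma coupling_const (q : M.Tri → ℝ) (w : M.Vel) :
    coupling (const q) w = divForm Finset.univ q w := by
  rw [coupling_apply, partI_const, jumpForm_const, sub_zero]

lemma LocalV.coupling_eq {K : M.Elt} {w : M.Vel} (hw : LocalV K w) (q : M.Pres) :
    coupling q w = divForm (M.trisIn K) (partI q) w := by
  rw [coupling_apply, hw.jumpForm_eq_zero, sub_zero, divForm_univ_of_supp _ _ hw.1]

lemma sideInner_self_nonneg {K : M.Elt} {E : M.Edge} (hE : E.1 ⊆ K.1) (v : M.Vel) :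
    0 ≤ sideInner K E v v := by
  rw [sideInner_eq hE]
  exact Finset.sum_nonneg fun e he =>
    mul_nonneg (len_pos (card_of_mem_edgesIn he)).le (mul_self_nonneg _)

lemma edgeInner_self_nonneg (E : M.Edge) (v : M.Vel) : 0 ≤ edgeInner E v v :=
  mul_nonneg (by positivity) (Finset.sum_nonneg fun _ hK =>
    sideInner_self_nonneg (mem_eltsAt.1 hK) v)

/-- Every one-sided trace is counted at most with the factor two in the averages over the sides. -/
lemma sum_sideInner_le (v : M.Vel) :
    ∑ K : M.Elt, ∑ E ∈ M.edgesOf K, sideInner K E v v ≤ 2 * ∑ E, edgeInner E v v := by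
  have h1 : ∑ K : M.Elt, ∑ E ∈ M.edgesOf K, sideInner K E v v =
      ∑ E : M.Edge, ∑ K ∈ M.eltsAt E, sideInner K E v v := by
    refine Finset.sum_comm' fun K E => ?_
    simp [mem_edgesOf, mem_eltsAt]
  rw [h1, Finset.mul_sum]
  refine Finset.sum_le_sum fun E _ => ?_
  have h0 : (0 : ℝ) < (M.eltsAt E).card := by exact_mod_cast (M.eltsAt_nonempty E).card_pos
  have h2 : ((M.eltsAt E).card : ℝ) ≤ 2 := by exact_mod_cast eltsAt_card_le E
  have h3 : ∑ K ∈ M.eltsAt E, sideInner K E v v = (M.eltsAt E).card * edgeInner E v v := by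
    rw [edgeInner, ← mul_assoc, mul_inv_cancel₀ h0.ne', one_mul]
  rw [h3]
  exact mul_le_mul_of_nonneg_right h2 (edgeInner_self_nonneg E v)

lemma trisIn_subset_patch {K : M.Elt} {E : M.Edge} (h : E.1 ⊆ K.1) : M.trisIn K ⊆ M.patch E :=
  fun _ hτ => mem_patch.2 ⟨K, mem_eltsAt.2 h, hτ⟩

/-- The part of `residual2` that belongs to the coarse element `K`. -/
def residualIn (ρ g : Plane → ℝ) (q : M.Pres) (K : M.Elt) : ℝ :=
  ∑ τ ∈ M.trisIn K, ∫ x in hull τ.1, ρ x * ((ρ x)⁻¹ * g x - presAt q τ x) ^ 2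

lemma residual2_eq (ρ g : Plane → ℝ) (q : M.Pres) :
    residual2 ρ g q = ∑ K, residualIn ρ g q K := sum_elts _

lemma residualIn_nonneg (hρ : Coeff M ρ) (g : Plane → ℝ) (q : M.Pres) (K : M.Elt) :
    0 ≤ residualIn ρ g q K :=
  Finset.sum_nonneg fun _ _ =>
    setIntegral_nonneg (measurableSet_hull _)
      fun _ hx => mul_nonneg (hρ.pos hx).le (sq_nonneg _)

lemma memLp_hull {F : Plane → ℝ} (hF : MemLp F 2 (volume.restrict M.domain)) (τ : M.Tri) :
    MemLp F 2 (volume.restrict (hull τ.1)) :=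
  hF.mono_measure (Measure.restrict_mono (hull_subset_domain τ) le_rfl)

lemma finite_hull (τ : M.Tri) : IsFiniteMeasure (volume.restrict (hull τ.1)) :=
  ⟨by simpa using (isCompact_hull τ.1).measure_lt_top⟩

lemma integrableOn_source {F : Plane → ℝ} (hF : MemLp F 2 (volume.restrict M.domain)) (τ : M.Tri)
    (q : M.Pres) : IntegrableOn (fun x => F x * presAt q τ x) (hull τ.1) := by
  have := finite_hull τ
  have h1 : IntegrableOn F (hull τ.1) := (memLp_hull hF τ).integrable one_le_two
  exact h1.mul_continuousOn (continuous_presAt q τ).continuousOn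
    (isCompact_hull τ.1)

lemma integrableOn_residual (hρ : Coeff M ρ) {F : Plane → ℝ}
    (hF : MemLp F 2 (volume.restrict M.domain)) (q : M.Pres) (τ : M.Tri) :
    IntegrableOn (fun x => ρ x * ((ρ x)⁻¹ * F x - presAt q τ x) ^ 2) (hull τ.1) := by
  have h1 : IntegrableOn (fun x => F x ^ 2) (hull τ.1) := (memLp_hull hF τ).integrable_sq
  have h2 := hρ.inv.integrableOn_mul τ h1
  have h3 := integrableOn_source hF τ q
  have h4 := integrableOn_massQ hρ τ q q
  refine ((h2.sub (h3.const_mul 2)).add h4).congr_fun_ae ?_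
  filter_upwards [ae_restrict_mem
    (measurableSet_hull _)] with x hx
  have := (hρ.pos hx).ne'
  simp only [Pi.add_apply, Pi.sub_apply]
  field_simp
  ring

/-- Young's inequality for the functional `s ↦ ∫ ρ (ρ⁻¹ F - q) s`, where `s` lives on `K`. -/
lemma two_mul_residual_le (hρ : Coeff M ρ) {F : Plane → ℝ}
    (hF : MemLp F 2 (volume.restrict M.domain)) (q : M.Pres) {K : M.Elt} {s : M.Tri → ℝ}
    (hs : ∀ τ, τ ∉ M.trisIn K → s τ = 0) :
    2 * (source F (const s) - massQ ρ q (const s)) ≤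
      residualIn ρ F q K + massQ ρ (const s) (const s) := by
  have h1 : source F (const s) = ∑ τ ∈ M.trisIn K, ∫ x in hull τ.1, F x * presAt (const s) τ x := by
    refine (Finset.sum_subset (Finset.subset_univ _) fun τ _ hτ => ?_).symm
    simp [presAt_const, hs τ hτ]
  have h2 : ∀ p : M.Pres, massQ ρ p (const s) =
      ∑ τ ∈ M.trisIn K, ∫ x in hull τ.1, ρ x * (presAt p τ x * presAt (const s) τ x) := by
    intro p
    refine (Finset.sum_subset (Finset.subset_univ _) fun τ _ hτ => ?_).symm
    simp [presAt_const, hs τ hτ]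
  rw [h1, h2, h2, residualIn, ← Finset.sum_sub_distrib, Finset.mul_sum, ← Finset.sum_add_distrib]
  refine Finset.sum_le_sum fun τ _ => ?_
  have i1 := integrableOn_source hF τ (const s)
  have i2 := integrableOn_massQ hρ τ q (const s)
  have i3 := integrableOn_massQ hρ τ (const s) (const s)
  have i4 := integrableOn_residual hρ hF q τ
  rw [← integral_sub i1 i2, ← integral_const_mul, ← integral_add i4 i3]
  refine setIntegral_mono_on ((i1.sub i2).const_mul 2) (i4.add i3)
    (measurableSet_hull _) fun x hx => ?_
  have hp := hρ.pos hx
  have h5 : 0 ≤ ρ x * (((ρ x)⁻¹ * F x - presAt q τ x) - presAt (const s) τ x) ^ 2 :=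
    mul_nonneg hp.le (sq_nonneg _)
  have h6 : ρ x * (((ρ x)⁻¹ * F x - presAt q τ x) - presAt (const s) τ x) ^ 2 =
      ρ x * ((ρ x)⁻¹ * F x - presAt q τ x) ^ 2 +
        ρ x * (presAt (const s) τ x * presAt (const s) τ x) -
      2 * (F x * presAt (const s) τ x - ρ x * (presAt q τ x * presAt (const s) τ x)) := by
    field_simp
    ring
  linarith

namespace Basis

variable (B : Basis M κ ρ)

lemma inv_eigK_le (hκ : Coeff M κ) (mK : M.Elt → ℕ) (K : M.Elt) {j : Fin (M.dimElt K)}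
    (hj : ¬ j.1 < mK K) : (B.eigK K j)⁻¹ ≤ B.maxInvEigK mK := by
  have hK : mK K < M.dimElt K := lt_of_le_of_lt (not_lt.1 hj) j.2
  have h1 : (B.eigK K j)⁻¹ ≤ (B.eigK K ⟨mK K, hK⟩)⁻¹ :=
    inv_anti₀ (B.eigK_pos hκ K _) (B.eigK_mono K (by simpa [Fin.le_def] using hj))
  refine h1.trans ?_
  have h2 := le_ciSup (f := fun K : M.Elt =>
    if hK : mK K < M.dimElt K then (B.eigK K ⟨mK K, hK⟩)⁻¹ else 0) (Set.finite_range _).bddAbove K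
  simp only [dif_pos hK] at h2
  exact h2

lemma inv_eigE_le (hκ : Coeff M κ) (nE : M.Edge → ℕ) (E : M.Edge) {j : Fin (M.dimEdge E)}
    (hj : ¬ j.1 < nE E) : (B.eigE E j)⁻¹ ≤ B.maxInvEigE nE := by
  have hE : nE E < M.dimEdge E := lt_of_le_of_lt (not_lt.1 hj) j.2
  have h1 : (B.eigE E j)⁻¹ ≤ (B.eigE E ⟨nE E, hE⟩)⁻¹ :=
    inv_anti₀ (B.eigE_pos hκ E _) (B.eigE_mono E (by simpa [Fin.le_def] using hj))
  refine h1.trans ?_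
  have h2 := le_ciSup (f := fun E : M.Edge =>
    if hE : nE E < M.dimEdge E then (B.eigE E ⟨nE E, hE⟩)⁻¹ else 0) (Set.finite_range _).bddAbove E
  simp only [dif_pos hE] at h2
  exact h2

lemma maxInvEigK_nonneg (hκ : Coeff M κ) (mK : M.Elt → ℕ) : 0 ≤ B.maxInvEigK mK :=
  Real.iSup_nonneg fun K => by
    split_ifs
    · exact (inv_pos.2 (B.eigK_pos hκ K _)).le
    · exact le_rfl

lemma maxInvEigE_nonneg (hκ : Coeff M κ) (nE : M.Edge → ℕ) : 0 ≤ B.maxInvEigE nE :=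
  Real.iSup_nonneg fun E => by
    split_ifs
    · exact (inv_pos.2 (B.eigE_pos hκ E _)).le
    · exact le_rfl

lemma sum_sub_coefA0 (K : M.Elt) (p : M.Tri → ℝ) :
    ∑ τ ∈ M.trisIn K, area τ.1 * (p τ - B.coefA0 p K) = 0 := by
  have h0 : (∑ τ ∈ M.trisIn K, area τ.1) ≠ 0 :=
    (Finset.sum_pos (fun τ _ => area_pos τ) (trisIn_nonempty K)).ne'
  simp only [mul_sub, Finset.sum_sub_distrib, ← Finset.sum_mul]
  rw [coefA0, ← mul_assoc, mul_inv_cancel₀ h0, one_mul, sub_self]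

lemma divForm_sub_coefA0 {K : M.Elt} {w : M.Vel} (hw : LocalV K w) (p : M.Tri → ℝ) :
    divForm (M.trisIn K) (fun τ => p τ - B.coefA0 p K) w = divForm (M.trisIn K) p w := by
  have h1 : (fun τ => p τ - B.coefA0 p K) = p - fun _ => B.coefA0 p K := rfl
  rw [h1, ← divB_apply, map_sub, LinearMap.sub_apply, divB_apply, divB_apply, hw.div_mean,
    sub_zero]

/-- A field in `V_{h,0}(K)` with a potential is determined by its divergence; its norm is given by
the coefficients of the divergence along the eigenfunctions. -/
lemma massV_local (hκ : Coeff M κ) {K : M.Elt} {r : M.Vel} (hr : LocalV K r)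
    (hp : r ∈ potentialSub hκ K) :
    massV κ (M.trisIn K) r r =
      ∑ j, (B.eigK K j)⁻¹ * divForm (M.trisIn K) (B.thirdQ K j) r ^ 2 := by
  obtain ⟨p, hp⟩ := hp
  -- The potential is only determined up to a constant; it is normalised to mean zero so that it can
  -- be expanded in the eigenfunctions.
  set c := B.coefA0 p K with hc
  have hmean := B.sum_sub_coefA0 K p
  have hpot : ∀ w, LocalV K w →
      massV κ (M.trisIn K) r w = divForm (M.trisIn K) (fun τ => p τ - c) w := by
    intro w hw
    rw [B.divForm_sub_coefA0 hw, ← massVB_apply hκ, hp w hw, divB_apply]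
  -- Testing with an eigenfunction relates the coefficients of the divergence to those of the
  -- potential.
  have hD : ∀ j, divForm (M.trisIn K) (B.thirdQ K j) r =
      B.eigK K j * massQ ρ (const fun τ => p τ - c) (const (B.thirdQ K j)) := by
    intro j
    have h1 := (B.third_eq K j).eq_v r hr
    rw [← B.divForm_thirdV K j hmean, ← hpot _ (B.third_eq K j).vel_mem, massV_comm]
    linarith
  have hexp : divForm (M.trisIn K) (fun τ => p τ - c) r =
      ∑ j, massQ ρ (const fun τ => p τ - c) (const (B.thirdQ K j)) *
        divForm (M.trisIn K) (B.thirdQ K j) r := by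
    rw [divForm_congr (q' := ∑ j, massQ ρ (const fun τ => p τ - c) (const (B.thirdQ K j)) •
      B.thirdQ K j) (w' := r) _ fun _ _ => rfl]
    · simp only [← divB_apply, map_sum, map_smul, LinearMap.sum_apply, LinearMap.smul_apply,
        smul_eq_mul]
    · intro τ hτ
      simpa using B.elt_expansion K hmean τ hτ
  rw [hpot r hr, hexp]
  refine Finset.sum_congr rfl fun j _ => ?_
  have := (B.eigK_pos hκ K j).ne'
  rw [hD j]
  field_simp

/-- The discarded components of `v` along the eigenfunctions of the edge `E`, seen from `K`. -/
def tail (nE : M.Edge → ℕ) (v : M.Vel) (K : M.Elt) (E : M.Edge) : M.Vel :=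
  ∑ j, (if j.1 < nE E then 0 else B.coefC v K E j) • B.second E j

/-- On combinations of the discarded eigenfunctions of `E`, the velocity norm is bounded by the
coefficients, with the largest reciprocal of a discarded eigenvalue as the constant. -/
lemma massV_sum_second_le (hκ : Coeff M κ) (nE : M.Edge → ℕ) {K : M.Elt} {E : M.Edge}
    (hE : E.1 ⊆ K.1) (c : Fin (M.dimEdge E) → ℝ) (hc : ∀ j, j.1 < nE E → c j = 0) :
    massV κ (M.trisIn K) (∑ j, c j • B.second E j) (∑ j, c j • B.second E j) ≤
      B.maxInvEigE nE * ∑ j, c j ^ 2 := by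
  refine (massV_mono hκ (trisIn_subset_patch hE) _).trans ?_
  have h1 : massV κ (M.patch E) (∑ j, c j • B.second E j) (∑ j, c j • B.second E j) =
      ∑ j, (B.eigE E j)⁻¹ * c j ^ 2 := by
    simp only [← massVB_apply hκ, map_sum, map_smul, LinearMap.sum_apply, LinearMap.smul_apply,
      smul_eq_mul]
    simp only [massVB_apply hκ, B.massV_second_eq hκ, mul_ite, mul_zero,
      Finset.sum_ite_eq', Finset.mem_univ, if_true]
    exact Finset.sum_congr rfl fun j _ => by ring
  rw [h1, Finset.mul_sum]
  refine Finset.sum_le_sum fun j _ => ?_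
  by_cases hj : j.1 < nE E
  · rw [hc j hj]; simp
  · exact mul_le_mul_of_nonneg_right (B.inv_eigE_le hκ nE E hj) (sq_nonneg _)

/-- The discarded edge components are small in the velocity norm, since on the snapshot space the
trace norm controls it through the eigenvalues. -/
lemma massV_tail_le (hκ : Coeff M κ) (nE : M.Edge → ℕ) (v : M.Vel) {K : M.Elt} {E : M.Edge}
    (hE : E.1 ⊆ K.1) :
    massV κ (M.trisIn K) (B.tail nE v K E) (B.tail nE v K E) ≤
      B.maxInvEigE nE * sideInner K E v v := by
  refine (B.massV_sum_second_le hκ nE hE _ fun j hj => if_pos hj).trans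
    (mul_le_mul_of_nonneg_left ?_ (B.maxInvEigE_nonneg hκ nE))
  have h1 := orthonormal_bessel (M.edgesIn E)
    (fun e he => (len_pos (card_of_mem_edgesIn he)).le) (B.trace E) (B.trace_orthonormal E)
    (fun e => sideFlux K e v) (fun j => if j.1 < nE E then 0 else B.sideCoef v K E j)
    (fun j => by
      by_cases hj : j.1 < nE E
      · exact Or.inl (if_pos hj)
      · exact Or.inr (if_neg hj))
  rw [sideInner_eq hE]
  refine le_of_eq_of_le (Finset.sum_congr rfl fun j _ => ?_) h1
  split_ifs
  · rfl
  · rw [B.coefC_eq v hE, mul_pow, (B.sgn_spec hE).1, one_mul]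

/-- Up to the discarded edge components, the interpolation error of the velocity is on each
coarse element a field in `V_{h,0}(K)`. -/
lemma localV_remainder (hκ : Coeff M κ) (nE : M.Edge → ℕ) (mK : M.Elt → ℕ) {v : M.Vel}
    (hv : v ∈ M.fineV) (K : M.Elt) (hpot : v ∈ potentialSub hκ K) :
    LocalV K (restr K (v - B.interpV nE mK v - ∑ E ∈ M.edgesOf K, B.tail nE v K E)) ∧
    restr K (v - B.interpV nE mK v - ∑ E ∈ M.edgesOf K, B.tail nE v K E) ∈ potentialSub hκ K ∧
    ∀ j, divForm (M.trisIn K) (B.thirdQ K j)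
      (restr K (v - B.interpV nE mK v - ∑ E ∈ M.edgesOf K, B.tail nE v K E)) =
        if j.1 < mK K then 0 else divForm (M.trisIn K) (B.thirdQ K j) v := by
  have htail : ∀ S : Submodule ℝ M.Vel, (∀ E j, B.second E j ∈ S) →
      ∑ E ∈ M.edgesOf K, B.tail nE v K E ∈ S := fun S hS =>
    Submodule.sum_mem _ fun E _ => Submodule.sum_mem _ fun j _ => Submodule.smul_mem _ _ (hS E j)
  refine ⟨localV_iff.2 ⟨fun τ hτ => restr_of_notMem hτ _, ?_, fun E hE e he => ?_⟩, ?_, fun j => ?_⟩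
  · refine confSub_congr (fun τ hτ => (restr_of_mem hτ _).symm) (Submodule.sub_mem _
      (Submodule.sub_mem _ (conformingIn_of_mem_fineV hv K) (B.conformingIn_interpV nE mK v K))
      (htail _ fun E j => ?_))
    exact (B.second_spec E j).1.conformingIn K
  · rw [sideFlux_restr, if_pos rfl, map_sub, B.sideFlux_error nE mK v hE he, map_sum,
      Finset.sum_eq_single_of_mem E (mem_edgesOf.2 hE), tail, map_sum, ← Finset.sum_sub_distrib]
    · refine Finset.sum_eq_zero fun j _ => ?_
      rw [map_smul, B.sideFlux_second hE he j, if_pos rfl, smul_eq_mul]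
      split_ifs
      · ring
      · rw [B.coefC_eq v hE]
        have := (B.sgn_spec hE).1
        linear_combination (-B.sideCoef v K E j * B.trace E j e) * this
    · intro E' hE' hne
      rw [tail, map_sum]
      refine Finset.sum_eq_zero fun j _ => ?_
      rw [map_smul, B.sideFlux_second hE he j, if_neg hne.symm, smul_zero]
  · refine potentialSub_congr hκ (fun τ hτ => (restr_of_mem hτ _).symm) (Submodule.sub_mem _
      (Submodule.sub_mem _ hpot (B.interpV_mem_potentialSub hκ nE mK v K)) (htail _ fun E j => ?_))
    exact (B.second_spec E j).1.mem_potentialSub hκ K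
  · rw [divForm_congr (fun _ _ => rfl) (fun τ hτ => restr_of_mem hτ _), ← B.divForm_error hκ nE,
      ← divB_apply, ← divB_apply, map_sub, sub_eq_self]
    have := htail (LinearMap.ker (divB (M.trisIn K) (B.thirdQ K j))) fun E i => by
      rw [LinearMap.mem_ker, divB_apply]
      exact (B.second_spec E i).1.divForm_eq_zero (B.third_eq K j).pres_mean
    exact LinearMap.mem_ker.1 this

/-- The velocity error on one coarse element. -/
lemma vel_error_elt (hκ : Coeff M κ) (hρ : Coeff M ρ) (nE : M.Edge → ℕ) (mK : M.Elt → ℕ)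
    {V1 : M.Vel} {P0 P2 : M.Pres} {F : Plane → ℝ} (hF : MemLp F 2 (volume.restrict M.domain))
    (hV1 : V1 ∈ M.fineV)
    (h1 : ∀ w ∈ M.fineV, massV κ Finset.univ V1 w = coupling P0 w)
    (h3 : ∀ q ∈ M.fineQhat, massQ ρ P2 q + coupling q V1 = source F q) (K : M.Elt) :
    massV κ (M.trisIn K) (V1 - B.interpV nE mK V1) (V1 - B.interpV nE mK V1) ≤
      2 * (B.maxInvEigK mK * residualIn ρ F P2 K) +
        6 * (B.maxInvEigE nE * ∑ E ∈ M.edgesOf K, sideInner K E V1 V1) := by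
  -- The velocity equation provides a potential on `K`.
  have hpot : V1 ∈ potentialSub hκ K := by
    refine ⟨partI P0, fun w hw => ?_⟩
    rw [massVB_apply, divB_apply, ← hw.coupling_eq, ← h1 w hw.mem_fineV,
      massV_univ_of_supp _ _ hw.1]
  obtain ⟨hr, hrp, hrd⟩ := B.localV_remainder hκ nE mK hV1 K hpot
  set t := ∑ E ∈ M.edgesOf K, B.tail nE V1 K E with ht
  set r := restr K (V1 - B.interpV nE mK V1 - t) with hrdef
  have hsplit : massV κ (M.trisIn K) (V1 - B.interpV nE mK V1) (V1 - B.interpV nE mK V1) =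
      massV κ (M.trisIn K) (r + t) (r + t) := by
    have : ∀ τ ∈ M.trisIn K, (V1 - B.interpV nE mK V1) τ = (r + t) τ := by
      intro τ hτ
      rw [Pi.add_apply, hrdef, restr_of_mem hτ, Pi.sub_apply (V1 - B.interpV nE mK V1) t,
        sub_add_cancel]
    exact massV_congr this this
  -- The remainder `r` is bounded by the discarded components `c` of the divergence, which the
  -- pressure equation turns into components of the residual.
  have hbr : massV κ (M.trisIn K) r r ≤ B.maxInvEigK mK * residualIn ρ F P2 K := by
    set c : Fin (M.dimElt K) → ℝ := fun j =>
      if j.1 < mK K then 0 else divForm (M.trisIn K) (B.thirdQ K j) V1 with hc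
    set s : M.Tri → ℝ := ∑ j, c j • B.thirdQ K j with hs
    have hsapp : ∀ τ, s τ = ∑ j, c j * B.thirdQ K j τ := fun τ => by simp [hs]
    have hs0 : ∀ τ, τ ∉ M.trisIn K → s τ = 0 := by
      intro τ hτ
      rw [hsapp]
      exact Finset.sum_eq_zero fun j _ => by rw [(B.third_eq K j).pres_supp τ hτ, mul_zero]
    -- The pressure equation, tested with the discarded part `s` of the divergence.
    have hL : source F (const s) - massQ ρ P2 (const s) = ∑ j, c j ^ 2 := by
      have e1 := h3 (const s) (const_mem_fineQhat s)
      rw [coupling_const] at e1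
      have e2 : divForm Finset.univ s V1 = ∑ j, c j ^ 2 := by
        rw [divForm_univ_of_supp' _ _ hs0, hs]
        simp only [← divB_apply, map_sum, map_smul, LinearMap.sum_apply, LinearMap.smul_apply,
          smul_eq_mul]
        refine Finset.sum_congr rfl fun j _ => ?_
        simp only [hc, divB_apply]
        split_ifs
        · ring
        · ring
      linarith
    have hpars : massQ ρ (const s) (const s) = ∑ j, c j ^ 2 := by
      rw [massQ_const_of_supp ρ _ hs0]
      simp only [hsapp]
      refine orthonormal_parseval (M.trisIn K) (B.thirdQ K) (fun j k => ?_) c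
      rw [← massQ_const_of_supp ρ _ (B.third_eq K k).pres_supp, B.third_orthonormal]
    have hbes := two_mul_residual_le hρ hF P2 hs0
    rw [B.massV_local hκ hr hrp]
    have hle : ∑ j, (B.eigK K j)⁻¹ * divForm (M.trisIn K) (B.thirdQ K j) r ^ 2 ≤
        B.maxInvEigK mK * ∑ j, c j ^ 2 := by
      rw [Finset.mul_sum]
      refine Finset.sum_le_sum fun j _ => ?_
      rw [hrd j]
      by_cases hj : j.1 < mK K
      · simp [hc, hj]
      · simp only [hc, if_neg hj]
        exact mul_le_mul_of_nonneg_right (B.inv_eigK_le hκ mK K hj) (sq_nonneg _)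
    exact hle.trans (mul_le_mul_of_nonneg_left (by linarith) (B.maxInvEigK_nonneg hκ mK))
  -- An element has at most three edges.
  have hbt : massV κ (M.trisIn K) t t ≤
      3 * (B.maxInvEigE nE * ∑ E ∈ M.edgesOf K, sideInner K E V1 V1) := by
    refine (massV_sum_le hκ _ _ _).trans ?_
    refine mul_le_mul (by exact_mod_cast edgesOf_card_le K) ?_
      (Finset.sum_nonneg fun E _ => massV_nonneg hκ _ _) (by norm_num)
    rw [Finset.mul_sum]
    exact Finset.sum_le_sum fun E hE => B.massV_tail_le hκ nE V1 (mem_edgesOf.1 hE)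
  rw [hsplit]
  have := massV_add_le hκ (M.trisIn K) r t
  linarith

/-- The velocity error: the local bounds summed over the coarse elements. -/
lemma vel_error (hκ : Coeff M κ) (hρ : Coeff M ρ) (nE : M.Edge → ℕ) (mK : M.Elt → ℕ)
    {V1 : M.Vel} {P0 P2 : M.Pres} {F : Plane → ℝ} (hF : MemLp F 2 (volume.restrict M.domain))
    (hV1 : V1 ∈ M.fineV)
    (h1 : ∀ w ∈ M.fineV, massV κ Finset.univ V1 w = coupling P0 w)
    (h3 : ∀ q ∈ M.fineQhat, massQ ρ P2 q + coupling q V1 = source F q) :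
    normV2 κ (V1 - B.interpV nE mK V1) ≤
      2 * (B.maxInvEigK mK * residual2 ρ F P2) +
        12 * (B.maxInvEigE nE * ∑ E, edgeInner E V1 V1) := by
  rw [normV2, massV_univ, residual2_eq]
  refine (Finset.sum_le_sum fun K _ => B.vel_error_elt hκ hρ nE mK hF hV1 h1 h3 K).trans ?_
  rw [Finset.sum_add_distrib, ← Finset.mul_sum, ← Finset.mul_sum, ← Finset.mul_sum,
    ← Finset.mul_sum]
  have := mul_le_mul_of_nonneg_left (sum_sideInner_le V1) (B.maxInvEigE_nonneg hκ nE)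
  linarith

/-- The error of the element part of the pressure, tested with the eigenfunctions of `K`. -/
lemma presI_error_elt (hκ : Coeff M κ) (mK : M.Elt → ℕ) {V2 : M.Vel} {P1 : M.Pres}
    (h2 : ∀ w ∈ M.fineV, massV κ Finset.univ V2 w = coupling P1 w) (K : M.Elt) :
    ∑ τ ∈ M.trisIn K, wt ρ τ * ((partI P1 - B.valI mK (partI P1)) τ *
        (partI P1 - B.valI mK (partI P1)) τ) ≤
      B.maxInvEigK mK * massV κ (M.trisIn K) V2 V2 := by
  set x := partI P1 - B.valI mK (partI P1) with hx
  obtain ⟨hx0, hxs⟩ := B.valI_error mK (partI P1) K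
  set s : Fin (M.dimElt K) → ℝ := fun j => if j.1 < mK K then 0 else B.coefA (partI P1) K j with hs
  have hexp : ∀ τ ∈ M.trisIn K, x τ = ∑ j, s j * B.thirdQ K j τ := by
    intro τ hτ
    refine (B.elt_expansion K (q := x) hx0 τ hτ).trans ?_
    exact Finset.sum_congr rfl fun j _ => by rw [hxs j]
  have hX : ∑ τ ∈ M.trisIn K, wt ρ τ * (x τ * x τ) = ∑ j, s j ^ 2 := by
    rw [← orthonormal_parseval (M.trisIn K) (B.thirdQ K) (fun j k => ?_) s]
    · exact Finset.sum_congr rfl fun τ hτ => by rw [hexp τ hτ]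
    · rw [← massQ_const_of_supp ρ _ (B.third_eq K k).pres_supp, B.third_orthonormal]
  -- testing the velocity equation with an eigenfunction gives the coefficient of the pressure
  have htest : ∀ j, massV κ (M.trisIn K) V2 (B.thirdV K j) =
      B.eigK K j * B.coefA (partI P1) K j := by
    intro j
    have hloc := (B.third_eq K j).vel_mem
    rw [← massV_univ_of_supp _ _ hloc.1, h2 _ hloc.mem_fineV, hloc.coupling_eq]
    rw [coefA, ← B.divForm_thirdV K j (B.sum_sub_coefA0 K _), B.divForm_sub_coefA0 hloc]
  -- The test function `W` pairs with `V2` to the squared norm `∑ s_j ^ 2` of the error, while its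
  -- own squared norm is at most `max μ⁻¹` times that.
  set W : M.Vel := ∑ j, ((B.eigK K j)⁻¹ * s j) • B.thirdV K j with hW
  have hVW : massV κ (M.trisIn K) V2 W = ∑ j, s j ^ 2 := by
    simp only [hW, ← massVB_apply hκ, map_sum, map_smul, smul_eq_mul]
    refine Finset.sum_congr rfl fun j _ => ?_
    have := (B.eigK_pos hκ K j).ne'
    rw [massVB_apply, htest]
    by_cases hj : j.1 < mK K
    · simp [hs, hj]
    · simp only [hs, if_neg hj]
      field_simp
  have hWW : massV κ (M.trisIn K) W W ≤ B.maxInvEigK mK * ∑ j, s j ^ 2 := by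
    have e1 : massV κ (M.trisIn K) W W = ∑ j, (B.eigK K j)⁻¹ * s j ^ 2 := by
      simp only [hW, ← massVB_apply hκ, map_sum, map_smul, LinearMap.sum_apply,
        LinearMap.smul_apply, smul_eq_mul]
      simp only [massVB_apply hκ, B.massV_third, mul_ite, mul_zero,
        Finset.sum_ite_eq', Finset.mem_univ, if_true]
      refine Finset.sum_congr rfl fun j _ => ?_
      have := (B.eigK_pos hκ K j).ne'
      field_simp
    rw [e1, Finset.mul_sum]
    refine Finset.sum_le_sum fun j _ => ?_
    by_cases hj : j.1 < mK K
    · simp [hs, hj]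
    · exact mul_le_mul_of_nonneg_right (B.inv_eigK_le hκ mK K hj) (sq_nonneg _)
  rw [hX]
  refine le_of_sq_le (massV_nonneg hκ _ _) (B.maxInvEigK_nonneg hκ mK) ?_
  calc (∑ j, s j ^ 2) ^ 2 = massV κ (M.trisIn K) V2 W ^ 2 := by rw [hVW]
    _ ≤ massV κ (M.trisIn K) V2 V2 * massV κ (M.trisIn K) W W := massV_sq_le hκ _ _ _
    _ ≤ _ := mul_le_mul_of_nonneg_left hWW (massV_nonneg hκ _ _)

/-- The error of the edge part of the pressure, tested with the decoupled eigenfunctions of `E` on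
one adjacent element. -/
lemma presB_error_edge (hκ : Coeff M κ) (nE : M.Edge → ℕ) {V2 : M.Vel} {P1 : M.Pres}
    (h2 : ∀ w ∈ M.fineV, massV κ Finset.univ V2 w = coupling P1 w) {E : M.Edge}
    (hE : M.IsDecoupled E) {K : M.Elt} (hK : K ∈ M.eltsAt E) :
    ∑ e ∈ M.edgesIn E, len e * presOn (partB P1 - B.interpB nE P1) e ^ 2 ≤
      B.maxInvEigE nE * massV κ (M.trisIn K) V2 V2 := by
  set t : Fin (M.dimEdge E) → ℝ := fun j => if j.1 < nE E then 0 else B.coefB P1 E j with ht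
  have hX : ∑ e ∈ M.edgesIn E, len e * presOn (partB P1 - B.interpB nE P1) e ^ 2 =
      ∑ j, t j ^ 2 := by
    rw [← orthonormal_parseval (M.edgesIn E) (B.trace E) (B.trace_orthonormal E) t]
    exact Finset.sum_congr rfl fun e he => by rw [B.presOn_error nE P1 hE he, pow_two]
  -- At a decoupled edge, the eigenfunction restricted to one side is an admissible test function;
  -- it has no divergence, so only the pressure on the edge remains.
  have htest : ∀ j, massV κ (M.trisIn K) V2 (B.second E j) = -(B.sgn K E * B.coefB P1 E j) := by
    intro j
    have hsp := (B.second_spec E j).1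
    have e1 : massV κ (M.trisIn K) V2 (B.second E j) =
        massV κ Finset.univ V2 (restr K (B.second E j)) := by
      rw [massV_univ_of_supp (S := M.trisIn K) _ _ fun τ hτ => restr_of_notMem hτ _]
      exact massV_congr (fun _ _ => rfl) fun τ hτ => (restr_of_mem hτ _).symm
    have e2 : divForm Finset.univ (partI P1) (restr K (B.second E j)) = 0 := by
      rw [divForm_univ_of_supp (S := M.trisIn K) _ _ fun τ hτ => restr_of_notMem hτ _,
        divForm_congr (fun _ _ => rfl) fun τ hτ => restr_of_mem hτ _]
      exact Finset.sum_eq_zero fun τ hτ => by rw [hsp.dvg_eq hK hτ]; ring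
    rw [e1, h2 _ (hsp.restr_mem_fineV hE K), coupling_apply, e2, B.jumpForm_restr hsp hE hK,
      zero_sub]
    rfl
  set W : M.Vel := ∑ j, t j • B.second E j with hW
  have hVW : massV κ (M.trisIn K) V2 W = -(B.sgn K E * ∑ j, t j ^ 2) := by
    simp only [hW, ← massVB_apply hκ, map_sum, map_smul, smul_eq_mul]
    rw [Finset.mul_sum, ← Finset.sum_neg_distrib]
    refine Finset.sum_congr rfl fun j _ => ?_
    rw [massVB_apply, htest]
    by_cases hj : j.1 < nE E
    · simp [ht, hj]
    · simp only [ht, if_neg hj]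
      ring
  have hEK := mem_eltsAt.1 hK
  have hWW := B.massV_sum_second_le hκ nE hEK t fun j hj => if_pos hj
  rw [hX]
  refine le_of_sq_le (massV_nonneg hκ _ _) (B.maxInvEigE_nonneg hκ nE) ?_
  calc (∑ j, t j ^ 2) ^ 2 = massV κ (M.trisIn K) V2 W ^ 2 := by
        rw [hVW, neg_sq, mul_pow, (B.sgn_spec hEK).1, one_mul]
    _ ≤ massV κ (M.trisIn K) V2 V2 * massV κ (M.trisIn K) W W := massV_sq_le hκ _ _ _
    _ ≤ _ := mul_le_mul_of_nonneg_left hWW (massV_nonneg hκ _ _)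

/-- The local bounds summed over the decoupled edges: every element has at most three edges. -/
lemma sum_presB_error (hκ : Coeff M κ) (nE : M.Edge → ℕ) {V2 : M.Vel} {P1 : M.Pres}
    (h2 : ∀ w ∈ M.fineV, massV κ Finset.univ V2 w = coupling P1 w) :
    ∑ E ∈ M.decoupledEdges, ∑ e ∈ M.edgesIn E,
        len e * presOn (partB P1 - B.interpB nE P1) e ^ 2 ≤
      3 * (B.maxInvEigE nE * normV2 κ V2) := by
  have hΛ := B.maxInvEigE_nonneg hκ nE
  have h1 : ∀ E ∈ M.decoupledEdges, ∑ e ∈ M.edgesIn E,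
      len e * presOn (partB P1 - B.interpB nE P1) e ^ 2 ≤
        ∑ K ∈ M.eltsAt E, B.maxInvEigE nE * massV κ (M.trisIn K) V2 V2 := by
    intro E hE
    obtain ⟨K, hK⟩ := M.eltsAt_nonempty E
    refine (B.presB_error_edge hκ nE h2 (mem_decoupledEdges.1 hE) hK).trans ?_
    exact Finset.single_le_sum
      (f := fun K : M.Elt => B.maxInvEigE nE * massV κ (M.trisIn K) V2 V2)
      (fun K _ => mul_nonneg hΛ (massV_nonneg hκ _ _)) hK
  refine (Finset.sum_le_sum h1).trans ?_
  refine (Finset.sum_le_sum_of_subset_of_nonneg (Finset.subset_univ _) fun E _ _ =>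
    Finset.sum_nonneg fun K _ => mul_nonneg hΛ (massV_nonneg hκ _ _)).trans ?_
  have h3 : ∑ E : M.Edge, ∑ K ∈ M.eltsAt E, B.maxInvEigE nE * massV κ (M.trisIn K) V2 V2 =
      ∑ K : M.Elt, ∑ E ∈ M.edgesOf K, B.maxInvEigE nE * massV κ (M.trisIn K) V2 V2 := by
    refine Finset.sum_comm' fun K E => ?_
    simp [mem_edgesOf, mem_eltsAt]
  rw [h3, normV2, massV_univ, Finset.mul_sum, Finset.mul_sum]
  refine Finset.sum_le_sum fun K _ => ?_
  rw [Finset.sum_const, nsmul_eq_mul]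
  exact mul_le_mul_of_nonneg_right (by exact_mod_cast edgesOf_card_le K)
    (mul_nonneg hΛ (massV_nonneg hκ _ _))

/-- The pressure error: element part and edge part, where the norm of the edge part gains a factor
`h`. -/
lemma pres_error (hκ : Coeff M κ) (hρ : Coeff M ρ) {R : ℝ} (hR0 : 0 ≤ R)
    (hR : ∀ x ∈ M.domain, ρ x ≤ R) (nE : M.Edge → ℕ) (mK : M.Elt → ℕ) {V2 : M.Vel} {P1 : M.Pres}
    (hP1 : P1 ∈ M.fineQhat) (h2 : ∀ w ∈ M.fineV, massV κ Finset.univ V2 w = coupling P1 w) :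
    normQ2 ρ (P1 - (B.interpI mK P1 + B.interpB nE P1)) ≤
      2 * (B.maxInvEigK mK * normV2 κ V2) +
        24 * R * (M.h * B.maxInvEigE nE * normV2 κ V2) := by
  have hsplit : P1 - (B.interpI mK P1 + B.interpB nE P1) =
      const (partI P1 - B.valI mK (partI P1)) + (partB P1 - B.interpB nE P1) := by
    rw [B.interpI_eq, ← constL_apply (partI P1 - _), map_sub, constL_apply, constL_apply]
    rw [sub_add_sub_comm, partI_add_partB]
  have hI : massQ ρ (const (partI P1 - B.valI mK (partI P1)))
      (const (partI P1 - B.valI mK (partI P1))) ≤ B.maxInvEigK mK * normV2 κ V2 := by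
    rw [massQ_const, sum_elts, normV2, massV_univ, Finset.mul_sum]
    exact Finset.sum_le_sum fun K _ => B.presI_error_elt hκ mK h2 K
  have hB := bubble_norm_le hρ hR0 hR
    (Submodule.sub_mem _ (partB_mem_bubbleQ hP1) (B.interpB_mem_bubbleQ nE P1))
  have hB' := mul_le_mul_of_nonneg_left (B.sum_presB_error hκ nE h2)
    (mul_nonneg (mul_nonneg (by norm_num : (0 : ℝ) ≤ 4) hR0) (h_nonneg (M := M)))
  rw [normQ2, hsplit]
  refine (massQ_add_le hρ _ _).trans ?_
  have e1 := hB.trans hB'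
  nlinarith [e1, hI]

/-- The interpolation errors of velocity and pressure together. The hypotheses are the
equations of the fine scheme that `V1 = v'`, `V2 = v''`, `P1 = p'`, `P2 = p''` satisfy with
`P0 = p` and `F = f'`. -/
lemma interp_error (hκ : Coeff M κ) (hρ : Coeff M ρ) {R : ℝ} (hR0 : 0 ≤ R)
    (hR : ∀ x ∈ M.domain, ρ x ≤ R) (nE : M.Edge → ℕ) (mK : M.Elt → ℕ) {V1 V2 : M.Vel}
    {P0 P1 P2 : M.Pres} {F : Plane → ℝ} (hF : MemLp F 2 (volume.restrict M.domain))
    (hV1 : V1 ∈ M.fineV) (hP1 : P1 ∈ M.fineQhat)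
    (h1 : ∀ w ∈ M.fineV, massV κ Finset.univ V1 w = coupling P0 w)
    (h2 : ∀ w ∈ M.fineV, massV κ Finset.univ V2 w = coupling P1 w)
    (h3 : ∀ q ∈ M.fineQhat, massQ ρ P2 q + coupling q V1 = source F q) :
    normV2 κ (V1 - B.interpV nE mK V1) +
        normQ2 ρ (P1 - (B.interpI mK P1 + B.interpB nE P1)) ≤
      (12 + 24 * R) * (B.maxInvEigE nE * (∑ E, edgeInner E V1 V1) +
        M.h * B.maxInvEigE nE * normV2 κ V2 +
        B.maxInvEigK mK * (residual2 ρ F P2 + normV2 κ V2)) := by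
  have e1 := B.vel_error hκ hρ nE mK hF hV1 h1 h3
  have e2 := B.pres_error hκ hρ hR0 hR nE mK hP1 h2
  have hΛ := B.maxInvEigE_nonneg hκ nE
  have hM := B.maxInvEigK_nonneg hκ mK
  have hV : 0 ≤ normV2 κ V2 := massV_nonneg hκ _ _
  have hres : 0 ≤ residual2 ρ F P2 := by
    rw [residual2_eq]
    exact Finset.sum_nonneg fun K _ => residualIn_nonneg hρ F P2 K
  have a1 : 0 ≤ B.maxInvEigE nE * ∑ E, edgeInner E V1 V1 :=
    mul_nonneg hΛ (Finset.sum_nonneg fun E _ => edgeInner_self_nonneg E V1)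
  have a2 : 0 ≤ M.h * B.maxInvEigE nE * normV2 κ V2 :=
    mul_nonneg (mul_nonneg h_nonneg hΛ) hV
  have a3 := mul_nonneg hM hres
  have a4 := mul_nonneg hM hV
  have b1 := mul_nonneg hR0 a1
  have b3 := mul_nonneg hR0 a3
  have b4 := mul_nonneg hR0 a4
  nlinarith

end Basis

end StaggeredMesh

/-! ### Dependence on time -/

/-- Grönwall's inequality in the form used for the energy of the discretization error. -/
lemma gronwall_le {T : ℝ} {y y' A : ℝ → ℝ}
    (hy : ∀ t ∈ Icc 0 T, HasDerivWithinAt y (y' t) (Icc 0 T) t) (hA : ContinuousOn A (Icc 0 T))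
    (hA0 : ∀ t ∈ Icc 0 T, 0 ≤ A t) (hle : ∀ t ∈ Icc 0 T, y' t ≤ A t + y t) (h0 : y 0 = 0)
    {t : ℝ} (ht : t ∈ Icc 0 T) : y t ≤ Real.exp T * ∫ s in (0 : ℝ)..T, A s := by
  have hT : 0 ≤ T := ht.1.trans ht.2
  have hint : IntervalIntegrable A volume 0 T := by
    refine ContinuousOn.intervalIntegrable ?_
    rwa [uIcc_of_le hT]
  have hprim : ContinuousOn (fun t => ∫ s in (0 : ℝ)..t, A s) (Icc 0 T) := by
    have := intervalIntegral.continuousOn_primitive_interval' hint left_mem_uIcc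
    rwa [uIcc_of_le hT] at this
  set z : ℝ → ℝ := fun t => Real.exp (-t) * y t - ∫ s in (0 : ℝ)..t, A s with hz
  have hcont : ContinuousOn z (Icc 0 T) :=
    ((Real.continuous_exp.comp continuous_neg).continuousOn.mul
      fun t ht => (hy t ht).continuousWithinAt).sub hprim
  have hder : ∀ t ∈ Ioo 0 T,
      HasDerivAt z (-Real.exp (-t) * y t + Real.exp (-t) * y' t - A t) t := by
    intro t ht
    have hnhds := Icc_mem_nhds ht.1 ht.2
    have h1 : HasDerivAt (fun t : ℝ => Real.exp (-t)) (-Real.exp (-t)) t := by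
      simpa using (hasDerivAt_neg t).exp
    have h2 : HasDerivAt (fun t => ∫ s in (0 : ℝ)..t, A s) (A t) t := by
      refine intervalIntegral.integral_hasDerivAt_right
        (hint.mono_set ?_) ?_ (hA.continuousAt hnhds)
      · rw [uIcc_of_le ht.1.le, uIcc_of_le hT]
        exact Icc_subset_Icc_right ht.2.le
      · exact (hA.mono Ioo_subset_Icc_self).stronglyMeasurableAtFilter isOpen_Ioo t ht
    exact (h1.mul ((hy t (Ioo_subset_Icc_self ht)).hasDerivAt hnhds)).sub h2
  -- The integrating factor `exp (-t)` makes `z` decreasing.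
  have hanti : AntitoneOn z (Icc 0 T) := by
    refine antitoneOn_of_deriv_nonpos (convex_Icc 0 T) hcont ?_ ?_
    · rw [interior_Icc]
      exact fun t ht => (hder t ht).differentiableAt.differentiableWithinAt
    · rw [interior_Icc]
      intro t ht
      rw [(hder t ht).deriv]
      have ht' := Ioo_subset_Icc_self ht
      have e0 := Real.exp_pos (-t)
      have e1 : Real.exp (-t) ≤ 1 := Real.exp_le_one_iff.2 (by linarith [ht.1])
      have e2 := mul_le_mul_of_nonneg_left (hle t ht') e0.le
      have e3 := mul_le_mul_of_nonneg_right e1 (hA0 t ht')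
      linarith
  have h1 : z t ≤ z 0 := hanti (left_mem_Icc.2 hT) ht ht.1
  have h2 : z 0 = 0 := by simp [hz, h0]
  have h3 : ∫ s in (0 : ℝ)..t, A s ≤ ∫ s in (0 : ℝ)..T, A s := by
    refine intervalIntegral.integral_mono_interval le_rfl ht.1 ht.2 ?_ hint
    filter_upwards [ae_restrict_mem measurableSet_Ioc] with s hs
    exact hA0 s ⟨hs.1.le, hs.2⟩
  have h4 : Real.exp (-t) * y t ≤ ∫ s in (0 : ℝ)..T, A s := by
    have : z t = Real.exp (-t) * y t - ∫ s in (0 : ℝ)..t, A s := rfl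
    linarith
  have h5 : 0 ≤ ∫ s in (0 : ℝ)..T, A s :=
    intervalIntegral.integral_nonneg hT hA0
  calc y t = Real.exp t * (Real.exp (-t) * y t) := by
        rw [← mul_assoc, ← Real.exp_add, add_neg_cancel, Real.exp_zero, one_mul]
    _ ≤ Real.exp t * ∫ s in (0 : ℝ)..T, A s :=
        mul_le_mul_of_nonneg_left h4 (Real.exp_pos t).le
    _ ≤ Real.exp T * ∫ s in (0 : ℝ)..T, A s :=
        mul_le_mul_of_nonneg_right (Real.exp_le_exp.2 ht.2) h5

section FiniteDimensional

variable {W W' : Type*} [NormedAddCommGroup W] [NormedSpace ℝ W] [FiniteDimensional ℝ W]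
  [NormedAddCommGroup W'] [NormedSpace ℝ W']

lemma hasDerivWithinAt_linear (L : W →ₗ[ℝ] W') {u : ℝ → W} {u' : W} {S : Set ℝ} {t : ℝ}
    (hu : HasDerivWithinAt u u' S t) : HasDerivWithinAt (fun s => L (u s)) (L u') S t :=
  L.toContinuousLinearMap.hasFDerivAt.comp_hasDerivWithinAt t hu

lemma continuousOn_linear (L : W →ₗ[ℝ] W') {u : ℝ → W} {S : Set ℝ} (hu : ContinuousOn u S) :
    ContinuousOn (fun s => L (u s)) S :=
  L.toContinuousLinearMap.continuous.comp_continuousOn hu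

lemma continuousOn_bilin (b : LinearMap.BilinForm ℝ W) {u v : ℝ → W} {S : Set ℝ}
    (hu : ContinuousOn u S) (hv : ContinuousOn v S) : ContinuousOn (fun s => b (u s) (v s)) S :=
  ((LinearMap.toContinuousBilinearMap b).continuous.comp_continuousOn hu).clm_apply hv

lemma hasDerivWithinAt_bilin (b : LinearMap.BilinForm ℝ W) {u v : ℝ → W} {u' v' : W} {S : Set ℝ}
    {t : ℝ} (hu : HasDerivWithinAt u u' S t) (hv : HasDerivWithinAt v v' S t) :
    HasDerivWithinAt (fun s => b (u s) (v s)) (b (u t) v' + b u' (v t)) S t :=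
  ContinuousLinearMap.hasDerivWithinAt_of_bilinear (B := LinearMap.toContinuousBilinearMap b) hu hv

/-- The derivative of a curve in a subspace stays in the subspace. -/
lemma derivWithin_mem {u : ℝ → W} {u' : W} {S : Set ℝ} (hS : UniqueDiffOn ℝ S) {t : ℝ}
    (ht : t ∈ S) (hu : HasDerivWithinAt u u' S t) (P : Submodule ℝ W) (hP : ∀ s ∈ S, u s ∈ P) :
    u' ∈ P := by
  by_contra hnot
  obtain ⟨φ, hφ, hker⟩ := Submodule.exists_le_ker_of_notMem hnot
  refine hφ ?_
  have h1 := hasDerivWithinAt_linear φ hu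
  have h2 : HasDerivWithinAt (fun s => φ (u s)) 0 S t :=
    (hasDerivWithinAt_const t S (0 : ℝ)).congr (fun s hs => hker (hP s hs)) (hker (hP t ht))
  exact (hS t ht).eq_deriv _ h1 h2

/-- An identity between functions of time may be differentiated. -/
lemma deriv_eq_of_eqOn {S : Set ℝ} (hS : UniqueDiffOn ℝ S) {g₁ g₂ : ℝ → W'} {d₁ d₂ : W'} {t : ℝ}
    (ht : t ∈ S) (h : ∀ s ∈ S, g₁ s = g₂ s) (h₁ : HasDerivWithinAt g₁ d₁ S t)
    (h₂ : HasDerivWithinAt g₂ d₂ S t) : d₁ = d₂ :=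
  (hS t ht).eq_deriv _ h₁ (h₂.congr h (h t ht))

end FiniteDimensional

namespace StaggeredMesh

variable {M : StaggeredMesh} {κ ρ : Plane → ℝ}

variable (M) in
/-- The space of the sources, `L²` of the domain. -/
abbrev L2 : Type := Lp ℝ 2 (volume.restrict M.domain)

lemma restrict_domain_hull (τ : M.Tri) :
    (volume.restrict M.domain).restrict (hull τ.1) = volume.restrict (hull τ.1) := by
  rw [Measure.restrict_restrict (measurableSet_hull _),
    inter_eq_left.2 (hull_subset_domain τ)]

lemma memLp_indicator_pres (τ : M.Tri) (q : M.Pres) :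
    MemLp ((hull τ.1).indicator (presAt q τ)) 2 (volume.restrict M.domain) := by
  rw [memLp_indicator_iff_restrict (measurableSet_hull _), restrict_domain_hull]
  have := finite_hull τ
  obtain ⟨C, hC⟩ := (isCompact_hull τ.1).exists_bound_of_continuousOn
    (continuous_presAt q τ).continuousOn
  refine MemLp.of_bound (continuous_presAt q τ).aestronglyMeasurable C ?_
  filter_upwards [ae_restrict_mem (measurableSet_hull _)] with x hx using hC x hx

/-- The restriction of `q` to the triangle `τ`, extended by zero, as a function in `L²`. -/
def presLp (τ : M.Tri) : M.Pres →ₗ[ℝ] M.L2 where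
  toFun q := (memLp_indicator_pres τ q).toLp
  map_add' p q := by
    rw [← MemLp.toLp_add]
    refine MemLp.toLp_congr _ _ (Filter.Eventually.of_forall fun x => ?_)
    by_cases hx : x ∈ hull τ.1 <;> simp [hx, presAt_add]
  map_smul' c q := by
    rw [RingHom.id_apply, ← MemLp.toLp_const_smul]
    refine MemLp.toLp_congr _ _ (Filter.Eventually.of_forall fun x => ?_)
    by_cases hx : x ∈ hull τ.1 <;> simp [hx, presAt_smul]

/-- `source` as a bilinear form, continuous in the source. -/
def sourceB : M.Pres →ₗ[ℝ] M.L2 →L[ℝ] ℝ :=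
  ∑ τ : M.Tri, ((ContinuousLinearMap.mul ℝ ℝ).lpPairing (volume.restrict M.domain)
    2 2).toLinearMap.comp (presLp τ)

lemma sourceB_apply (q : M.Pres) (g : M.L2) : sourceB q g = source g q := by
  rw [sourceB, LinearMap.sum_apply, sum_apply, source]
  refine Finset.sum_congr rfl fun τ _ => ?_
  rw [LinearMap.comp_apply, ContinuousLinearMap.coe_coe,
    ContinuousLinearMap.lpPairing_eq_integral]
  have h1 : ∀ᵐ x ∂(volume.restrict M.domain), ContinuousLinearMap.mul ℝ ℝ (presLp τ q x) (g x) =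
      (hull τ.1).indicator (fun x => g x * presAt q τ x) x := by
    filter_upwards [(memLp_indicator_pres τ q).coeFn_toLp] with x hx
    have : presLp τ q x = (hull τ.1).indicator (presAt q τ) x := hx
    rw [ContinuousLinearMap.mul_apply', this]
    by_cases hx : x ∈ hull τ.1
    · simp [hx, mul_comm]
    · simp [hx]
  rw [integral_congr_ae h1, integral_indicator (measurableSet_hull _), restrict_domain_hull]

lemma memLp_indicator_inv (hρ : Coeff M ρ) (τ : M.Tri) :
    MemLp ((hull τ.1).indicator fun x => (ρ x)⁻¹) ⊤ (volume.restrict M.domain) := by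
  rw [memLp_indicator_iff_restrict (measurableSet_hull _), restrict_domain_hull]
  obtain ⟨C, hC⟩ := hρ.inv.bound τ
  exact memLp_top_of_bound hρ.inv.1.aestronglyMeasurable C hC

/-- The weighted square norm on a triangle is continuous on `L²`, as multiplication by the bounded
function `ρ⁻¹` is. -/
lemma continuous_weighted (hρ : Coeff M ρ) (τ : M.Tri) :
    Continuous fun g : M.L2 => ∫ x in hull τ.1, (ρ x)⁻¹ * g x ^ 2 := by
  set m := (memLp_indicator_inv hρ τ).toLp with hm
  set A := (ContinuousLinearMap.mul ℝ ℝ).holderL (volume.restrict M.domain) ⊤ 2 2 m with hA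
  set b := (ContinuousLinearMap.mul ℝ ℝ).lpPairing (volume.restrict M.domain) 2 2 with hb
  have h1 : ∀ g : M.L2, ∫ x in hull τ.1, (ρ x)⁻¹ * g x ^ 2 = b (A g) g := by
    intro g
    rw [hb, ContinuousLinearMap.lpPairing_eq_integral]
    have h2 : ∀ᵐ x ∂(volume.restrict M.domain), ContinuousLinearMap.mul ℝ ℝ (A g x) (g x) =
        (hull τ.1).indicator (fun x => (ρ x)⁻¹ * g x ^ 2) x := by
      filter_upwards [(memLp_indicator_inv hρ τ).coeFn_toLp,
        (ContinuousLinearMap.mul ℝ ℝ).coeFn_holder (r := 2) m g] with x hx hx'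
      have h3 : A g x = m x * g x := hx'
      rw [ContinuousLinearMap.mul_apply', h3, hm, hx]
      by_cases hx : x ∈ hull τ.1
      · simp only [indicator_of_mem hx]
        ring
      · simp [hx]
    rw [integral_congr_ae h2, integral_indicator (measurableSet_hull _), restrict_domain_hull]
  simp only [h1]
  exact (b.continuous.comp A.continuous).clm_apply continuous_id

/-- The residual as a quadratic polynomial in terms that are continuous in the source and the
pressure. -/
lemma residual2_expand (hρ : Coeff M ρ) (g : M.L2) (q : M.Pres) :
    residual2 ρ g q = (∑ τ : M.Tri, ∫ x in hull τ.1, (ρ x)⁻¹ * g x ^ 2)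
      - 2 * sourceB q g + massQ ρ q q := by
  have hF : MemLp g 2 (volume.restrict M.domain) := Lp.memLp g
  rw [sourceB_apply, residual2, source, massQ, Finset.mul_sum, ← Finset.sum_sub_distrib,
    ← Finset.sum_add_distrib]
  refine Finset.sum_congr rfl fun τ _ => ?_
  have h2 : IntegrableOn (fun x => (ρ x)⁻¹ * g x ^ 2) (hull τ.1) :=
    hρ.inv.integrableOn_mul τ (memLp_hull hF τ).integrable_sq
  have h3 := integrableOn_source hF τ q
  have h4 := integrableOn_massQ hρ τ q q
  have h5 : IntegrableOn (fun x => (ρ x)⁻¹ * g x ^ 2 - 2 * (g x * presAt q τ x)) (hull τ.1) :=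
    h2.sub (h3.const_mul 2)
  rw [← integral_const_mul, ← integral_sub h2 (h3.const_mul 2), ← integral_add h5 h4]
  refine setIntegral_congr_fun (measurableSet_hull _) fun x hx => ?_
  have := (hρ.pos hx).ne'
  field_simp
  ring

lemma continuousOn_residual2 (hρ : Coeff M ρ) {g : ℝ → M.L2} {q : ℝ → M.Pres} {S : Set ℝ}
    (hg : ContinuousOn g S) (hq : ContinuousOn q S) :
    ContinuousOn (fun t => residual2 ρ (g t) (q t)) S := by
  simp only [residual2_expand hρ]
  refine ((continuousOn_finsetSum _ fun τ _ =>
    (continuous_weighted hρ τ).comp_continuousOn hg).sub (continuousOn_const.mul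
      ((continuousOn_linear sourceB hq).clm_apply hg))).add ?_
  exact continuousOn_bilin (massQB hρ) hq hq

lemma continuousOn_normV2 (hκ : Coeff M κ) {v : ℝ → M.Vel} {S : Set ℝ} (hv : ContinuousOn v S) :
    ContinuousOn (fun t => normV2 κ (v t)) S :=
  continuousOn_bilin (massVB hκ Finset.univ) hv hv

lemma continuousOn_edgeInner (E : M.Edge) {v : ℝ → M.Vel} {S : Set ℝ} (hv : ContinuousOn v S) :
    ContinuousOn (fun t => edgeInner E (v t) (v t)) S := by
  refine continuousOn_const.mul (continuousOn_finsetSum _ fun K _ =>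
    continuousOn_finsetSum _ fun e _ => continuousOn_const.mul
      (continuousOn_finsetSum _ fun τ _ => ?_))
  exact (continuousOn_linear (fluxL τ e) hv).mul (continuousOn_linear (fluxL τ e) hv)

lemma neg_two_mul_massV_le (hκ : Coeff M κ) (S : Finset M.Tri) (v w : M.Vel) :
    -(2 * massV κ S v w) ≤ massV κ S v v + massV κ S w w := by
  have h1 := massV_nonneg hκ S (v + w)
  have h2 := massV_comm κ S v w
  simp only [← massVB_apply hκ, map_add, LinearMap.add_apply] at h1 h2 ⊢
  linarith

lemma neg_two_mul_massQ_le (hρ : Coeff M ρ) (p q : M.Pres) :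
    -(2 * massQ ρ p q) ≤ massQ ρ p p + massQ ρ q q := by
  have h1 := massQ_nonneg hρ (p + q)
  have h2 := massQ_comm ρ p q
  simp only [← massQB_apply hρ, map_add, LinearMap.add_apply] at h1 h2 ⊢
  linarith

namespace IsSolution

variable {T : ℝ} {f : ℝ → M.L2} {V : Submodule ℝ M.Vel} {Q : Submodule ℝ M.Pres}
  {v : ℝ → M.Vel} {p : ℝ → M.Pres}

lemma massV_deriv (h : IsSolution κ ρ T f V Q v p) {t : ℝ} (ht : t ∈ Icc 0 T) {w : M.Vel}
    (hw : w ∈ V) :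
    massV κ Finset.univ (derivWithin v (Icc 0 T) t) w = coupling (p t) w := by
  have := h.eq_v t ht w hw
  rw [coupling_apply]
  linarith

lemma massQ_deriv (h : IsSolution κ ρ T f V Q v p) {t : ℝ} (ht : t ∈ Icc 0 T) {q : M.Pres}
    (hq : q ∈ Q) :
    massQ ρ (derivWithin p (Icc 0 T) t) q + coupling q (v t) = source (f t) q := by
  have := h.eq_p t ht q hq
  rw [coupling_apply]
  linarith

/-- The velocity equation, differentiated in time. -/
lemma massV_deriv2 (h : IsSolution κ ρ T f V Q v p) (hκ : Coeff M κ)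
    (hS : UniqueDiffOn ℝ (Icc 0 T)) {t : ℝ} (ht : t ∈ Icc 0 T) {v2 : M.Vel} {p1 : M.Pres}
    (hv2 : HasDerivWithinAt (derivWithin v (Icc 0 T)) v2 (Icc 0 T) t)
    (hp1 : HasDerivWithinAt p p1 (Icc 0 T) t) {w : M.Vel} (hw : w ∈ V) :
    massV κ Finset.univ v2 w = coupling p1 w :=
  deriv_eq_of_eqOn hS ht (fun _ hs => h.massV_deriv hs hw)
    (hasDerivWithinAt_linear ((massVB hκ Finset.univ).flip w) hv2)
    (hasDerivWithinAt_linear (coupling.flip w) hp1)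

/-- The pressure equation, differentiated in time. -/
lemma massQ_deriv2 (h : IsSolution κ ρ T f V Q v p) (hρ : Coeff M ρ)
    (hS : UniqueDiffOn ℝ (Icc 0 T)) {t : ℝ} (ht : t ∈ Icc 0 T) {v1 : M.Vel} {p2 : M.Pres}
    {f1 : M.L2} (hv1 : HasDerivWithinAt v v1 (Icc 0 T) t)
    (hp2 : HasDerivWithinAt (derivWithin p (Icc 0 T)) p2 (Icc 0 T) t)
    (hf1 : HasDerivWithinAt f f1 (Icc 0 T) t) {q : M.Pres} (hq : q ∈ Q) :
    massQ ρ p2 q + coupling q v1 = source f1 q := by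
  rw [← sourceB_apply]
  refine deriv_eq_of_eqOn hS ht (fun s hs => ?_)
    ((hasDerivWithinAt_linear ((massQB hρ).flip q) hp2).add
      (hasDerivWithinAt_linear (coupling q) hv1))
    ((sourceB q).hasFDerivAt.comp_hasDerivWithinAt t hf1)
  exact (h.massQ_deriv hs hq).trans (sourceB_apply q (f s)).symm

end IsSolution

namespace Basis

variable (B : Basis M κ ρ)

/-- The energy of the difference between the interpolant of the fine solution and the multiscale
solution grows at most at the rate of the interpolation error of the time derivatives: by the
Galerkin orthogonality of the interpolants, the coupling terms cancel. -/
lemma energy_deriv_le (hκ : Coeff M κ) (hρ : Coeff M ρ) (nE : M.Edge → ℕ) (mK : M.Elt → ℕ)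
    {v1 v v1H vH : M.Vel} {p1 p p1H pH : M.Pres} {F : Plane → ℝ} (hv : v ∈ M.fineV)
    (hvH : vH ∈ B.coarseV nE mK) (hpH : pH ∈ B.coarseQ nE mK)
    (h1 : ∀ w ∈ M.fineV, massV κ Finset.univ v1 w = coupling p w)
    (h2 : ∀ q ∈ M.fineQhat, massQ ρ p1 q + coupling q v = source F q)
    (h1H : ∀ w ∈ B.coarseV nE mK, massV κ Finset.univ v1H w = coupling pH w)
    (h2H : ∀ q ∈ B.coarseQ nE mK, massQ ρ p1H q + coupling q vH = source F q) :
    2 * massV κ Finset.univ (B.interpV nE mK v1 - v1H) (B.interpV nE mK v - vH) +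
        2 * massQ ρ (B.interpI mK p1 + B.interpB nE p1 - p1H)
          (B.interpI mK p + B.interpB nE p - pH) ≤
      normV2 κ (v1 - B.interpV nE mK v1) +
        normQ2 ρ (p1 - (B.interpI mK p1 + B.interpB nE p1)) +
      (normV2 κ (B.interpV nE mK v - vH) +
        normQ2 ρ (B.interpI mK p + B.interpB nE p - pH)) := by
  set ev := B.interpV nE mK v - vH with hev
  set ep := B.interpI mK p + B.interpB nE p - pH with hep
  have hev' : ev ∈ B.coarseV nE mK := Submodule.sub_mem _ (B.interpV_mem nE mK hv) hvH
  have hep' : ep ∈ B.coarseQ nE mK := Submodule.sub_mem _ (B.interpQ_mem nE mK p) hpH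
  -- Both schemes are tested with the errors, which belong to the multiscale spaces.
  have a1 := h1 ev (B.coarseV_le_fineV nE mK hev')
  have a2 := h1H ev hev'
  have a3 := h2 ep (B.coarseQ_le_fineQhat nE mK hep')
  have a4 := h2H ep hep'
  -- Galerkin orthogonality allows exchanging the fine solution for its interpolant in the coupling.
  have a5 := B.coupling_pres_error nE mK p hev'
  have a6 := B.coupling_vel_error hκ nE mK hv hep'
  have a7 : coupling ep ev = coupling (B.interpI mK p + B.interpB nE p) ev - coupling pH ev := by
    rw [hep, map_sub coupling, LinearMap.sub_apply]
  have a8 : coupling ep ev = coupling ep (B.interpV nE mK v) - coupling ep vH := by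
    rw [hev, map_sub]
  rw [map_sub coupling, LinearMap.sub_apply] at a5
  rw [map_sub] at a6
  have d1 : massV κ Finset.univ (B.interpV nE mK v1 - v1H) ev =
      coupling p ev - coupling pH ev - massV κ Finset.univ (v1 - B.interpV nE mK v1) ev := by
    rw [← a1, ← a2]
    simp only [← massVB_apply hκ, map_sub, LinearMap.sub_apply]
    ring
  have d2 : massQ ρ (B.interpI mK p1 + B.interpB nE p1 - p1H) ep =
      coupling ep vH - coupling ep v -
        massQ ρ (p1 - (B.interpI mK p1 + B.interpB nE p1)) ep := by
    have e1 : coupling ep vH - coupling ep v = massQ ρ p1 ep - massQ ρ p1H ep := by linarith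
    rw [e1]
    simp only [← massQB_apply hρ, map_sub, LinearMap.sub_apply]
    ring
  -- The coupling terms of `d1` and `d2` cancel in the sum; Young's inequality splits the rest.
  have f1 := neg_two_mul_massV_le hκ Finset.univ (v1 - B.interpV nE mK v1) ev
  have f2 := neg_two_mul_massQ_le hρ (p1 - (B.interpI mK p1 + B.interpB nE p1)) ep
  simp only [normV2, normQ2]
  linarith

/-- The error estimate, with the constant made explicit and the time integrals collected. -/
lemma error_le (hκ : Coeff M κ) (hρ : Coeff M ρ) {R : ℝ} (hR0 : 0 ≤ R)
    (hR : ∀ x ∈ M.domain, ρ x ≤ R) {T : ℝ} (hT : 0 < T) {f : ℝ → M.L2}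
    (hf : ContDiffOn ℝ 1 f (Icc 0 T)) (nE : M.Edge → ℕ) (mK : M.Elt → ℕ)
    {v vH : ℝ → M.Vel} {p pH : ℝ → M.Pres} (h : IsSolution κ ρ T f M.fineV M.fineQhat v p)
    (hv : ContDiffOn ℝ 2 v (Icc 0 T)) (hp : ContDiffOn ℝ 2 p (Icc 0 T))
    (hH : IsSolution κ ρ T f (B.coarseV nE mK) (B.coarseQ nE mK) vH pH) {t : ℝ}
    (ht : t ∈ Icc 0 T) :
    normV2 κ (B.interpV nE mK (v t) - vH t) +
        normQ2 ρ (B.interpI mK (p t) + B.interpB nE (p t) - pH t) ≤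
      Real.exp T * (12 + 24 * R) *
        (B.maxInvEigE nE * (∑ E : M.Edge, ∫ s in (0 : ℝ)..T,
            edgeInner E (derivWithin v (Icc 0 T) s) (derivWithin v (Icc 0 T) s))
          + M.h * B.maxInvEigE nE * (∫ s in (0 : ℝ)..T,
              normV2 κ (iteratedDerivWithin 2 v (Icc 0 T) s))
          + B.maxInvEigK mK * (∫ s in (0 : ℝ)..T,
              (residual2 ρ (⇑(derivWithin f (Icc 0 T) s)) (iteratedDerivWithin 2 p (Icc 0 T) s)
                + normV2 κ (iteratedDerivWithin 2 v (Icc 0 T) s)))) := by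
  have hS : UniqueDiffOn ℝ (Icc 0 T) := uniqueDiffOn_Icc hT
  have hit : ∀ {W : Type} [NormedAddCommGroup W] [NormedSpace ℝ W] (u : ℝ → W),
      iteratedDerivWithin 2 u (Icc 0 T) = derivWithin (derivWithin u (Icc 0 T)) (Icc 0 T) := by
    intro W _ _ u
    rw [iteratedDerivWithin_succ, iteratedDerivWithin_one]
  have hder : ∀ {W : Type} [NormedAddCommGroup W] [NormedSpace ℝ W] {u : ℝ → W},
      ContDiffOn ℝ 2 u (Icc 0 T) → ∀ s ∈ Icc 0 T,
      HasDerivWithinAt u (derivWithin u (Icc 0 T) s) (Icc 0 T) s ∧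
      HasDerivWithinAt (derivWithin u (Icc 0 T)) (iteratedDerivWithin 2 u (Icc 0 T) s)
        (Icc 0 T) s := by
    intro W _ _ u hu s hs
    have h1 : ContDiffOn ℝ 1 (derivWithin u (Icc 0 T)) (Icc 0 T) :=
      hu.derivWithin hS (by norm_num)
    refine ⟨(hu.differentiableOn (by norm_num) s hs).hasDerivWithinAt, ?_⟩
    rw [hit]
    exact (h1.differentiableOn (by norm_num) s hs).hasDerivWithinAt
  have cv1 : ContinuousOn (derivWithin v (Icc 0 T)) (Icc 0 T) :=
    fun s hs => ((hder hv s hs).2).continuousWithinAt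
  have cv2 : ContinuousOn (iteratedDerivWithin 2 v (Icc 0 T)) (Icc 0 T) :=
    hv.continuousOn_iteratedDerivWithin le_rfl hS
  have cp2 : ContinuousOn (iteratedDerivWithin 2 p (Icc 0 T)) (Icc 0 T) :=
    hp.continuousOn_iteratedDerivWithin le_rfl hS
  have cf1 : ContinuousOn (derivWithin f (Icc 0 T)) (Icc 0 T) :=
    hf.continuousOn_derivWithin hS le_rfl
  set a₁ : M.Edge → ℝ → ℝ := fun E s =>
    edgeInner E (derivWithin v (Icc 0 T) s) (derivWithin v (Icc 0 T) s) with ha₁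
  set a₂ : ℝ → ℝ := fun s => normV2 κ (iteratedDerivWithin 2 v (Icc 0 T) s) with ha₂
  set a₃ : ℝ → ℝ := fun s => residual2 ρ (⇑(derivWithin f (Icc 0 T) s))
    (iteratedDerivWithin 2 p (Icc 0 T) s) + normV2 κ (iteratedDerivWithin 2 v (Icc 0 T) s) with ha₃
  have c₁ : ∀ E, ContinuousOn (a₁ E) (Icc 0 T) := fun E => continuousOn_edgeInner E cv1
  have c₂ : ContinuousOn a₂ (Icc 0 T) := continuousOn_normV2 hκ cv2
  have c₃ : ContinuousOn a₃ (Icc 0 T) := (continuousOn_residual2 hρ cf1 cp2).add c₂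
  set A : ℝ → ℝ := fun s => (12 + 24 * R) * (B.maxInvEigE nE * (∑ E, a₁ E s) +
    M.h * B.maxInvEigE nE * a₂ s + B.maxInvEigK mK * a₃ s) with hA
  have cA : ContinuousOn A (Icc 0 T) :=
    continuousOn_const.mul (((continuousOn_const.mul
      (continuousOn_finsetSum _ fun E _ => c₁ E)).add (continuousOn_const.mul c₂)).add
        (continuousOn_const.mul c₃))
  -- The time derivatives inherit the spatial estimate from the once differentiated equations.
  have herr : ∀ s ∈ Icc 0 T,
      normV2 κ (derivWithin v (Icc 0 T) s - B.interpV nE mK (derivWithin v (Icc 0 T) s)) +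
        normQ2 ρ (derivWithin p (Icc 0 T) s - (B.interpI mK (derivWithin p (Icc 0 T) s) +
          B.interpB nE (derivWithin p (Icc 0 T) s))) ≤ A s := by
    intro s hs
    obtain ⟨hv1, hv2⟩ := hder hv s hs
    obtain ⟨hp1, hp2⟩ := hder hp s hs
    have hf1 := (hf.differentiableOn (by norm_num) s hs).hasDerivWithinAt
    exact B.interp_error hκ hρ hR0 hR nE mK (Lp.memLp _)
      (derivWithin_mem hS hs hv1 _ h.v_mem) (derivWithin_mem hS hs hp1 _ h.p_mem)
      (fun w hw => h.massV_deriv hs hw) (fun w hw => h.massV_deriv2 hκ hS hs hv2 hp1 hw)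
      (fun q hq => h.massQ_deriv2 hρ hS hs hv1 hp2 hf1 hq)
  -- The energy of the error, with its derivative computed from the product rule, as the
  -- interpolants are linear in the solution.
  have hgron := gronwall_le (T := T)
    (y := fun s => normV2 κ (B.interpV nE mK (v s) - vH s) +
      normQ2 ρ (B.interpI mK (p s) + B.interpB nE (p s) - pH s))
    (y' := fun s =>
      2 * massV κ Finset.univ (B.interpV nE mK (derivWithin v (Icc 0 T) s) -
        derivWithin vH (Icc 0 T) s) (B.interpV nE mK (v s) - vH s) +
      2 * massQ ρ (B.interpI mK (derivWithin p (Icc 0 T) s) +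
        B.interpB nE (derivWithin p (Icc 0 T) s) - derivWithin pH (Icc 0 T) s)
          (B.interpI mK (p s) + B.interpB nE (p s) - pH s))
    (A := A) ?_ cA ?_ ?_ ?_ ht
  · refine hgron.trans (le_of_eq ?_)
    have int : ∀ {g : ℝ → ℝ}, ContinuousOn g (Icc 0 T) → IntervalIntegrable g volume 0 T := by
      intro g hg
      refine ContinuousOn.intervalIntegrable ?_
      rwa [uIcc_of_le hT.le]
    have i₁ : IntervalIntegrable (fun s => B.maxInvEigE nE * ∑ E, a₁ E s) volume 0 T :=
      int (continuousOn_const.mul (continuousOn_finsetSum _ fun E _ => c₁ E))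
    have i₂ : IntervalIntegrable (fun s => M.h * B.maxInvEigE nE * a₂ s) volume 0 T :=
      int (continuousOn_const.mul c₂)
    have i₃ : IntervalIntegrable (fun s => B.maxInvEigK mK * a₃ s) volume 0 T :=
      int (continuousOn_const.mul c₃)
    have hint : ∫ s in (0 : ℝ)..T, A s = (12 + 24 * R) *
        (B.maxInvEigE nE * (∑ E, ∫ s in (0 : ℝ)..T, a₁ E s) +
          M.h * B.maxInvEigE nE * (∫ s in (0 : ℝ)..T, a₂ s) +
          B.maxInvEigK mK * ∫ s in (0 : ℝ)..T, a₃ s) := by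
      rw [hA, intervalIntegral.integral_const_mul, intervalIntegral.integral_add (i₁.add i₂) i₃,
        intervalIntegral.integral_add i₁ i₂, intervalIntegral.integral_const_mul,
        intervalIntegral.integral_const_mul, intervalIntegral.integral_const_mul,
        intervalIntegral.integral_finsetSum fun E _ => int (c₁ E)]
    rw [hint, ← mul_assoc]
  · intro s hs
    have dv := (hder hv s hs).1
    have dp := (hder hp s hs).1
    have dvH := (hH.v_diff s hs).hasDerivWithinAt
    have dpH := (hH.p_diff s hs).hasDerivWithinAt
    have e1 := (hasDerivWithinAt_linear (B.interpVL nE mK) dv).sub dvH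
    have e2 := (hasDerivWithinAt_linear (B.interpQL hρ nE mK) dp).sub dpH
    have e3 := (hasDerivWithinAt_bilin (massVB hκ Finset.univ) e1 e1).add
      (hasDerivWithinAt_bilin (massQB hρ) e2 e2)
    simp only [interpVL_apply, interpQL_apply, massVB_apply, massQB_apply, Pi.sub_apply] at e3
    refine e3.congr_deriv ?_
    rw [massV_comm κ _ (B.interpV nE mK (v s) - vH s), massQ_comm ρ (_ + _ - pH s)]
    ring
  · intro s hs
    exact le_trans (add_nonneg (massV_nonneg hκ _ _) (massQ_nonneg hρ _)) (herr s hs)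
  · intro s hs
    refine (B.energy_deriv_le hκ hρ nE mK (h.v_mem s hs) (hH.v_mem s hs) (hH.p_mem s hs)
      (fun w hw => h.massV_deriv hs hw) (fun q hq => h.massQ_deriv hs hq)
      (fun w hw => hH.massV_deriv hs hw) (fun q hq => hH.massQ_deriv hs hq)).trans ?_
    exact add_le_add_left (herr s hs) _
  · have z1 : B.interpV nE mK (v 0) - vH 0 = 0 := by
      rw [h.v_zero, hH.v_zero, ← interpVL_apply, map_zero, sub_zero]
    have z2 : B.interpI mK (p 0) + B.interpB nE (p 0) - pH 0 = 0 := by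
      rw [h.p_zero, hH.p_zero, ← B.interpQL_apply hρ, map_zero, sub_zero]
    simp only [z1, z2, normV2, normQ2, ← massVB_apply hκ, ← massQB_apply hρ, map_zero, add_zero]

end Basis

end StaggeredMesh

end

end MixedGMsFEM

theorem mainTheorem2 (T : ℝ) (hT : 0 < T) (R : ℝ) (hR : 0 < R) :
    ∃ C : ℝ, 0 < C ∧
      ∀ (M : MixedGMsFEM.StaggeredMesh) (κ ρ : MixedGMsFEM.Plane → ℝ),
        Measurable κ → Measurable ρ →
        (∃ a b : ℝ, 0 < a ∧ ∀ x ∈ M.domain, a ≤ κ x ∧ κ x ≤ b) →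
        (∃ a : ℝ, 0 < a ∧ ∀ x ∈ M.domain, a ≤ ρ x ∧ ρ x ≤ R) →
      ∀ (f : ℝ → MeasureTheory.Lp ℝ 2 (MeasureTheory.volume.restrict M.domain)),
        ContDiffOn ℝ 1 f (Set.Icc 0 T) →
      ∀ (B : MixedGMsFEM.StaggeredMesh.Basis M κ ρ) (nE : M.Edge → ℕ) (mK : M.Elt → ℕ),
        (∀ E, nE E ≤ M.dimEdge E) → (∀ K, mK K ≤ M.dimElt K) →
      ∀ (v : ℝ → M.Vel) (p : ℝ → M.Pres) (vH : ℝ → M.Vel) (pH : ℝ → M.Pres),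
        MixedGMsFEM.StaggeredMesh.IsSolution κ ρ T f M.fineV M.fineQhat v p →
        ContDiffOn ℝ 2 v (Set.Icc 0 T) → ContDiffOn ℝ 2 p (Set.Icc 0 T) →
        MixedGMsFEM.StaggeredMesh.IsSolution κ ρ T f (B.coarseV nE mK) (B.coarseQ nE mK) vH pH →
      ∀ t ∈ Set.Icc 0 T,
        MixedGMsFEM.StaggeredMesh.normV2 κ (B.interpV nE mK (v t) - vH t) +
          MixedGMsFEM.StaggeredMesh.normQ2 ρ
            (B.interpI mK (p t) + B.interpB nE (p t) - pH t) ≤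
        C * (B.maxInvEigE nE * (∑ E : M.Edge, ∫ s in (0 : ℝ)..T,
              MixedGMsFEM.StaggeredMesh.edgeInner E
                (derivWithin v (Set.Icc 0 T) s) (derivWithin v (Set.Icc 0 T) s))
          + M.h * B.maxInvEigE nE * (∫ s in (0 : ℝ)..T,
              MixedGMsFEM.StaggeredMesh.normV2 κ (iteratedDerivWithin 2 v (Set.Icc 0 T) s))
          + B.maxInvEigK mK * (∫ s in (0 : ℝ)..T,
              (MixedGMsFEM.StaggeredMesh.residual2 ρ (⇑(derivWithin f (Set.Icc 0 T) s))
                  (iteratedDerivWithin 2 p (Set.Icc 0 T) s)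
                + MixedGMsFEM.StaggeredMesh.normV2 κ
                    (iteratedDerivWithin 2 v (Set.Icc 0 T) s)))) := by
  refine ⟨Real.exp T * (12 + 24 * R), by positivity, ?_⟩
  rintro M κ ρ hκm hρm hκ ⟨a, ha, hρ⟩ f hf B nE mK - - v p vH pH h hv hp hH t ht
  exact B.error_le ⟨hκm, hκ⟩ ⟨hρm, a, R, ha, hρ⟩ hR.le (fun x hx => (hρ x hx).2) hT hf nE mK h hv hp
    hH ht
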